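/- Let $(Z,g)$ be a closed (compact, without boundary, not necessarily connected) smooth Riemannian manifold, where points of different components are at distance $\infty$. Let $B_1,\dots,B_D$ be closed balls in $Z$, where $B_i$ has a center $p_i$ and a radius $r_i$ with $0<r_i\le 1/100$, such that the concentric closed balls $\tfrac12B_i$ of radius $r_i/2$ cover $Z$. (In particular this holds for every "good cover" in the sense of Guth.) Let $N\subset\prod_{i=1}^D[0,r_i]$ be the rectangular nerve of this cover, that is, the union of the open faces $$F=\{x : x_i=0\ (i\in I_0),\ x_i=r_i\ (i\in I_1),\ 0<x_i<r_i\ (i\in I_{(0,1)})\}$$ over all partitions $\{1,\dots,D\}=I_0\sqcup I_1\sqcup I_{(0,1)}$ such that $I_1\neq\emptyset$ and $\bigcap_{i\in I_1\cup I_{(0,1)}}B_i\neq\emptyset$. Let $\phi=(\phi_1,\dots,\phi_D):Z\to N$, where the functions $\phi_i:Z\to[0,r_i]$ are any functions with Lipschitz constant at most $2$ such that $\phi_i=r_i$ on $\tfrac12B_i$ and $\phi_i=0$ outside $B_i$ (these conditions imply that $\phi$ takes values in $N$). Let $\Sigma$ be a closed aspherical manifold (compact, without boundary, connected, with $\pi_k(\Sigma)=0$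 for all $k\ge2$), and let $f:Z\to\Sigma$ be a continuous map such that for every loop $\gamma$ in $Z$ of length at most $1$ the loop $f\circ\gamma$ is null-homotopic in $\Sigma$. Then there is a continuous map $\psi:N\to\Sigma$ such that $\psi\circ\phi:Z\to\Sigma$ is homotopic to $f$. -/

import Mathlib

open scoped Manifold ContDiff ENNReal Topology Bundle

/-- The length of a continuous curve in a metric space: the supremum of the lengths of the
inscribed polygons. -/
noncomputable def curveLength {Z : Type*} [PseudoEMetricSpace Z] {x y : Z} (γ : Path x y) : ℝ≥0∞ :=
  eVariationOn (fun t : unitInterval => γ t) Set.univ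

/-- A space is aspherical if it is path connected and all its homotopy groups in degrees at least
two are trivial. -/
structure IsAspherical (X : Type*) [TopologicalSpace X] : Prop where
  pathConnected : PathConnectedSpace X
  subsingleton_homotopyGroup : ∀ (k : ℕ), 2 ≤ k → ∀ x : X, Subsingleton (π_ k X x)

/-- A family of closed balls `B i`, `i = 1, …, D`, of positive radii, such that the concentric
balls of half the radius cover the space. Distances may be infinite (between points of different
components). -/
structure BallCover (Z : Type*) [PseudoEMetricSpace Z] (D : ℕ) where
  center : Fin D → Z
  radius : Fin D → ℝ
  radius_pos : ∀ i, 0 < radius i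
  half_cover : ∀ z : Z, ∃ i, z ∈ Metric.closedEBall (center i) (ENNReal.ofReal (radius i / 2))

namespace BallCover

variable {Z : Type*} [PseudoEMetricSpace Z] {D : ℕ}

/-- The closed ball `B i`. -/
def ball (B : BallCover Z D) (i : Fin D) : Set Z :=
  Metric.closedEBall (B.center i) (ENNReal.ofReal (B.radius i))

/-- The concentric closed ball of half the radius. -/
def halfBall (B : BallCover Z D) (i : Fin D) : Set Z :=
  Metric.closedEBall (B.center i) (ENNReal.ofReal (B.radius i / 2))

/-- The open face of the rectangle `∏ i, [0, r i]` on which the coordinates in `I₀` are `0`, those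
in `I₁` are maximal, and the others lie strictly in between. -/
def openFace (B : BallCover Z D) (I₀ I₁ : Set (Fin D)) : Set (Fin D → ℝ) :=
  {x | (∀ i ∈ I₀, x i = 0) ∧ (∀ i ∈ I₁, x i = B.radius i) ∧
    ∀ i, i ∉ I₀ → i ∉ I₁ → 0 < x i ∧ x i < B.radius i}

/-- The rectangular nerve: the union of the open faces `(I₀, I₁)` of the rectangle such that `I₁`
is nonempty and the balls `B i`, where `i` runs over the complement of `I₀`, have a common point. -/
def nerve (B : BallCover Z D) : Set (Fin D → ℝ) :=
  {x | ∃ I₀ I₁ : Set (Fin D), Disjoint I₀ I₁ ∧ I₁.Nonempty ∧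
    (⋂ i ∈ I₀ᶜ, B.ball i).Nonempty ∧ x ∈ B.openFace I₀ I₁}

/-- A choice of coordinate functions `φ i : Z → [0, r i]`: `2`-Lipschitz, equal to `r i` on the
half ball, and supported on the ball `B i`. -/
structure NerveCoordinates (B : BallCover Z D) where
  toFun : Fin D → Z → ℝ
  mem_Icc : ∀ i z, toFun i z ∈ Set.Icc 0 (B.radius i)
  eq_radius : ∀ i, ∀ z ∈ B.halfBall i, toFun i z = B.radius i
  eq_zero : ∀ i, ∀ z ∉ B.ball i, toFun i z = 0
  lipschitz : ∀ i, LipschitzWith 2 (toFun i)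

theorem NerveCoordinates.mem_nerve {B : BallCover Z D} (φ : B.NerveCoordinates) (z : Z) :
    (fun i => φ.toFun i z) ∈ B.nerve := by
  refine ⟨{i | φ.toFun i z = 0}, {i | φ.toFun i z = B.radius i}, ?_, ?_, ⟨z, ?_⟩, ?_, ?_, ?_⟩
  · rw [Set.disjoint_left]
    intro i (h0 : φ.toFun i z = 0) (h1 : φ.toFun i z = B.radius i)
    have := B.radius_pos i
    linarith
  · obtain ⟨i, hi⟩ := B.half_cover z
    exact ⟨i, φ.eq_radius i z hi⟩
  · simp only [Set.mem_iInter]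
    intro i hi
    by_contra h
    exact hi (φ.eq_zero i z h)
  · exact fun i hi => hi
  · exact fun i hi => hi
  · intro i h0 h1
    exact ⟨lt_of_le_of_ne (φ.mem_Icc i z).1 (Ne.symm h0), lt_of_le_of_ne (φ.mem_Icc i z).2 h1⟩

/-- The map `φ : Z → N` to the rectangular nerve with the given coordinate functions. -/
def NerveCoordinates.toNerve {B : BallCover Z D} (φ : B.NerveCoordinates) : C(Z, B.nerve) where
  toFun z := ⟨fun i => φ.toFun i z, φ.mem_nerve z⟩
  continuous_toFun :=
    Continuous.subtype_mk (continuous_pi fun i => (φ.lipschitz i).continuous) _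

end BallCover

/-! After dividing the `i`-th coordinate by `r i`, the nerve lies in a finite cubical complex
(`nerveComplex`): every coordinate is 0, strictly between 0 and 1, or 1. Each cell has a coordinate
equal to 1, and all its faces share this coordinate. The map on the complex is built by skeleta. A
vertex `v` goes to `f (ζ v)`, where `ζ v` is a common point of the balls with nonzero coordinate.
Two vertices of one cell have their points in a common ball, hence at distance at most 1/50, and an
edge goes to the image under `f` of a curve of length less than 1/2. The class of such an image does
not depend on the curve, because two of them form a loop of length at most 1, which `f` kills. This
fills the squares; cells of dimension at least 3 are filled because the higher homotopy groups
vanish (`exists_isShortOn`).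

To compare `ψ ∘ φ` with `f`, a homotopy class of paths from `ψ (φ z)` to `f z` is chosen for each
`z`: straight to a vertex `v` of the cell of `φ z`, then in the short class from `f (ζ v)` to `f z`.
The class does not depend on `v` (`NerveCoordinates.IsTrack.homotopic`), and near a given point a
single `v` serves all tracks, so the classes fit together along paths (`isPathSystem_isTrack`).

Obstruction theory turns such a path system into a homotopy (`IsPathSystem.homotopic`). Over a
subdivided cube, the selected classes give the vertical edges of the cylinder, consistency fills the
vertical squares, and asphericity fills the rest. No triangulation of `Z` is needed: `Z` is covered
by finitely many chart cubes, and the homotopy is extended over one cube after another. It is kept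
on a closed set in the interior of its previous domain, and the cube is subdivided finely relative
to that set. -/

/-- A continuous map on a compact space that is constant on the fibres of a continuous map `Q` to a
Hausdorff space factors through the image of `Q`. -/
theorem exists_continuousOn_factor {A E S : Type*} [TopologicalSpace A] [CompactSpace A]
    [TopologicalSpace E] [T2Space E] [TopologicalSpace S] [Nonempty S] {Q : A → E}
    (hQ : Continuous Q) {h : A → S} (hh : Continuous h) (hfac : ∀ a b, Q a = Q b → h a = h b) :
    ∃ u : E → S, ContinuousOn u (Set.range Q) ∧ ∀ a, u (Q a) = h a := by
  classical
  obtain ⟨s₀⟩ := ‹Nonempty S›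
  have hext : ∀ a, Function.extend Q h (fun _ => s₀) (Q a) = h a := fun a =>
    Function.FactorsThrough.extend_apply (fun a b hab => hfac a b hab) _ a
  refine ⟨Function.extend Q h fun _ => s₀, ?_, hext⟩
  rw [continuousOn_iff_continuous_domRestrict]
  have hq : Topology.IsQuotientMap (Set.rangeFactorization Q) :=
    IsClosedMap.isQuotientMap
      ((hQ.subtype_mk _).isClosedMap) (hQ.subtype_mk _) Set.rangeFactorization_surjective
  rw [hq.continuous_iff]
  convert hh using 1
  ext a
  exact hext a

/-! ### Balls as cones over collapsed cubes: filling spheres when `π_d` is trivial -/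

namespace SphereParam

variable {d : ℕ}

/-- The centred coordinates `2 x - 1` on the unit cube. -/
noncomputable def centred (x : Fin d → unitInterval) : Fin d → ℝ := fun i => 2 * (x i : ℝ) - 1

theorem continuous_centred : Continuous (centred (d := d)) := by
  unfold centred; fun_prop

theorem centred_injective : Function.Injective (centred (d := d)) := by
  intro x y h
  ext i
  have := congrFun h i
  simp only [centred] at this
  linarith

theorem norm_centred_le (x : Fin d → unitInterval) : ‖centred x‖ ≤ 1 := by
  rw [pi_norm_le_iff_of_nonneg zero_le_one]
  intro i
  have h0 := (x i).2.1
  have h1 := (x i).2.2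
  rw [Real.norm_eq_abs, abs_le]
  constructor <;> simp only [centred] <;> linarith

theorem mem_boundary_of_norm_centred (hd : 0 < d) {x : Fin d → unitInterval}
    (h : ‖centred x‖ = 1) : x ∈ Cube.boundary (Fin d) := by
  have : Nonempty (Fin d) := ⟨⟨0, hd⟩⟩
  obtain ⟨i, hi⟩ : ∃ i, ‖centred x‖ = ‖centred x i‖ := by
    obtain ⟨i, -, hi⟩ := Finset.exists_max_image Finset.univ (fun i => ‖centred x i‖)
      Finset.univ_nonempty
    refine ⟨i, le_antisymm ?_ (norm_le_pi_norm _ i)⟩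
    exact (pi_norm_le_iff_of_nonneg (norm_nonneg _)).2 fun j => hi j (Finset.mem_univ j)
  rw [h, Real.norm_eq_abs] at hi
  refine ⟨i, ?_⟩
  rcases (abs_eq zero_le_one).1 hi.symm with h | h
  · right
    ext
    simp only [centred] at h
    simp only [Set.Icc.coe_one]
    linarith
  · left
    ext
    simp only [centred] at h
    simp only [Set.Icc.coe_zero]
    linarith

theorem exists_centred_eq {y : Fin d → ℝ} (hy : ‖y‖ ≤ 1) : ∃ x, centred x = y := by
  have h : ∀ i, |y i| ≤ 1 := fun i => (norm_le_pi_norm y i).trans hy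
  refine ⟨fun i => ⟨(y i + 1) / 2, ?_, ?_⟩, ?_⟩
  · have := (abs_le.1 (h i)).1
    linarith
  · have := (abs_le.1 (h i)).2
    linarith
  · ext i
    simp only [centred]
    ring

/-- The factor by which the cube is squeezed at distance `s` from its centre. -/
noncomputable def squeeze (s : ℝ) : ℝ := min 2 ((2 - 2 * s) / max s (1 / 2))

theorem continuous_squeeze : Continuous squeeze := by
  unfold squeeze
  refine continuous_const.min (Continuous.div (by fun_prop) (by fun_prop) fun s => ?_)
  have : (1 / 2 : ℝ) ≤ max s (1 / 2) := le_max_right _ _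
  linarith

/-- The tail of `wrap x` must have norm `1 - |2 * s - 1|` with `s = ‖centred x‖`, since its first
coordinate is `2 * s - 1`. The minimum and maximum in `squeeze` avoid the division by zero at the
centre. -/
theorem squeeze_mul (s : ℝ) : squeeze s * s = 1 - |2 * s - 1| := by
  unfold squeeze
  rcases le_total s (1 / 2) with h | h
  · rw [max_eq_right h, min_eq_left, abs_of_nonpos] <;> linarith
  · have hs : 0 < s := by linarith
    rw [max_eq_left h, min_eq_right, abs_of_nonneg]
    · field_simp
      ring
    · linarith
    · rw [div_le_iff₀ hs]
      linarith

theorem squeeze_nonneg {s : ℝ} (h1 : s ≤ 1) : 0 ≤ squeeze s := by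
  unfold squeeze
  refine le_min zero_le_two (div_nonneg (by linarith) ?_)
  exact le_trans (by norm_num) (le_max_right _ _)

theorem squeeze_pos {s : ℝ} (h1 : s < 1) : 0 < squeeze s := by
  unfold squeeze
  refine lt_min zero_lt_two (div_pos (by linarith) ?_)
  exact lt_of_lt_of_le (by norm_num) (le_max_right _ _)

/-- The map from the cube to the boundary of the cross-polytope-like body `|t| + ‖y‖ ≤ 1` which
collapses the boundary of the cube to a point. -/
noncomputable def wrap (x : Fin d → unitInterval) : Fin (d + 1) → ℝ :=
  Fin.cons (2 * ‖centred x‖ - 1) (squeeze ‖centred x‖ • centred x)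

theorem continuous_wrap : Continuous (wrap (d := d)) := by
  have h := continuous_centred (d := d)
  have h' := continuous_squeeze
  refine continuous_pi fun i => ?_
  refine Fin.cases ?_ (fun i => ?_) i
  · simp only [wrap, Fin.cons_zero]
    fun_prop
  · simp only [wrap, Fin.cons_succ]
    exact ((continuous_apply i).comp ((h'.comp h.norm).smul h))

/-- The norm `|t| + ‖y‖`. -/
noncomputable def sumNorm (v : Fin (d + 1) → ℝ) : ℝ := |v 0| + ‖Fin.tail v‖

theorem sumNorm_smul {c : ℝ} (hc : 0 ≤ c) (v : Fin (d + 1) → ℝ) :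
    sumNorm (c • v) = c * sumNorm v := by
  have : Fin.tail (c • v) = c • Fin.tail v := rfl
  simp only [sumNorm, this, norm_smul, Pi.smul_apply, smul_eq_mul, abs_mul, abs_of_nonneg hc,
    Real.norm_eq_abs]
  ring

theorem sumNorm_pos {v : Fin (d + 1) → ℝ} (hv : v ≠ 0) : 0 < sumNorm v := by
  by_contra h
  have h0 : |v 0| = 0 := le_antisymm
    (by have := norm_nonneg (Fin.tail v); unfold sumNorm at h; linarith) (abs_nonneg _)
  have h1 : ‖Fin.tail v‖ = 0 := le_antisymm
    (by have := abs_nonneg (v 0); unfold sumNorm at h; linarith) (norm_nonneg _)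
  apply hv
  ext i
  refine Fin.cases ?_ (fun i => ?_) i
  · simpa using h0
  · exact congrFun (norm_eq_zero.1 h1) i

theorem sumNorm_wrap (x : Fin d → unitInterval) : sumNorm (wrap x) = 1 := by
  have h := norm_centred_le x
  simp only [sumNorm, wrap, Fin.cons_zero, Fin.tail_cons, norm_smul, Real.norm_eq_abs,
    abs_of_nonneg (squeeze_nonneg h), squeeze_mul]
  ring

theorem wrap_ne_zero (x : Fin d → unitInterval) : wrap x ≠ 0 := by
  intro h
  have h1 := sumNorm_wrap x
  have : Fin.tail (0 : Fin (d + 1) → ℝ) = 0 := rfl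
  rw [h, sumNorm, this] at h1
  simp at h1

/-- The first coordinate recovers the distance from the centre. If it is less than 1, the squeezing
factor is positive and can be cancelled; if it is 1, both points lie on the boundary of the cube. -/
theorem wrap_eq_wrap (hd : 0 < d) {x y : Fin d → unitInterval} (h : wrap x = wrap y) :
    x = y ∨ x ∈ Cube.boundary (Fin d) ∧ y ∈ Cube.boundary (Fin d) := by
  have h0 : ‖centred x‖ = ‖centred y‖ := by
    have := congrFun h 0
    simp only [wrap, Fin.cons_zero] at this
    linarith
  rcases (norm_centred_le x).lt_or_eq with h1 | h1
  · left
    have h2 := congrArg Fin.tail h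
    simp only [wrap, Fin.tail_cons, ← h0] at h2
    exact centred_injective (smul_right_injective _ (squeeze_pos h1).ne' h2)
  · exact Or.inr ⟨mem_boundary_of_norm_centred hd h1, mem_boundary_of_norm_centred hd (h0 ▸ h1)⟩

theorem exists_wrap_eq (hd : 0 < d) {v : Fin (d + 1) → ℝ} (hv : sumNorm v = 1) :
    ∃ x, wrap x = v := by
  obtain ⟨t, y, rfl⟩ : ∃ t y, v = Fin.cons t y := ⟨v 0, Fin.tail v, (Fin.cons_self_tail v).symm⟩
  simp only [sumNorm, Fin.cons_zero, Fin.tail_cons] at hv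
  have : Nonempty (Fin d) := ⟨⟨0, hd⟩⟩
  have ht : |t| ≤ 1 := by have := norm_nonneg y; linarith
  rw [abs_le] at ht
  suffices h : ∃ z : Fin d → ℝ, ‖z‖ = (t + 1) / 2 ∧ squeeze ((t + 1) / 2) • z = y by
    obtain ⟨z, hz, hzy⟩ := h
    obtain ⟨x, rfl⟩ := exists_centred_eq (y := z) (by linarith)
    refine ⟨x, ?_⟩
    rw [wrap, hz, hzy]
    congr 1
    ring
  rcases eq_or_ne y 0 with rfl | hy
  · have ht1 : |t| = 1 := by simpa using hv
    -- These are the two poles: `t = 1` comes from the boundary of the cube, here from a corner, and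
    -- `t = -1` from its centre.
    rcases (abs_eq zero_le_one).1 ht1 with rfl | rfl
    · refine ⟨fun _ => 1, by norm_num, ?_⟩
      norm_num [squeeze]
    · exact ⟨0, by norm_num, by simp⟩
  · have hy' : 0 < ‖y‖ := norm_pos_iff.2 hy
    refine ⟨((t + 1) / 2 / ‖y‖) • y, ?_, ?_⟩
    · rw [norm_smul, Real.norm_eq_abs, abs_of_nonneg (div_nonneg (by linarith) hy'.le)]
      field_simp
    · have h := squeeze_mul ((t + 1) / 2)
      have h2 : 2 * ((t + 1) / 2) - 1 = t := by ring
      rw [h2] at h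
      rw [smul_smul, ← mul_div_assoc, h, show 1 - |t| = ‖y‖ by linarith, div_self hy'.ne', one_smul]

/-- The parametrization of the unit ball as a cone over the collapsed cube. -/
noncomputable def cone (p : (Fin d → unitInterval) × unitInterval) : Fin (d + 1) → ℝ :=
  ((p.2 : ℝ) * ‖wrap p.1‖⁻¹) • wrap p.1

theorem continuous_cone : Continuous (cone (d := d)) := by
  have h : Continuous fun p : (Fin d → unitInterval) × unitInterval => wrap p.1 :=
    continuous_wrap.comp continuous_fst
  exact ((continuous_subtype_val.comp continuous_snd).mul
    (h.norm.inv₀ fun p => norm_ne_zero_iff.2 (wrap_ne_zero _))).smul h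

theorem norm_cone (p : (Fin d → unitInterval) × unitInterval) : ‖cone p‖ = p.2 := by
  have h := norm_pos_iff.2 (wrap_ne_zero p.1)
  rw [cone, norm_smul, Real.norm_eq_abs, abs_of_nonneg (mul_nonneg p.2.2.1 (inv_nonneg.2 h.le)),
    mul_assoc, inv_mul_cancel₀ h.ne', mul_one]

/-- The sup norm recovers the radius. At positive radius the two values of `wrap` are positive
multiples of each other, and they are equal because both have `sumNorm` equal to 1. -/
theorem cone_eq_cone (hd : 0 < d) {p q : (Fin d → unitInterval) × unitInterval}
    (h : cone p = cone q) : p.2 = q.2 ∧ (p.2 = 0 ∨ p.1 = q.1 ∨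
      p.1 ∈ Cube.boundary (Fin d) ∧ q.1 ∈ Cube.boundary (Fin d)) := by
  have h2 : p.2 = q.2 := by
    ext
    rw [← norm_cone, ← norm_cone, h]
  refine ⟨h2, or_iff_not_imp_left.2 fun h0 => wrap_eq_wrap hd ?_⟩
  have h0' : 0 < (p.2 : ℝ) := lt_of_le_of_ne p.2.2.1 fun h => h0 (Subtype.ext h.symm)
  have hp := norm_pos_iff.2 (wrap_ne_zero p.1)
  have hq := norm_pos_iff.2 (wrap_ne_zero q.1)
  have h3 : (‖wrap p.1‖⁻¹) • wrap p.1 = (‖wrap q.1‖⁻¹) • wrap q.1 := by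
    rw [cone, cone, ← h2, mul_smul, mul_smul] at h
    exact smul_right_injective _ h0'.ne' h
  have h4 := congrArg sumNorm h3
  rw [sumNorm_smul (inv_nonneg.2 hp.le), sumNorm_smul (inv_nonneg.2 hq.le), sumNorm_wrap,
    sumNorm_wrap, mul_one, mul_one] at h4
  rw [h4] at h3
  exact smul_right_injective _ (inv_pos.2 hq).ne' h3

theorem exists_cone_eq (hd : 0 < d) {v : Fin (d + 1) → ℝ} (hv : ‖v‖ ≤ 1) : ∃ p, cone p = v := by
  rcases eq_or_ne v 0 with rfl | h
  · exact ⟨(fun _ => 0, 0), by simp [cone]⟩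
  · have hs := sumNorm_pos h
    have hn := norm_pos_iff.2 h
    obtain ⟨x, hx⟩ := exists_wrap_eq hd (v := (sumNorm v)⁻¹ • v)
      (by rw [sumNorm_smul (inv_nonneg.2 hs.le), inv_mul_cancel₀ hs.ne'])
    refine ⟨(x, ⟨‖v‖, hn.le, hv⟩), ?_⟩
    rw [cone, hx, norm_smul, smul_smul, Real.norm_eq_abs, abs_of_pos (inv_pos.2 hs)]
    have : ‖v‖ * ((sumNorm v)⁻¹ * ‖v‖)⁻¹ * (sumNorm v)⁻¹ = 1 := by field_simp
    rw [this, one_smul]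

end SphereParam

open SphereParam in
/-- If `π_d` is trivial at all base points, then a continuous map on the unit sphere of the sup norm
in dimension `d + 1` extends to the unit ball. -/
theorem exists_extension_closedBall {S : Type*} [TopologicalSpace S] {d : ℕ} (hd : 0 < d)
    (hS : ∀ x : S, Subsingleton (π_ d S x)) {u : (Fin (d + 1) → ℝ) → S}
    (hu : ContinuousOn u (Metric.sphere 0 1)) :
    ∃ u' : (Fin (d + 1) → ℝ) → S, ContinuousOn u' (Metric.closedBall 0 1) ∧
      Set.EqOn u' u (Metric.sphere 0 1) := by
  have hw : ∀ x : Fin d → unitInterval, cone (x, 1) ∈ Metric.sphere (0 : Fin (d + 1) → ℝ) 1 :=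
    fun x => by rw [mem_sphere_zero_iff_norm, norm_cone]; rfl
  have hcont : Continuous fun x : Fin d → unitInterval => u (cone (x, 1)) :=
    hu.comp_continuous (continuous_cone.comp (by fun_prop)) hw
  have hb : ∀ x ∈ Cube.boundary (Fin d), cone (x, 1) = cone ((fun _ => 0 : Fin d → unitInterval), 1) := by
    -- Since `squeeze 1 = 0`, the whole boundary of the cube goes to the pole, so `u` restricts to a
    -- loop based at its value there.
    have key : ∀ x ∈ Cube.boundary (Fin d), wrap x = Fin.cons 1 0 := by
      rintro x ⟨i, hi⟩
      have h1 : ‖centred x‖ = 1 := by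
        refine le_antisymm (norm_centred_le x) (le_trans ?_ (norm_le_pi_norm _ i))
        rcases hi with hi | hi <;> norm_num [centred, hi]
      rw [wrap, h1]
      norm_num [squeeze]
    intro x hx
    have h0 : (fun _ => 0 : Fin d → unitInterval) ∈ Cube.boundary (Fin d) :=
      ⟨⟨0, hd⟩, Or.inl rfl⟩
    simp only [cone, key x hx, key _ h0]
  let x₀ : S := u (cone ((fun _ => 0 : Fin d → unitInterval), 1))
  let g : GenLoop (Fin d) S x₀ := ⟨⟨_, hcont⟩, fun x hx => by
    simp only [ContinuousMap.coe_mk, hb x hx, x₀]⟩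
  -- The homotopy parameter becomes the radius. Starting at the constant loop makes the map
  -- single-valued at the centre of the ball.
  have hg : GenLoop.Homotopic GenLoop.const g :=
    Quotient.exact ((hS x₀).elim (Quotient.mk _ GenLoop.const) (Quotient.mk _ g))
  obtain ⟨H⟩ := hg
  have : Nonempty S := ⟨x₀⟩
  have hH0 : ∀ x, H (0, x) = x₀ := fun x => H.apply_zero x
  have hHb : ∀ t, ∀ x ∈ Cube.boundary (Fin d), H (t, x) = x₀ := fun t x hx =>
    (H.eq_fst t hx)
  obtain ⟨u', hu', hu'2⟩ := exists_continuousOn_factor (continuous_cone (d := d))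
    (h := fun p => H (p.2, p.1)) (by fun_prop) (by
      intro p q hpq
      obtain ⟨h1, h2⟩ := cone_eq_cone hd hpq
      obtain ⟨p1, p2⟩ := p
      obtain ⟨q1, q2⟩ := q
      simp only at h1 h2 ⊢
      subst h1
      rcases h2 with rfl | rfl | ⟨h3, h4⟩
      · rw [hH0, hH0]
      · rfl
      · rw [hHb _ _ h3, hHb _ _ h4])
  refine ⟨u', hu'.mono fun v hv => ?_, fun v hv => ?_⟩
  · exact exists_cone_eq hd (mem_closedBall_zero_iff.1 hv)
  · rw [mem_sphere_zero_iff_norm] at hv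
    obtain ⟨⟨x, r⟩, rfl⟩ := exists_cone_eq hd hv.le
    have hr : r = 1 := by
      ext
      rw [norm_cone] at hv
      exact hv
    subst hr
    rw [hu'2]
    exact H.apply_one x

/-! ### Images of paths in convex sets, and cancellation in the fundamental groupoid -/

section ImagePath

variable {E S : Type*} [AddCommGroup E] [Module ℝ E] [TopologicalSpace E]
  [IsTopologicalAddGroup E] [ContinuousSMul ℝ E] [TopologicalSpace S]

/-- The straight path from `x` to `y`. -/
noncomputable def segPath (x y : E) : Path x y where
  toFun t := AffineMap.lineMap x y (t : ℝ)
  continuous_toFun := by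
    simp only [AffineMap.lineMap_apply_module]
    fun_prop
  source' := by simp
  target' := by simp

theorem segPath_apply (x y : E) (t : unitInterval) :
    segPath x y t = AffineMap.lineMap x y (t : ℝ) := rfl

theorem segPath_mem {K : Set E} (hK : Convex ℝ K) {x y : E} (hx : x ∈ K) (hy : y ∈ K)
    (t : unitInterval) : segPath x y t ∈ K :=
  hK.lineMap_mem hx hy t.2

/-- The path `p` is the image under `G` of the path `α`, which runs in `K`. -/
def IsImagePath {E : Type*} [TopologicalSpace E] (K : Set E) (G : E → S) {x y : E} (α : Path x y)
    {a b : S} (p : Path a b) : Prop :=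
  ∀ t, α t ∈ K ∧ p t = G (α t)

namespace IsImagePath

theorem trans {E : Type*} [TopologicalSpace E] {K : Set E} {G : E → S} {x y z : E} {α : Path x y}
    {β : Path y z} {a b c : S} {p : Path a b} {q : Path b c} (hp : IsImagePath K G α p)
    (hq : IsImagePath K G β q) : IsImagePath K G (α.trans β) (p.trans q) := by
  intro t
  rw [Path.trans_apply, Path.trans_apply]
  split_ifs
  · exact hp _
  · exact hq _

theorem exists_path {E : Type*} [TopologicalSpace E] {K : Set E} {G : E → S}
    (hG : ContinuousOn G K) {x y : E} {α : Path x y} (hα : ∀ t, α t ∈ K) {a b : S}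
    (ha : G x = a) (hb : G y = b) : ∃ p : Path a b, IsImagePath K G α p :=
  ⟨⟨⟨fun t => G (α t), hG.comp_continuous α.continuous hα⟩, by simp [ha], by simp [hb]⟩,
    fun t => ⟨hα t, rfl⟩⟩

/-- Images of two paths with the same end points in a convex set are homotopic. -/
theorem homotopic {K : Set E} (hK : Convex ℝ K) {G : E → S} (hG : ContinuousOn G K) {x y : E}
    {α β : Path x y} {a b : S} {p q : Path a b} (hp : IsImagePath K G α p)
    (hq : IsImagePath K G β q) : p.Homotopic q := by
  have hmem : ∀ s : unitInterval × unitInterval,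
      AffineMap.lineMap (α s.2) (β s.2) (s.1 : ℝ) ∈ K := fun s =>
    hK.lineMap_mem (hp s.2).1 (hq s.2).1 s.1.2
  refine ⟨⟨⟨⟨fun s => G (AffineMap.lineMap (α s.2) (β s.2) (s.1 : ℝ)), ?_⟩, ?_, ?_⟩, ?_⟩⟩
  · refine hG.comp_continuous ?_ hmem
    simp only [AffineMap.lineMap_apply_module]
    fun_prop
  · intro t
    simpa using (hp t).2.symm
  · intro t
    simpa using (hq t).2.symm
  · rintro s t (rfl | rfl)
    · simp [(hp 0).2]
    · simp [(hp 1).2]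

end IsImagePath

/-- In a convex set, the image of a broken segment is homotopic to the image of the segment. -/
theorem homotopic_of_triangle {K : Set E} (hK : Convex ℝ K) {G : E → S} (hG : ContinuousOn G K)
    {x y z : E} {a b c : S} {p : Path a b} {q : Path b c} {r : Path a c}
    (hp : IsImagePath K G (segPath x y) p) (hq : IsImagePath K G (segPath y z) q)
    (hr : IsImagePath K G (segPath x z) r) : (p.trans q).Homotopic r :=
  (hp.trans hq).homotopic hK hG hr

end ImagePath

namespace Path.Homotopic

variable {X : Type*} [TopologicalSpace X] {a b c : X}

theorem cancel_left {p : Path a b} {q q' : Path b c} (h : (p.trans q).Homotopic (p.trans q')) :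
    q.Homotopic q' := by
  rw [← Quotient.eq] at h ⊢
  simp only [Quotient.mk_trans] at h
  have := congrArg (fun r => (Quotient.mk p).symm.trans r) h
  simpa only [← Quotient.trans_assoc, Quotient.symm_trans, Quotient.refl_trans] using this

theorem assoc {d : X} (p : Path a b) (q : Path b c) (r : Path c d) :
    ((p.trans q).trans r).Homotopic (p.trans (q.trans r)) := by
  rw [← Quotient.eq]
  simp only [Quotient.mk_trans, Quotient.trans_assoc]

theorem of_trans_symm {p q : Path a b} (h : (p.trans q.symm).Homotopic (Path.refl a)) :
    p.Homotopic q := by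
  rw [← Quotient.eq] at h ⊢
  simp only [Quotient.mk_trans, Quotient.mk_symm] at h
  have := congrArg (fun r => r.trans (Quotient.mk q)) h
  simpa only [Quotient.trans_assoc, Quotient.symm_trans, Quotient.trans_refl,
    Quotient.mk_refl, Quotient.refl_trans] using this

end Path.Homotopic

/-! ### Filling a square from a homotopy between its two boundary paths -/

namespace SquareParam

/-- The path along the lower and right sides of the square `[-1, 1]²`. -/
noncomputable def lower (s : ℝ) : ℝ × ℝ := (min (4 * s - 1) 1, max (-1) (4 * s - 3))

/-- The linear homotopy from the lower to the upper boundary path of the square. -/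
noncomputable def sweep (p : unitInterval × unitInterval) : Fin 2 → ℝ :=
  ![(1 - p.1) * (lower p.2).1 + p.1 * (lower p.2).2, (1 - p.1) * (lower p.2).2 + p.1 * (lower p.2).1]

theorem continuous_sweep : Continuous sweep := by
  refine continuous_pi fun i => ?_
  fin_cases i <;> simp [sweep, lower] <;> fun_prop

/-- The sweep moves a point along the line where the sum of the coordinates is constant, so this sum
recovers `s`. The difference of the coordinates is multiplied by `1 - 2 * t`; by `lower_sub` it
determines `t` except at the two corners where `s` is 0 or 1. -/
theorem lower_add (s : ℝ) : (lower s).1 + (lower s).2 = 4 * s - 2 := by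
  unfold lower
  rcases le_total s (1 / 2) with h | h
  · rw [min_eq_left (by linarith), max_eq_left (by linarith)]; ring
  · rw [min_eq_right (by linarith), max_eq_right (by linarith)]; ring

theorem lower_sub (s : ℝ) : (lower s).1 - (lower s).2 = 2 - |4 * s - 2| := by
  unfold lower
  rcases le_total s (1 / 2) with h | h
  · rw [min_eq_left (by linarith), max_eq_left (by linarith), abs_of_nonpos (by linarith)]; ring
  · rw [min_eq_right (by linarith), max_eq_right (by linarith), abs_of_nonneg (by linarith)]; ring

theorem sweep_eq_sweep {p q : unitInterval × unitInterval} (h : sweep p = sweep q) :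
    p.2 = q.2 ∧ (p.2 = 0 ∨ p.2 = 1 ∨ p.1 = q.1) := by
  have h0 := congrFun h 0
  have h1 := congrFun h 1
  simp only [sweep, Matrix.cons_val_zero, Matrix.cons_val_one] at h0 h1
  have hp := lower_add p.2
  have hq := lower_add q.2
  have h2 : p.2 = q.2 := by
    ext
    linear_combination (h0 + h1 - hp + hq) / 4
  refine ⟨h2, ?_⟩
  rw [← h2] at h0 h1
  by_contra hne
  push Not at hne
  obtain ⟨ha, hb, hc⟩ := hne
  have hs := lower_sub p.2
  have ha' : (0 : ℝ) < p.2 := lt_of_le_of_ne p.2.2.1 fun h => ha (Subtype.ext h.symm)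
  have hb' : (p.2 : ℝ) < 1 := lt_of_le_of_ne p.2.2.2 fun h => hb (Subtype.ext h)
  have hpos : |4 * (p.2 : ℝ) - 2| < 2 := by
    rw [abs_lt]
    constructor <;> linarith
  have h3 : ((p.1 : ℝ) - q.1) * ((lower p.2).1 - (lower p.2).2) = 0 := by
    linear_combination (h1 - h0) / 2
  rw [hs] at h3
  rcases mul_eq_zero.1 h3 with h3 | h3
  · exact hc (Subtype.ext (by linarith))
  · linarith

theorem exists_sweep_eq {v : Fin 2 → ℝ} (hv : ‖v‖ ≤ 1) : ∃ p, sweep p = v := by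
  have h0 := abs_le.1 ((norm_le_pi_norm v 0).trans hv)
  have h1 := abs_le.1 ((norm_le_pi_norm v 1).trans hv)
  set s : ℝ := (v 0 + v 1 + 2) / 4 with hs
  have hadd := lower_add s
  have hsub := lower_sub s
  have h4 : 4 * s - 2 = v 0 + v 1 := by rw [hs]; ring
  rw [h4] at hadd hsub
  -- In general `|x - y| + |x + y| = 2 * max |x| |y|`, which is at most 2 on the square.
  have hD : |v 0 - v 1| ≤ 2 - |v 0 + v 1| := by
    rcases abs_cases (v 0 - v 1) with h | h <;> rcases abs_cases (v 0 + v 1) with h' | h' <;>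
      linarith
  have hs01 : s ∈ unitInterval := ⟨by linarith, by linarith⟩
  obtain ⟨t, ht, hteq⟩ : ∃ t ∈ unitInterval, (1 - 2 * t) * (2 - |v 0 + v 1|) = v 0 - v 1 := by
    rcases eq_or_ne (2 - |v 0 + v 1|) 0 with h | h
    · rw [h] at hD ⊢
      have := abs_nonpos_iff.1 hD
      exact ⟨0, unitInterval.zero_mem, by linarith⟩
    · have hpos : 0 < 2 - |v 0 + v 1| := lt_of_le_of_ne ((abs_nonneg _).trans hD) h.symm
      have h5 := abs_le.1 hD
      refine ⟨(1 - (v 0 - v 1) / (2 - |v 0 + v 1|)) / 2, ⟨?_, ?_⟩, ?_⟩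
      · have : (v 0 - v 1) / (2 - |v 0 + v 1|) ≤ 1 := (div_le_one hpos).2 h5.2
        linarith
      · have : -1 ≤ (v 0 - v 1) / (2 - |v 0 + v 1|) := by
          rw [le_div_iff₀ hpos]
          linarith
        linarith
      · field_simp
        ring
  refine ⟨(⟨t, ht⟩, ⟨s, hs01⟩), ?_⟩
  ext i
  fin_cases i
  · simp only [sweep, Fin.zero_eta, Matrix.cons_val_zero]
    linear_combination hadd / 2 + (1 - 2 * t) * hsub / 2 + hteq / 2
  · simp only [sweep, Fin.mk_one, Matrix.cons_val_one, Matrix.cons_val_fin_one]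
    linear_combination hadd / 2 - (1 - 2 * t) * hsub / 2 - hteq / 2

end SquareParam

open SquareParam in
/-- A continuous map on the boundary of the square `[-1, 1]²` extends to the square if the images of
the two boundary paths from one corner to the opposite one are homotopic. -/
theorem exists_extension_square {S : Type*} [TopologicalSpace S] {u : (Fin 2 → ℝ) → S}
    {s₀₀ s₁₀ s₀₁ s₁₁ : S} {a : Path s₀₀ s₁₀} {b : Path s₁₀ s₁₁} {c : Path s₀₀ s₀₁}
    {d : Path s₀₁ s₁₁} (ha : ∀ t, a t = u (segPath ![-1, -1] ![1, -1] t))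
    (hb : ∀ t, b t = u (segPath ![1, -1] ![1, 1] t))
    (hc : ∀ t, c t = u (segPath ![-1, -1] ![-1, 1] t))
    (hd : ∀ t, d t = u (segPath ![-1, 1] ![1, 1] t))
    (h : (a.trans b).Homotopic (c.trans d)) :
    ∃ u' : (Fin 2 → ℝ) → S, ContinuousOn u' (Metric.closedBall 0 1) ∧
      Set.EqOn u' u (Metric.sphere 0 1) := by
  obtain ⟨H⟩ := h
  have hlow : ∀ s : unitInterval, (a.trans b) s = u (sweep (0, s)) := by
    intro s
    rw [Path.trans_apply]
    split_ifs with hs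
    · rw [ha]
      congr 1
      ext i
      have hs' : (s : ℝ) ≤ 1 / 2 := hs
      fin_cases i <;> simp [sweep, lower, segPath_apply, AffineMap.lineMap_apply_module]
      · rw [min_eq_left (by linarith)]; ring
      · rw [max_eq_left (by linarith)]; ring
    · rw [hb]
      congr 1
      ext i
      have hs' : (1 / 2 : ℝ) ≤ s := (not_le.1 hs).le
      fin_cases i <;> simp [sweep, lower, segPath_apply, AffineMap.lineMap_apply_module]
      · linarith
      · rw [max_eq_right (by linarith)]; ring
  have hupp : ∀ s : unitInterval, (c.trans d) s = u (sweep (1, s)) := by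
    intro s
    rw [Path.trans_apply]
    split_ifs with hs
    · rw [hc]
      congr 1
      ext i
      have hs' : (s : ℝ) ≤ 1 / 2 := hs
      fin_cases i <;> simp [sweep, lower, segPath_apply, AffineMap.lineMap_apply_module]
      · rw [max_eq_left (by linarith)]; ring
      · rw [min_eq_left (by linarith)]; ring
    · rw [hd]
      congr 1
      ext i
      have hs' : (1 / 2 : ℝ) ≤ s := (not_le.1 hs).le
      fin_cases i <;> simp [sweep, lower, segPath_apply, AffineMap.lineMap_apply_module]
      · rw [max_eq_right (by linarith)]; ring
      · linarith
  have : Nonempty S := ⟨s₀₀⟩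
  obtain ⟨u', hu', hu'2⟩ := exists_continuousOn_factor continuous_sweep (h := H) H.continuous (by
    rintro ⟨t, s⟩ ⟨t', s'⟩ hpq
    obtain ⟨h1, h2⟩ := sweep_eq_sweep hpq
    simp only at h1 h2
    subst h1
    rcases h2 with rfl | rfl | rfl
    · rw [H.source, H.source]
    · rw [H.target, H.target]
    · rfl)
  refine ⟨u', hu'.mono fun v hv => exists_sweep_eq (mem_closedBall_zero_iff.1 hv), fun v hv => ?_⟩
  rw [mem_sphere_zero_iff_norm] at hv
  obtain ⟨⟨t, s⟩, rfl⟩ := exists_sweep_eq hv.le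
  rw [hu'2]
  -- For `s` and `t` strictly inside the interval, both coordinates of the swept point are strict
  -- convex combinations of two distinct numbers in `[-1, 1]`, so the point is not on the boundary
  -- of the square.
  suffices hts : s = 0 ∨ s = 1 ∨ t = 0 ∨ t = 1 by
    have key : ∀ s t : unitInterval, s = 0 ∨ s = 1 → sweep (t, s) = sweep (0, s) := by
      rintro s t (rfl | rfl)
      · ext i
        fin_cases i <;> (norm_num [sweep, lower]; try ring)
      · ext i
        fin_cases i <;> norm_num [sweep, lower]
    rcases hts with rfl | rfl | rfl | rfl
    · rw [key 0 t (Or.inl rfl), ← hlow, H.source, Path.source]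
    · rw [key 1 t (Or.inr rfl), ← hlow, H.target, Path.target]
    · rw [← hlow]
      exact H.apply_zero s
    · rw [← hupp]
      exact H.apply_one s
  by_contra hne
  push Not at hne
  obtain ⟨h1, h2, h3, h4⟩ := hne
  have hs0 : (0 : ℝ) < s := lt_of_le_of_ne s.2.1 fun h => h1 (Subtype.ext h.symm)
  have hs1 : (s : ℝ) < 1 := lt_of_le_of_ne s.2.2 fun h => h2 (Subtype.ext h)
  have ht0 : (0 : ℝ) < t := lt_of_le_of_ne t.2.1 fun h => h3 (Subtype.ext h.symm)
  have ht1 : (t : ℝ) < 1 := lt_of_le_of_ne t.2.2 fun h => h4 (Subtype.ext h)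
  have hadd := lower_add s
  have hsub := lower_sub s
  have hle : (lower s).1 ≤ 1 := min_le_right _ _
  have hge : -1 ≤ (lower s).2 := le_max_left _ _
  have hD : (lower s).2 < (lower s).1 := by
    rcases abs_cases (4 * (s : ℝ) - 2) with h | h <;> linarith
  have hlt : ‖sweep (t, s)‖ < 1 := by
    rw [pi_norm_lt_iff zero_lt_one]
    intro i
    rw [Real.norm_eq_abs, abs_lt]
    fin_cases i
    · simp only [sweep, Fin.zero_eta, Matrix.cons_val_zero]
      constructor <;> nlinarith
    · simp only [sweep, Fin.mk_one, Matrix.cons_val_one, Matrix.cons_val_fin_one]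
      constructor <;> nlinarith
  exact hlt.ne hv

/-! ### Cubical cells coded by integers, and extension over finite complexes -/

namespace LatticeCell

variable {ι : Type*}

/-- Cells of the unit cubical subdivision of `ι → ℝ` are encoded by `ι → ℤ`: the coordinate `2 k`
stands for the point `k`, and the coordinate `2 k + 1` for the open interval `(k, k + 1)`. -/
def IsFace (d c : ι → ℤ) : Prop := ∀ i, |d i - c i| ≤ c i % 2

/-- The closed cell with code `c`. -/
def closedCell (c : ι → ℤ) : Set (ι → ℝ) := {x | ∀ i, |2 * x i - c i| ≤ ((c i % 2 : ℤ) : ℝ)}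

/-- The code of the open cell that contains `x`. -/
noncomputable def cellType (x : ι → ℝ) : ι → ℤ := fun i => ⌊x i⌋ + ⌈x i⌉

/-- The barycentre of a cell. -/
noncomputable def center (c : ι → ℤ) : ι → ℝ := fun i => (c i : ℝ) / 2

/-- The relative boundary of a cell. -/
def boundary (c : ι → ℤ) : Set (ι → ℝ) := {x | x ∈ closedCell c ∧ cellType x ≠ c}

/-- A set of cells that contains all faces of its elements. -/
def IsComplex (𝒞 : Set (ι → ℤ)) : Prop := ∀ c ∈ 𝒞, ∀ d, IsFace d c → d ∈ 𝒞

/-- The union of the open cells with codes in `𝒞`. -/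
def carrier (𝒞 : Set (ι → ℤ)) : Set (ι → ℝ) := {x | cellType x ∈ 𝒞}

theorem IsFace.refl (c : ι → ℤ) : IsFace c c := fun i => by
  simpa using Int.emod_nonneg (c i) two_ne_zero

theorem IsFace.eq_or {d c : ι → ℤ} (h : IsFace d c) (i : ι) :
    d i = c i ∨ c i % 2 = 1 ∧ (d i = c i - 1 ∨ d i = c i + 1) := by
  have := abs_le.1 (h i)
  omega

theorem isFace_iff {d c : ι → ℤ} :
    IsFace d c ↔ ∀ i, d i = c i ∨ c i % 2 = 1 ∧ (d i = c i - 1 ∨ d i = c i + 1) := by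
  refine ⟨fun h => h.eq_or, fun h i => abs_le.2 ?_⟩
  have := h i
  omega

theorem IsFace.trans {b d c : ι → ℤ} (h : IsFace b d) (h' : IsFace d c) : IsFace b c := by
  rw [isFace_iff] at *
  intro i
  have := h i
  have := h' i
  omega

theorem IsFace.antisymm {d c : ι → ℤ} (h : IsFace d c) (h' : IsFace c d) : d = c := by
  rw [isFace_iff] at *
  ext i
  have := h i
  have := h' i
  omega

/-- For `c = 2 * k` both sides say `x = k`, and for `c = 2 * k + 1` both say `k ≤ x ≤ k + 1`.
Coordinatewise this translates membership in a closed cell into the face relation of codes. -/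
theorem floor_add_ceil_cases (x : ℝ) (c : ℤ) :
    |2 * x - c| ≤ ((c % 2 : ℤ) : ℝ) ↔ |⌊x⌋ + ⌈x⌉ - c| ≤ c % 2 := by
  have h1 := Int.floor_le x
  have h2 := Int.lt_floor_add_one x
  have h3 := Int.le_ceil x
  have h4 := Int.ceil_lt_add_one x
  have hc := Int.emod_two_eq_zero_or_one c
  obtain ⟨k, hk⟩ : ∃ k, c = 2 * k + c % 2 := ⟨c / 2, by omega⟩
  have hck : (c : ℝ) = 2 * k + (c % 2 : ℤ) := by exact_mod_cast hk
  rw [abs_le, abs_le]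
  rcases hc with hc | hc
  · rw [hc] at hck hk ⊢
    simp only [Int.cast_zero, neg_zero, add_zero] at hck ⊢
    constructor
    · rintro ⟨ha, hb⟩
      have : x = k := by linarith
      subst this
      simp only [Int.floor_intCast, Int.ceil_intCast]
      omega
    · rintro ⟨ha, hb⟩
      have h5 : ⌊x⌋ + ⌈x⌉ = 2 * k := by omega
      have h6 := Int.floor_le_ceil x
      have h7 := Int.ceil_le_floor_add_one x
      have h8 : (⌊x⌋ : ℝ) = k := by exact_mod_cast (by omega : ⌊x⌋ = k)
      have h9 : (⌈x⌉ : ℝ) = k := by exact_mod_cast (by omega : ⌈x⌉ = k)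
      constructor <;> linarith
  · rw [hc] at hck hk ⊢
    simp only [Int.cast_one] at hck ⊢
    constructor
    · rintro ⟨ha, hb⟩
      have h5 : k ≤ ⌊x⌋ := Int.le_floor.2 (by linarith)
      have h6 : ⌈x⌉ ≤ k + 1 := Int.ceil_le.2 (by push_cast; linarith)
      have h7 := Int.floor_le_ceil x
      omega
    · rintro ⟨ha, hb⟩
      have h6 := Int.floor_le_ceil x
      have h7 := Int.ceil_le_floor_add_one x
      have h8 : (k : ℝ) ≤ ⌊x⌋ := by exact_mod_cast (by omega : k ≤ ⌊x⌋)
      have h9 : (⌈x⌉ : ℝ) ≤ k + 1 := by exact_mod_cast (by omega : ⌈x⌉ ≤ k + 1)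
      constructor <;> linarith

theorem mem_closedCell_iff {x : ι → ℝ} {c : ι → ℤ} :
    x ∈ closedCell c ↔ IsFace (cellType x) c :=
  forall_congr' fun i => floor_add_ceil_cases (x i) (c i)

theorem mem_closedCell_cellType (x : ι → ℝ) : x ∈ closedCell (cellType x) :=
  mem_closedCell_iff.2 (IsFace.refl _)

theorem closedCell_subset {d c : ι → ℤ} (h : IsFace d c) : closedCell d ⊆ closedCell c :=
  fun _ hx => mem_closedCell_iff.2 ((mem_closedCell_iff.1 hx).trans h)

theorem cellType_center (c : ι → ℤ) : cellType (center c) = c := by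
  ext i
  obtain ⟨k, hk | hk⟩ := Int.even_or_odd' (c i)
  · have : center c i = k := by simp [center, hk]
    rw [cellType, this, Int.floor_intCast, Int.ceil_intCast]
    omega
  · have h : center c i = k + 1 / 2 := by simp [center, hk]; ring
    have h1 : ⌊center c i⌋ = k := by
      rw [Int.floor_eq_iff, h]
      constructor <;> linarith
    have h2 : ⌈center c i⌉ = k + 1 := by
      rw [Int.ceil_eq_iff, h]
      push_cast
      constructor <;> linarith
    rw [cellType, h1, h2]
    omega

theorem center_mem_closedCell_iff {d c : ι → ℤ} : center d ∈ closedCell c ↔ IsFace d c := by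
  rw [mem_closedCell_iff, cellType_center]

theorem convex_closedCell (c : ι → ℤ) : Convex ℝ (closedCell c) := by
  intro x hx y hy a b ha hb hab i
  have h1 := abs_le.1 (hx i)
  have h2 := abs_le.1 (hy i)
  rw [abs_le]
  simp only [Pi.add_apply, Pi.smul_apply, smul_eq_mul]
  have hb' : b = 1 - a := by linarith
  subst hb'
  constructor <;> nlinarith

theorem isClosed_closedCell (c : ι → ℤ) : IsClosed (closedCell c) := by
  simp only [closedCell, Set.ofPred_forall]
  exact isClosed_iInter fun i => isClosed_le (by fun_prop) continuous_const

theorem closedCell_subset_carrier {𝒞 : Set (ι → ℤ)} (h𝒞 : IsComplex 𝒞) {c : ι → ℤ} (hc : c ∈ 𝒞) :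
    closedCell c ⊆ carrier 𝒞 := fun _ hx => h𝒞 c hc _ (mem_closedCell_iff.1 hx)

theorem carrier_eq_iUnion {𝒞 : Set (ι → ℤ)} (h𝒞 : IsComplex 𝒞) :
    carrier 𝒞 = ⋃ c ∈ 𝒞, closedCell c := by
  ext x
  simp only [Set.mem_iUnion]
  exact ⟨fun hx => ⟨_, hx, mem_closedCell_cellType x⟩,
    fun ⟨c, hc, hx⟩ => closedCell_subset_carrier h𝒞 hc hx⟩

theorem isClosed_carrier {𝒞 : Set (ι → ℤ)} (h𝒞 : IsComplex 𝒞) (hfin : 𝒞.Finite) :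
    IsClosed (carrier 𝒞) := by
  rw [carrier_eq_iUnion h𝒞]
  exact hfin.isClosed_biUnion fun c _ => isClosed_closedCell c

/-- A proper face differs from the cell in an odd coordinate, which has moved by one. In the affine
parametrization this becomes the condition that the sup norm is 1. -/
theorem mem_boundary_iff {c : ι → ℤ} {x : ι → ℝ} :
    x ∈ boundary c ↔ x ∈ closedCell c ∧ ∃ i, c i % 2 = 1 ∧ |2 * x i - c i| = 1 := by
  refine and_congr_right fun hx => ?_
  have hf := (mem_closedCell_iff.1 hx).eq_or
  constructor
  · intro h
    obtain ⟨i, hi⟩ := Function.ne_iff.1 h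
    obtain ⟨h1, h2⟩ := (hf i).resolve_left hi
    refine ⟨i, h1, ?_⟩
    have h3 := mem_closedCell_cellType x i
    have h4 : cellType x i % 2 = 0 := by omega
    rw [h4, Int.cast_zero] at h3
    have h5 := abs_nonpos_iff.1 h3
    rcases h2 with h2 | h2 <;> rw [h2] at h5 <;> push_cast at h5
    · rw [show 2 * x i - c i = -1 by linarith]; norm_num
    · rw [show 2 * x i - c i = 1 by linarith]; norm_num
  · rintro ⟨i, hi, h⟩ heq
    have h1 : cellType x i = c i := congrFun heq i
    obtain ⟨k, hk⟩ : ∃ k, c i = 2 * k + 1 := ⟨c i / 2, by omega⟩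
    have hck : (c i : ℝ) = 2 * k + 1 := by exact_mod_cast hk
    simp only [cellType] at h1
    rcases (abs_eq zero_le_one).1 h with h | h
    · have : x i = ((k + 1 : ℤ) : ℝ) := by push_cast; linarith
      rw [this, Int.floor_intCast, Int.ceil_intCast] at h1
      omega
    · have : x i = (k : ℝ) := by linarith
      rw [this, Int.floor_intCast, Int.ceil_intCast] at h1
      omega

theorem center_mem_closedCell (c : ι → ℤ) : center c ∈ closedCell c :=
  center_mem_closedCell_iff.2 (IsFace.refl c)

theorem center_mem_boundary {v c : ι → ℤ} (h : IsFace v c) (hne : v ≠ c) :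
    center v ∈ boundary c :=
  ⟨center_mem_closedCell_iff.2 h, by rwa [cellType_center]⟩

theorem closedCell_subset_boundary {d c : ι → ℤ} (h : IsFace d c) (hne : d ≠ c) :
    closedCell d ⊆ boundary c := fun _ hx =>
  ⟨closedCell_subset h hx, fun h' => hne (h.antisymm (h' ▸ mem_closedCell_iff.1 hx))⟩

/-- Every cell has a vertex. -/
theorem exists_vertex (c : ι → ℤ) : ∃ v, IsFace v c ∧ ∀ i, v i % 2 = 0 := by
  refine ⟨fun i => if c i % 2 = 0 then c i else c i - 1, isFace_iff.2 fun i => ?_, fun i => ?_⟩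
  · split_ifs <;> omega
  · simp only
    split_ifs <;> omega

theorem IsComplex.diff_singleton {𝒞 : Set (ι → ℤ)} (h𝒞 : IsComplex 𝒞) {σ : ι → ℤ}
    (hmax : ∀ c ∈ 𝒞, IsFace σ c → c = σ) : IsComplex (𝒞 \ {σ}) := by
  rintro c ⟨hc, hcσ⟩ d hd
  refine ⟨h𝒞 c hc d hd, ?_⟩
  rintro rfl
  exact hcσ (hmax c hc hd)

/-- Extension over a finite cubical complex, cell by cell: `Good σ g` is a condition on the
restriction of `g` to the closed cell `σ` that is maintained during the process. -/
theorem exists_extension [Finite ι] {S : Type*} [TopologicalSpace S] {𝒜 : Set (ι → ℤ)}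
    (h𝒜 : IsComplex 𝒜) (Good : (ι → ℤ) → ((ι → ℝ) → S) → Prop)
    (hlocal : ∀ σ g g', Set.EqOn g g' (closedCell σ) → Good σ g → Good σ g')
    {g₀ : (ι → ℝ) → S} (hg₀ : ContinuousOn g₀ (carrier 𝒜)) (hgood : ∀ σ ∈ 𝒜, Good σ g₀)
    {𝒞 : Set (ι → ℤ)} (h𝒞 : IsComplex 𝒞) (hfin : 𝒞.Finite) (h𝒜𝒞 : 𝒜 ⊆ 𝒞)
    (hfill : ∀ σ ∈ 𝒞, σ ∉ 𝒜 → ∀ u : (ι → ℝ) → S, ContinuousOn u (boundary σ) →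
      (∀ τ, IsFace τ σ → τ ≠ σ → Good τ u) →
      ∃ u' : (ι → ℝ) → S, ContinuousOn u' (closedCell σ) ∧ Set.EqOn u' u (boundary σ) ∧ Good σ u') :
    ∃ g : (ι → ℝ) → S, ContinuousOn g (carrier 𝒞) ∧ Set.EqOn g g₀ (carrier 𝒜) ∧
      ∀ σ ∈ 𝒞, Good σ g := by
  classical
  induction hn : (𝒞 \ 𝒜).ncard generalizing 𝒞 with
  | zero =>
    have : 𝒞 = 𝒜 := by
      rw [Set.ncard_eq_zero (hfin.subset Set.sdiff_subset), Set.sdiff_eq_empty] at hn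
      exact hn.antisymm h𝒜𝒞
    subst this
    exact ⟨g₀, hg₀, fun _ _ => rfl, hgood⟩
  | succ n ih =>
    have hfin' : (𝒞 \ 𝒜).Finite := hfin.subset Set.sdiff_subset
    obtain ⟨σ, ⟨hσ, hσ𝒜⟩, hσmax⟩ : ∃ σ ∈ 𝒞 \ 𝒜, ∀ c ∈ 𝒞 \ 𝒜, IsFace σ c → c = σ := by
      have hne : (𝒞 \ 𝒜).Nonempty := Set.nonempty_of_ncard_ne_zero (by omega)
      let P : PartialOrder (ι → ℤ) :=
        { le := IsFace
          lt := fun a b => IsFace a b ∧ ¬ IsFace b a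
          le_refl := IsFace.refl
          le_trans := fun _ _ _ => IsFace.trans
          le_antisymm := fun _ _ => IsFace.antisymm }
      obtain ⟨σ, hσ, hmax⟩ := @Set.Finite.exists_maximal _ P.toLE ⟨fun _ _ _ => IsFace.trans⟩ _ hfin' hne
      exact ⟨σ, hσ, fun c hc hσc => IsFace.antisymm (hmax hc hσc) hσc⟩
    -- As `𝒜` contains the faces of its cells, no cell of `𝒜` has `σ` as a face. Hence `σ` is
    -- maximal in all of `𝒞`, removing it leaves a complex, and the boundary of `σ` lies in the
    -- carrier of that complex.
    have hmax : ∀ c ∈ 𝒞, IsFace σ c → c = σ := fun c hc hσc =>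
      hσmax c ⟨hc, fun hc𝒜 => hσ𝒜 (h𝒜 c hc𝒜 σ hσc)⟩ hσc
    have hB := h𝒞.diff_singleton hmax
    have hBfin : (𝒞 \ {σ}).Finite := hfin.subset Set.sdiff_subset
    obtain ⟨g, hg, hgg₀, hgg⟩ := ih hB hBfin (fun c hc => ⟨h𝒜𝒞 hc, fun h => hσ𝒜 (h ▸ hc)⟩)
      (fun τ hτ => hfill τ hτ.1) (by
        have : (𝒞 \ {σ}) \ 𝒜 = (𝒞 \ 𝒜) \ {σ} := by
          ext; simp only [Set.mem_sdiff]; tauto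
        rw [this, Set.ncard_sdiff_singleton_of_mem (show σ ∈ 𝒞 \ 𝒜 from ⟨hσ, hσ𝒜⟩), hn]
        rfl)
    have hbd : boundary σ ⊆ carrier (𝒞 \ {σ}) := fun x hx =>
      ⟨h𝒞 σ hσ _ (mem_closedCell_iff.1 hx.1), hx.2⟩
    obtain ⟨u, hu, hug, hσu⟩ := hfill σ hσ hσ𝒜 g (hg.mono hbd) fun τ hτ hne =>
      hgg τ ⟨h𝒞 σ hσ τ hτ, hne⟩
    -- The case distinction is by open cells. Since `u` agrees with `g` on the boundary of `σ`, the
    -- result equals `u` on the closed cell, and two closed sets can be pasted.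
    let G : (ι → ℝ) → S := fun x => if cellType x = σ then u x else g x
    have hG1 : Set.EqOn G g (carrier (𝒞 \ {σ})) := fun x hx => if_neg hx.2
    have hG2 : Set.EqOn G u (closedCell σ) := by
      intro x hx
      by_cases h : cellType x = σ
      · exact if_pos h
      · exact (if_neg h).trans (hug ⟨hx, h⟩).symm
    have hcar : carrier 𝒞 = carrier (𝒞 \ {σ}) ∪ closedCell σ := by
      ext x
      constructor
      · intro hx
        by_cases h : cellType x = σ
        · exact Or.inr (h ▸ mem_closedCell_cellType x)
        · exact Or.inl ⟨hx, h⟩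
      · rintro (hx | hx)
        · exact hx.1
        · exact closedCell_subset_carrier h𝒞 hσ hx
    refine ⟨G, ?_, ?_, ?_⟩
    · rw [hcar]
      exact (hg.congr hG1).union_of_isClosed (hu.congr hG2) (isClosed_carrier hB hBfin)
        (isClosed_closedCell σ)
    · intro x hx
      rw [← hgg₀ hx]
      exact hG1 ⟨h𝒜𝒞 hx, fun h => hσ𝒜 (h ▸ hx)⟩
    · intro τ hτ
      by_cases h : τ = σ
      · subst h
        exact hlocal _ _ _ hG2.symm hσu
      · exact hlocal _ _ _ (hG1.mono (closedCell_subset_carrier hB ⟨hτ, h⟩)).symm (hgg τ ⟨hτ, h⟩)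

/-! ### Filling single cells: affine coordinates, edges, squares, higher cells -/

section Parametrization

variable {k : ℕ} (c : ι → ℤ) (e : Fin k ≃ {i // c i % 2 = 1})

open Classical in
/-- The affine parametrization of a cell by the unit ball of the sup norm. -/
noncomputable def param (y : Fin k → ℝ) : ι → ℝ := fun i =>
  if h : c i % 2 = 1 then (c i + y (e.symm ⟨i, h⟩)) / 2 else c i / 2

/-- The inverse of the affine parametrization of a cell. -/
noncomputable def coord (x : ι → ℝ) : Fin k → ℝ := fun j => 2 * x (e j) - c (e j)

variable {c e}

theorem continuous_param : Continuous (param c e) := by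
  refine continuous_pi fun i => ?_
  unfold param
  split_ifs <;> fun_prop

theorem continuous_coord : Continuous (coord c e) := by
  unfold coord; fun_prop

theorem coord_param (y : Fin k → ℝ) : coord c e (param c e y) = y := by
  ext j
  simp only [coord, param, (e j).2, dite_true, Subtype.coe_eta, Equiv.symm_apply_apply]
  ring

theorem param_coord {x : ι → ℝ} (hx : x ∈ closedCell c) : param c e (coord c e x) = x := by
  ext i
  simp only [param]
  split_ifs with h
  · simp only [coord, Equiv.apply_symm_apply]
    ring
  · have h1 := hx i
    have h2 : c i % 2 = 0 := by omega
    rw [h2, Int.cast_zero] at h1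
    have := abs_nonpos_iff.1 h1
    linarith

theorem norm_coord_le {x : ι → ℝ} (hx : x ∈ closedCell c) : ‖coord c e x‖ ≤ 1 := by
  rw [pi_norm_le_iff_of_nonneg zero_le_one]
  intro j
  have h := hx (e j)
  rw [(e j).2, Int.cast_one] at h
  exact h

theorem param_mem {y : Fin k → ℝ} (hy : ‖y‖ ≤ 1) : param c e y ∈ closedCell c := by
  intro i
  simp only [param]
  split_ifs with h
  · rw [h, Int.cast_one]
    have h1 := (norm_le_pi_norm y (e.symm ⟨i, h⟩)).trans hy
    rw [Real.norm_eq_abs] at h1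
    rwa [show 2 * ((c i + y (e.symm ⟨i, h⟩)) / 2) - c i = y (e.symm ⟨i, h⟩) by ring]
  · have h2 : c i % 2 = 0 := by omega
    rw [h2, Int.cast_zero, show 2 * ((c i : ℝ) / 2) - c i = 0 by ring, abs_zero]

theorem param_mem_boundary (hk : 0 < k) {y : Fin k → ℝ} (hy : ‖y‖ = 1) :
    param c e y ∈ boundary c := by
  have : Nonempty (Fin k) := ⟨⟨0, hk⟩⟩
  rw [mem_boundary_iff]
  refine ⟨param_mem hy.le, ?_⟩
  obtain ⟨j, -, hj⟩ := Finset.exists_max_image Finset.univ (fun j => ‖y j‖) Finset.univ_nonempty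
  have h1 : ‖y‖ = ‖y j‖ := le_antisymm
    ((pi_norm_le_iff_of_nonneg (norm_nonneg _)).2 fun i => hj i (Finset.mem_univ i))
    (norm_le_pi_norm _ j)
  refine ⟨e j, (e j).2, ?_⟩
  have h2 : 2 * param c e y (e j) - c (e j) = y j := congrFun (coord_param y) j
  rw [h2, ← Real.norm_eq_abs, ← h1, hy]

theorem norm_coord_eq {x : ι → ℝ} (hx : x ∈ boundary c) : ‖coord c e x‖ = 1 := by
  refine le_antisymm (norm_coord_le hx.1) ?_
  obtain ⟨-, i, hi, h⟩ := mem_boundary_iff.1 hx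
  refine le_trans ?_ (norm_le_pi_norm _ (e.symm ⟨i, hi⟩))
  rw [Real.norm_eq_abs, coord, Equiv.apply_symm_apply, h]

/-- Extension over a cell can be checked in the affine parametrization. -/
theorem exists_extension_of_param {S : Type*} [TopologicalSpace S] (e : Fin k ≃ {i // c i % 2 = 1})
    {u : (ι → ℝ) → S}
    (h : ∃ w : (Fin k → ℝ) → S, ContinuousOn w (Metric.closedBall 0 1) ∧
      Set.EqOn w (u ∘ param c e) (Metric.sphere 0 1)) :
    ∃ u' : (ι → ℝ) → S, ContinuousOn u' (closedCell c) ∧ Set.EqOn u' u (boundary c) := by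
  obtain ⟨w, hw, hwu⟩ := h
  refine ⟨w ∘ coord c e, hw.comp continuous_coord.continuousOn fun x hx => ?_, fun x hx => ?_⟩
  · exact mem_closedBall_zero_iff.2 (norm_coord_le hx)
  · rw [Function.comp_apply, hwu (mem_sphere_zero_iff_norm.2 (norm_coord_eq hx)),
      Function.comp_apply, param_coord hx.1]

end Parametrization

variable [Fintype ι]

/-- The dimension of a cell. -/
def dim (c : ι → ℤ) : ℕ := Fintype.card {i // c i % 2 = 1}

/-- Extension over cells of dimension at least three, if higher homotopy groups are trivial. -/
theorem exists_extension_of_three_le_dim {S : Type*} [TopologicalSpace S] {c : ι → ℤ}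
    (hS : ∀ k : ℕ, 2 ≤ k → ∀ x : S, Subsingleton (π_ k S x)) (hc : 3 ≤ dim c) {u : (ι → ℝ) → S}
    (hu : ContinuousOn u (boundary c)) :
    ∃ u' : (ι → ℝ) → S, ContinuousOn u' (closedCell c) ∧ Set.EqOn u' u (boundary c) := by
  obtain ⟨d, hd⟩ : ∃ d, dim c = d + 1 := ⟨dim c - 1, by omega⟩
  have e : Fin (d + 1) ≃ {i // c i % 2 = 1} := (Fintype.equivFinOfCardEq hd).symm
  refine exists_extension_of_param e
    (exists_extension_closedBall (by omega) (hS d (by omega)) ?_)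
  exact hu.comp continuous_param.continuousOn fun y hy =>
    param_mem_boundary (by omega) (mem_sphere_zero_iff_norm.1 hy)

end LatticeCell

namespace LatticeCell

theorem segPath_apply' {ι : Type*} (x y : ι → ℝ) (t : unitInterval) (i : ι) :
    segPath x y t i = (1 - t) * x i + t * y i := by
  simp [segPath_apply, AffineMap.lineMap_apply_module]

/-- The trichotomy of cells by dimension: vertices, edges, squares, and higher cells. -/
theorem dim_cases {ι : Type*} [Fintype ι] (c : ι → ℤ) :
    (∀ i, c i % 2 = 0) ∨ (∃ i, c i % 2 = 1 ∧ ∀ j, j ≠ i → c j % 2 = 0) ∨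
      (∃ i j, i ≠ j ∧ c i % 2 = 1 ∧ c j % 2 = 1 ∧ ∀ k, k ≠ i → k ≠ j → c k % 2 = 0) ∨
      3 ≤ dim c := by
  classical
  by_cases h0 : ∀ i, c i % 2 = 0
  · exact Or.inl h0
  push Not at h0
  obtain ⟨i, hi⟩ := h0
  have hi : c i % 2 = 1 := by omega
  by_cases h1 : ∀ j, j ≠ i → c j % 2 = 0
  · exact Or.inr (Or.inl ⟨i, hi, h1⟩)
  push Not at h1
  obtain ⟨j, hji, hj⟩ := h1
  have hj : c j % 2 = 1 := by omega
  by_cases h2 : ∀ k, k ≠ i → k ≠ j → c k % 2 = 0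
  · exact Or.inr (Or.inr (Or.inl ⟨i, j, hji.symm, hi, hj, h2⟩))
  push Not at h2
  obtain ⟨k, hki, hkj, hk⟩ := h2
  have hk : c k % 2 = 1 := by omega
  refine Or.inr (Or.inr (Or.inr ?_))
  have := Fintype.two_lt_card_iff.2 ⟨(⟨i, hi⟩ : {i // c i % 2 = 1}), ⟨j, hj⟩, ⟨k, hk⟩,
    by simpa using hji.symm, by simpa using hki.symm, by simpa using hkj.symm⟩
  exact this

variable {ι : Type*} [DecidableEq ι]

/-- The facet of the cell `c` obtained by shifting the coordinate `i` by `ε = ± 1`. -/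
def shift (c : ι → ℤ) (i : ι) (ε : ℤ) : ι → ℤ := Function.update c i (c i + ε)

theorem isFace_shift {c : ι → ℤ} {i : ι} (hi : c i % 2 = 1) {ε : ℤ} (hε : ε = -1 ∨ ε = 1) :
    IsFace (shift c i ε) c := by
  rw [isFace_iff]
  intro j
  rcases eq_or_ne j i with rfl | h
  · right
    simp only [shift, Function.update_self]
    omega
  · left
    simp [shift, h]

theorem shift_ne {c : ι → ℤ} {i : ι} {ε : ℤ} (hε : ε = -1 ∨ ε = 1) : shift c i ε ≠ c := by
  intro h
  have := congrFun h i
  simp only [shift, Function.update_self] at this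
  omega

/-- Extension over an edge by a prescribed path. -/
theorem exists_extension_edge {S : Type*} [TopologicalSpace S] {c : ι → ℤ} {i : ι}
    (hi : c i % 2 = 1) (he : ∀ j, j ≠ i → c j % 2 = 0) {u : (ι → ℝ) → S} {a b : S} (p : Path a b)
    (ha : u (center (shift c i (-1))) = a) (hb : u (center (shift c i 1)) = b) :
    ∃ u' : (ι → ℝ) → S, ContinuousOn u' (closedCell c) ∧ Set.EqOn u' u (boundary c) ∧
      ∀ t, u' (segPath (center (shift c i (-1))) (center (shift c i 1)) t) = p t := by
  -- On the cell, `x i` runs from `(c i - 1) / 2` to `(c i + 1) / 2`, so the difference is the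
  -- parameter of the edge in `[0, 1]`.
  refine ⟨fun x => p.extend (x i - (c i - 1) / 2), ?_, ?_, ?_⟩
  · exact (p.continuous_extend.comp (by fun_prop)).continuousOn
  · intro x hx
    have hall : ∀ j, j ≠ i → x j = c j / 2 := by
      intro j hj
      have := hx.1 j
      rw [he j hj, Int.cast_zero] at this
      have := abs_nonpos_iff.1 this
      linarith
    have key : ∀ ε : ℤ, 2 * x i - c i = ε → x = center (shift c i ε) := by
      intro ε hε
      ext j
      rcases eq_or_ne j i with rfl | hj
      · simp only [center, shift, Function.update_self]
        push_cast
        linarith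
      · simpa [center, shift, hj] using hall j hj
    obtain ⟨-, j, hj, h⟩ := mem_boundary_iff.1 hx
    have hji : j = i := by
      by_contra hne
      have := he j hne
      omega
    subst hji
    rcases (abs_eq zero_le_one).1 h with h | h
    · have h1 := key 1 (by simpa using h)
      have h2 : x j - (c j - 1) / 2 = 1 := by linarith
      simp only [h2, Path.extend_one]
      rw [h1, hb]
    · have h1 := key (-1) (by simpa using h)
      have h2 : x j - (c j - 1) / 2 = 0 := by linarith
      simp only [h2, Path.extend_zero]
      rw [h1, ha]
  · intro t
    have : segPath (center (shift c i (-1))) (center (shift c i 1)) t i - (c i - 1) / 2 = t := by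
      rw [segPath_apply']
      simp only [center, shift, Function.update_self]
      push_cast
      ring
    simp only [this]
    exact Path.extend_extends' p t

/-- Extension over a two-dimensional cell, if the images of the two boundary paths are homotopic. -/
theorem exists_extension_of_dim_two {S : Type*} [TopologicalSpace S] {c : ι → ℤ} {i j : ι}
    (hij : i ≠ j) (hi : c i % 2 = 1) (hj : c j % 2 = 1)
    (he : ∀ k, k ≠ i → k ≠ j → c k % 2 = 0) {u : (ι → ℝ) → S}
    {s₀₀ s₁₀ s₀₁ s₁₁ : S} {p₁ : Path s₀₀ s₁₀} {p₂ : Path s₁₀ s₁₁} {q₁ : Path s₀₀ s₀₁}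
    {q₂ : Path s₀₁ s₁₁}
    (hp₁ : ∀ t, p₁ t = u (segPath (center (shift (shift c i (-1)) j (-1)))
      (center (shift (shift c i 1) j (-1))) t))
    (hp₂ : ∀ t, p₂ t = u (segPath (center (shift (shift c i 1) j (-1)))
      (center (shift (shift c i 1) j 1)) t))
    (hq₁ : ∀ t, q₁ t = u (segPath (center (shift (shift c i (-1)) j (-1)))
      (center (shift (shift c i (-1)) j 1)) t))
    (hq₂ : ∀ t, q₂ t = u (segPath (center (shift (shift c i (-1)) j 1))
      (center (shift (shift c i 1) j 1)) t))
    (h : (p₁.trans p₂).Homotopic (q₁.trans q₂)) :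
    ∃ u' : (ι → ℝ) → S, ContinuousOn u' (closedCell c) ∧ Set.EqOn u' u (boundary c) := by
  let e₀ : Fin 2 → {k // c k % 2 = 1} := ![⟨i, hi⟩, ⟨j, hj⟩]
  have hbij : Function.Bijective e₀ := by
    constructor
    · intro a b hab
      fin_cases a <;> fin_cases b <;> simp_all [e₀]
    · rintro ⟨k, hk⟩
      by_cases hki : k = i
      · exact ⟨0, by simp [e₀, hki]⟩
      · by_cases hkj : k = j
        · exact ⟨1, by simp [e₀, hkj]⟩
        · have := he k hki hkj
          omega
  let e := Equiv.ofBijective e₀ hbij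
  have he0 : e.symm ⟨i, hi⟩ = 0 := by rw [Equiv.symm_apply_eq]; rfl
  have he1 : e.symm ⟨j, hj⟩ = 1 := by rw [Equiv.symm_apply_eq]; rfl
  have hseg : ∀ (y y' : Fin 2 → ℝ) (t : unitInterval),
      param c e (segPath y y' t) = segPath (param c e y) (param c e y') t := by
    intro y y' t
    ext k
    simp only [param, segPath_apply']
    split_ifs
    · ring
    · ring
  have hcorner : ∀ a b : ℤ, param c e ![(a : ℝ), (b : ℝ)] = center (shift (shift c i a) j b) := by
    intro a b
    ext k
    by_cases hki : k = i
    · subst hki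
      simp [param, center, shift, hi, he0, hij]
    · by_cases hkj : k = j
      · subst hkj
        simp [param, center, shift, hj, he1, hij.symm]
      · simp [param, center, shift, he k hki hkj, hki, hkj]
  have h00 := hcorner (-1) (-1)
  have h10 := hcorner 1 (-1)
  have h01 := hcorner (-1) 1
  have h11 := hcorner 1 1
  push_cast at h00 h10 h01 h11
  refine exists_extension_of_param e (exists_extension_square (a := p₁) (b := p₂) (c := q₁)
    (d := q₂) ?_ ?_ ?_ ?_ h)
  · intro t
    rw [Function.comp_apply, hseg, h00, h10, hp₁]
  · intro t
    rw [Function.comp_apply, hseg, h10, h11, hp₂]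
  · intro t
    rw [Function.comp_apply, hseg, h00, h01, hq₁]
  · intro t
    rw [Function.comp_apply, hseg, h01, h11, hq₂]

end LatticeCell

/-! ### Path systems and partial homotopies -/

/-- `P` is consistent along paths on the set `U`. -/
def ConsistentOn {Z S : Type*} [TopologicalSpace Z] [TopologicalSpace S] {F₀ F₁ : C(Z, S)}
    (P : ∀ z, Path (F₀ z) (F₁ z) → Prop) (U : Set Z) : Prop :=
  ∀ z z' : Z, ∀ γ : Path z z', (∀ t, γ t ∈ U) → ∀ p p', P z p → P z' p' →
    ((γ.map F₀.continuous).trans p').Homotopic (p.trans (γ.map F₁.continuous))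

/-- `P` selects, for every `z`, one homotopy class of paths from `F₀ z` to `F₁ z`, in a locally
consistent way. -/
structure IsPathSystem {Z S : Type*} [TopologicalSpace Z] [TopologicalSpace S] (F₀ F₁ : C(Z, S))
    (P : ∀ z, Path (F₀ z) (F₁ z) → Prop) : Prop where
  exists_path : ∀ z, ∃ p, P z p
  iff_homotopic : ∀ {z p p'}, P z p → (P z p' ↔ p.Homotopic p')
  locally_consistent : ∀ z₀, ∃ U ∈ 𝓝 z₀, ConsistentOn P U

/-- A homotopy from `F₀` to `F₁` over the set `A`, whose tracks lie in the given classes of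
paths; it is parametrized by a map `Λ`. -/
structure IsPartialHomotopy {X Z S : Type*} [TopologicalSpace X] [TopologicalSpace Z]
    [TopologicalSpace S] {F₀ F₁ : C(Z, S)} (P : ∀ z, Path (F₀ z) (F₁ z) → Prop) (Λ : X → Z)
    (A : Set X) (H : X × ℝ → S) : Prop where
  continuousOn : ContinuousOn H (A ×ˢ Set.Icc 0 1)
  apply_zero : ∀ x ∈ A, H (x, 0) = F₀ (Λ x)
  apply_one : ∀ x ∈ A, H (x, 1) = F₁ (Λ x)
  track : ∀ x ∈ A, ∀ p, (∀ t : unitInterval, p t = H (x, t)) → P (Λ x) p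

/-! ### Extending partial homotopies over the cylinder of a cubical complex -/

namespace LatticeCell

variable {ι : Type*}

/-- The cell `c × a` in the product with a line. -/
def withTime {R : Type*} (y : ι → R) (t : R) : Option ι → R := fun o => o.elim t y

/-- The projection of a product with a line to the first factor. -/
def base {R : Type*} (x : Option ι → R) : ι → R := fun i => x (some i)

theorem base_withTime {R : Type*} (y : ι → R) (t : R) : base (withTime y t) = y := rfl

theorem withTime_base {R : Type*} (x : Option ι → R) : withTime (base x) (x none) = x := by
  ext o
  cases o <;> rfl

theorem continuous_base : Continuous (base : (Option ι → ℝ) → ι → ℝ) := by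
  unfold base; fun_prop

theorem continuous_withTime : Continuous fun p : (ι → ℝ) × ℝ => withTime p.1 p.2 := by
  refine continuous_pi fun o => ?_
  rcases o with - | i
  · exact continuous_snd
  · exact (by fun_prop : Continuous fun p : (ι → ℝ) × ℝ => p.1 i)

theorem isFace_option_iff {d c : Option ι → ℤ} :
    IsFace d c ↔ IsFace (base d) (base c) ∧ |d none - c none| ≤ c none % 2 :=
  ⟨fun h => ⟨fun i => h (some i), h none⟩, fun h o => by cases o; exacts [h.2, h.1 _]⟩

theorem mem_closedCell_option_iff {x : Option ι → ℝ} {c : Option ι → ℤ} :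
    x ∈ closedCell c ↔ base x ∈ closedCell (base c) ∧
      |2 * x none - c none| ≤ ((c none % 2 : ℤ) : ℝ) :=
  ⟨fun h => ⟨fun i => h (some i), h none⟩, fun h o => by cases o; exacts [h.2, h.1 _]⟩

theorem floor_add_ceil_eq_zero {r : ℝ} (h : ⌊r⌋ + ⌈r⌉ = 0) : r = 0 := by
  have h1 := (floor_add_ceil_cases r 0).2 (by simp [h])
  simp only [Int.cast_zero, Int.zero_emod] at h1
  have := abs_nonpos_iff.1 h1
  linarith

theorem floor_add_ceil_eq_two {r : ℝ} (h : ⌊r⌋ + ⌈r⌉ = 2) : r = 1 := by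
  have h1 := (floor_add_ceil_cases r 2).2 (by simp [h])
  norm_num at h1
  linarith

theorem mem_Icc_iff_floor_add_ceil {r : ℝ} :
    r ∈ Set.Icc (0 : ℝ) 1 ↔ 0 ≤ ⌊r⌋ + ⌈r⌉ ∧ ⌊r⌋ + ⌈r⌉ ≤ 2 := by
  have h := floor_add_ceil_cases r 1
  norm_num at h
  rw [abs_le, abs_le] at h
  constructor
  · rintro ⟨h0, h1⟩
    have := h.1 ⟨by linarith, by linarith⟩
    omega
  · rintro ⟨h0, h1⟩
    have := h.2 ⟨by linarith, by linarith⟩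
    constructor <;> linarith

/-- The product of a complex with the unit interval. -/
def cylinder (𝒢 : Set (ι → ℤ)) : Set (Option ι → ℤ) := {σ | base σ ∈ 𝒢 ∧ 0 ≤ σ none ∧ σ none ≤ 2}

theorem isComplex_cylinder {𝒢 : Set (ι → ℤ)} (h : IsComplex 𝒢) : IsComplex (cylinder 𝒢) := by
  rintro c ⟨hc, h0, h2⟩ d hd
  have h3 := isFace_option_iff.1 hd
  refine ⟨h _ hc _ h3.1, ?_⟩
  have h4 := abs_le.1 h3.2
  omega

theorem finite_cylinder {𝒢 : Set (ι → ℤ)} (h : 𝒢.Finite) : (cylinder 𝒢).Finite := by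
  refine ((h.prod (Set.finite_Icc (0 : ℤ) 2)).image fun p => withTime p.1 p.2).subset ?_
  rintro σ ⟨h1, h2⟩
  exact ⟨(base σ, σ none), ⟨h1, h2⟩, withTime_base σ⟩

theorem mem_carrier_cylinder {𝒢 : Set (ι → ℤ)} {x : Option ι → ℝ} :
    x ∈ carrier (cylinder 𝒢) ↔ base x ∈ carrier 𝒢 ∧ x none ∈ Set.Icc (0 : ℝ) 1 :=
  and_congr_right fun _ => mem_Icc_iff_floor_add_ceil.symm

/-- The subcomplex of the cylinder consisting of its bottom, its top, and the cylinder over a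
subcomplex. -/
def cylinderBoundary (𝒢 𝒜 : Set (ι → ℤ)) : Set (Option ι → ℤ) :=
  {σ | σ ∈ cylinder 𝒢 ∧ (σ none = 1 → base σ ∈ 𝒜)}

theorem isComplex_cylinderBoundary {𝒢 𝒜 : Set (ι → ℤ)} (h : IsComplex 𝒢) (h' : IsComplex 𝒜) :
    IsComplex (cylinderBoundary 𝒢 𝒜) := by
  rintro c ⟨hc, hc1⟩ d hd
  refine ⟨isComplex_cylinder h c hc d hd, fun h1 => ?_⟩
  obtain ⟨h2, h3⟩ := isFace_option_iff.1 hd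
  refine h' _ (hc1 ?_) _ h2
  have h4 := abs_le.1 h3
  have := hc.2
  omega

variable {Z S : Type*} [TopologicalSpace Z] [TopologicalSpace S] {F₀ F₁ : C(Z, S)}

/-- The condition on the restriction of a partial homotopy to a cell of the cylinder. -/
structure IsGoodOn (P : ∀ z, Path (F₀ z) (F₁ z) → Prop) (Λ : (ι → ℝ) → Z) (σ : Option ι → ℤ)
    (g : (Option ι → ℝ) → S) : Prop where
  bottom : σ none = 0 → ∀ x ∈ closedCell σ, g x = F₀ (Λ (base x))
  top : σ none = 2 → ∀ x ∈ closedCell σ, g x = F₁ (Λ (base x))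
  track : σ none = 1 → (∀ i, σ (some i) % 2 = 0) →
    ∀ p : Path (F₀ (Λ (center (base σ)))) (F₁ (Λ (center (base σ)))),
      (∀ t : unitInterval, p t = g (withTime (center (base σ)) t)) → P _ p

theorem withTime_mem_closedCell {σ : Option ι → ℤ} (hσ : σ none = 1) {y : ι → ℝ}
    (hy : y ∈ closedCell (base σ)) (t : unitInterval) : withTime y (t : ℝ) ∈ closedCell σ := by
  rw [mem_closedCell_option_iff]
  refine ⟨hy, ?_⟩
  have h0 := t.2.1
  have h1 := t.2.2
  rw [hσ]
  norm_num
  rw [abs_le]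
  simp only [withTime, Option.elim]
  constructor <;> linarith

theorem IsGoodOn.congr {P : ∀ z, Path (F₀ z) (F₁ z) → Prop} {Λ : (ι → ℝ) → Z} {σ : Option ι → ℤ}
    {g g' : (Option ι → ℝ) → S} (h : Set.EqOn g g' (closedCell σ)) (hg : IsGoodOn P Λ σ g) :
    IsGoodOn P Λ σ g' where
  bottom h0 x hx := (h hx).symm.trans (hg.bottom h0 x hx)
  top h0 x hx := (h hx).symm.trans (hg.top h0 x hx)
  track h0 h1 p hp := hg.track h0 h1 p fun t => by
    rw [hp, h (withTime_mem_closedCell h0 (center_mem_closedCell _) t)]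

theorem segPath_withTime_time (y : ι → ℝ) (t : unitInterval) :
    segPath (withTime y 0) (withTime y 1) t = withTime y (t : ℝ) := by
  ext o
  rw [segPath_apply']
  cases o <;> simp only [withTime, Option.elim] <;> ring

theorem segPath_withTime_base (x y : ι → ℝ) (s : ℝ) (t : unitInterval) :
    segPath (withTime x s) (withTime y s) t = withTime (segPath x y t) s := by
  ext o
  rw [segPath_apply']
  cases o
  · simp only [withTime, Option.elim]; ring
  · simp only [withTime, Option.elim, segPath_apply']

theorem center_withTime (c : ι → ℤ) (a : ℤ) :
    center (withTime c a) = withTime (center c) ((a : ℝ) / 2) := by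
  ext o
  cases o <;> rfl

variable {P : ∀ z, Path (F₀ z) (F₁ z) → Prop} {Λ : (ι → ℝ) → Z}

/-- Filling the vertical square over an edge of the base. -/
theorem exists_extension_vertical_square [DecidableEq ι] {U : Set Z} (hU : ConsistentOn P U)
    {σ : Option ι → ℤ} {i : ι} (h1 : σ none = 1) (hi : σ (some i) % 2 = 1)
    (he : ∀ j, j ≠ i → σ (some j) % 2 = 0) (hΛ : ContinuousOn Λ (closedCell (base σ)))
    (hΛU : ∀ x ∈ closedCell (base σ), Λ x ∈ U) {u : (Option ι → ℝ) → S}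
    (hu : ContinuousOn u (boundary σ)) (hgood : ∀ τ, IsFace τ σ → τ ≠ σ → IsGoodOn P Λ τ u) :
    ∃ u' : (Option ι → ℝ) → S, ContinuousOn u' (closedCell σ) ∧ Set.EqOn u' u (boundary σ) := by
  set c := base σ with hc
  have hσ : σ = withTime c 1 := by rw [← h1, withTime_base]
  have hci : c i % 2 = 1 := hi
  set v := shift c i (-1) with hv
  set w := shift c i 1 with hw
  have hvc : IsFace v c := isFace_shift hci (Or.inl rfl)
  have hwc : IsFace w c := isFace_shift hci (Or.inr rfl)
  have heven : ∀ d, d = v ∨ d = w → ∀ j, d j % 2 = 0 := by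
    rintro d (rfl | rfl) j <;> rcases eq_or_ne j i with rfl | hj
    · simp only [hv, shift, Function.update_self]; omega
    · simpa [hv, shift, hj] using (show c j % 2 = 0 from he j hj)
    · simp only [hw, shift, Function.update_self]; omega
    · simpa [hw, shift, hj] using (show c j % 2 = 0 from he j hj)
  have hsh : ∀ a b : ℤ, shift (shift σ (some i) a) none b = withTime (shift c i a) (1 + b) := by
    intro a b
    ext o
    rcases o with - | j
    · simp [shift, withTime, h1]
    · rcases eq_or_ne j i with rfl | hj
      · simp [shift, withTime, hc, base]
      · simp [shift, withTime, hc, base, hj]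
  have hface : ∀ (d : ι → ℤ) (a : ℤ), IsFace d c → 0 ≤ a → a ≤ 2 → IsFace (withTime d a) σ := by
    intro d a hd h0 h2
    rw [isFace_option_iff]
    refine ⟨hd, ?_⟩
    rw [h1, abs_le]
    simp only [withTime, Option.elim]
    omega
  have hneT : ∀ (d : ι → ℤ) (a : ℤ), a ≠ 1 → withTime d a ≠ σ := by
    intro d a ha h
    exact ha ((congrFun h none).trans h1)
  have hneV : ∀ (d : ι → ℤ) (a : ℤ), d ≠ c → withTime d a ≠ σ := by
    intro d a hd h
    exact hd (congrArg base h)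
  have hvne : v ≠ c := shift_ne (Or.inl rfl)
  have hwne : w ≠ c := shift_ne (Or.inr rfl)
  have hseg := fun t => segPath_mem (convex_closedCell c) (center_mem_closedCell_iff.2 hvc)
    (center_mem_closedCell_iff.2 hwc) t
  let γ : Path (Λ (center v)) (Λ (center w)) :=
    ⟨⟨fun t => Λ (segPath (center v) (center w) t),
      hΛ.comp_continuous (segPath _ _).continuous hseg⟩, by simp, by simp⟩
  have hγ : ∀ t, γ t = Λ (segPath (center v) (center w) t) := fun t => rfl
  have hbot : ∀ y ∈ closedCell c, u (withTime y 0) = F₀ (Λ y) := fun y hy =>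
    (hgood _ (hface c 0 (IsFace.refl c) le_rfl (by norm_num)) (hneT _ _ (by norm_num))).bottom rfl _
      (mem_closedCell_option_iff.2 ⟨hy, by simp [withTime]⟩)
  have htop : ∀ y ∈ closedCell c, u (withTime y 1) = F₁ (Λ y) := fun y hy =>
    (hgood _ (hface c 2 (IsFace.refl c) (by norm_num) le_rfl) (hneT _ _ (by norm_num))).top rfl _
      (mem_closedCell_option_iff.2 ⟨hy, by simp [withTime]⟩)
  have hvert : ∀ d, d = v ∨ d = w → IsFace d c → d ≠ c →
      ∃ p : Path (F₀ (Λ (center d))) (F₁ (Λ (center d))), P _ p ∧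
        ∀ t : unitInterval, p t = u (withTime (center d) (t : ℝ)) := by
    intro d hd hdc hdne
    have hf := hface d 1 hdc (by norm_num) (by norm_num)
    have hmem := fun t : unitInterval => withTime_mem_closedCell (σ := withTime d 1) rfl
      (center_mem_closedCell d) t
    have hcont : Continuous fun t : unitInterval => u (withTime (center d) (t : ℝ)) :=
      (hu.mono (closedCell_subset_boundary hf (hneV _ _ hdne))).comp_continuous
        (continuous_withTime.comp (by fun_prop : Continuous fun t : unitInterval =>
          (center d, (t : ℝ)))) hmem
    let p : Path (F₀ (Λ (center d))) (F₁ (Λ (center d))) := ⟨⟨_, hcont⟩,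
      by simpa using hbot _ (center_mem_closedCell_iff.2 hdc),
      by simpa using htop _ (center_mem_closedCell_iff.2 hdc)⟩
    exact ⟨p, (hgood _ hf (hneV _ _ hdne)).track rfl (heven d hd) p fun t => rfl, fun t => rfl⟩
  obtain ⟨p, hPp, hp⟩ := hvert v (Or.inl rfl) hvc hvne
  obtain ⟨q, hPq, hq⟩ := hvert w (Or.inr rfl) hwc hwne
  have hzero : ((0 : ℤ) : ℝ) / 2 = 0 := by norm_num
  have htwo : ((2 : ℤ) : ℝ) / 2 = 1 := by norm_num
  have hv0 : center (shift (shift σ (some i) (-1)) none (-1)) = withTime (center v) 0 := by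
    rw [hsh, center_withTime, ← hzero]; rfl
  have hw0 : center (shift (shift σ (some i) 1) none (-1)) = withTime (center w) 0 := by
    rw [hsh, center_withTime, ← hzero]; rfl
  have hv1 : center (shift (shift σ (some i) (-1)) none 1) = withTime (center v) 1 := by
    rw [hsh, center_withTime, ← htwo]; rfl
  have hw1 : center (shift (shift σ (some i) 1) none 1) = withTime (center w) 1 := by
    rw [hsh, center_withTime, ← htwo]; rfl
  -- The boundary paths of the square are bottom then right side, and left side then top.
  -- Consistency along `γ` says precisely that they are homotopic.
  refine exists_extension_of_dim_two (i := some i) (j := none) (by simp) hi (by rw [h1]; rfl) ?_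
    (p₁ := γ.map F₀.continuous) (p₂ := q) (q₁ := p) (q₂ := γ.map F₁.continuous) ?_ ?_ ?_ ?_
    (hU _ _ γ (fun t => hΛU _ (hseg t)) p q hPp hPq)
  · rintro (- | k) hk hk'
    · exact absurd rfl hk'
    · exact he k fun h => hk (congrArg some h)
  · intro t
    rw [hv0, hw0, segPath_withTime_base, hbot _ (hseg t)]
    rfl
  · intro t
    rw [hw0, hw1, segPath_withTime_time, hq]
  · intro t
    rw [hv0, hv1, segPath_withTime_time, hp]
  · intro t
    rw [hv1, hw1, segPath_withTime_base, htop _ (hseg t)]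
    rfl

end LatticeCell

namespace LatticeCell

variable {ι : Type*} {Z S : Type*} [TopologicalSpace Z] [TopologicalSpace S] {F₀ F₁ : C(Z, S)}
  {P : ∀ z, Path (F₀ z) (F₁ z) → Prop} {Λ : (ι → ℝ) → Z}

/-- The map prescribed on the bottom, the top, and a part of the wall of the cylinder. -/
theorem exists_map_cylinderBoundary [Finite ι] {𝒢 𝒜 : Set (ι → ℤ)} (h𝒢 : IsComplex 𝒢)
    (hfin : 𝒢.Finite) (h𝒜 : IsComplex 𝒜) (h𝒜𝒢 : 𝒜 ⊆ 𝒢) (hΛ : ContinuousOn Λ (carrier 𝒢))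
    {H : (ι → ℝ) × ℝ → S} (hH : IsPartialHomotopy P Λ (carrier 𝒜) H) :
    ∃ g : (Option ι → ℝ) → S, ContinuousOn g (carrier (cylinderBoundary 𝒢 𝒜)) ∧
      (∀ σ ∈ cylinderBoundary 𝒢 𝒜, IsGoodOn P Λ σ g) ∧
      ∀ x ∈ carrier 𝒜, ∀ t ∈ Set.Icc (0 : ℝ) 1, g (withTime x t) = H (x, t) := by
  classical
  let g : (Option ι → ℝ) → S := fun x => if x none = 0 then F₀ (Λ (base x)) else
    if x none = 1 then F₁ (Λ (base x)) else H (base x, x none)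
  have hg0 : ∀ x : Option ι → ℝ, x none = 0 → g x = F₀ (Λ (base x)) := fun x h => if_pos h
  have hg1 : ∀ x : Option ι → ℝ, x none = 1 → g x = F₁ (Λ (base x)) := fun x h =>
    (if_neg (by rw [h]; norm_num)).trans (if_pos h)
  -- On the wall over `𝒜` the prescriptions do not conflict, because `H` starts at `F₀` and ends at
  -- `F₁`.
  have hgH : ∀ x : Option ι → ℝ, base x ∈ carrier 𝒜 → g x = H (base x, x none) := by
    intro x hx
    by_cases h0 : x none = 0
    · rw [hg0 x h0, h0, hH.apply_zero _ hx]
    by_cases h1 : x none = 1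
    · rw [hg1 x h1, h1, hH.apply_one _ hx]
    · exact (if_neg h0).trans (if_neg h1)
  have hbase : Continuous (base : (Option ι → ℝ) → ι → ℝ) := continuous_base
  refine ⟨g, ?_, ?_, ?_⟩
  · let A₀ : Set (Option ι → ℝ) := {x | base x ∈ carrier 𝒢 ∧ x none = 0}
    let A₁ : Set (Option ι → ℝ) := {x | base x ∈ carrier 𝒢 ∧ x none = 1}
    let A₂ : Set (Option ι → ℝ) := {x | base x ∈ carrier 𝒜 ∧ x none ∈ Set.Icc (0 : ℝ) 1}
    have hA₀ : IsClosed A₀ := ((isClosed_carrier h𝒢 hfin).preimage hbase).inter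
      (isClosed_eq (by fun_prop) continuous_const)
    have hA₁ : IsClosed A₁ := ((isClosed_carrier h𝒢 hfin).preimage hbase).inter
      (isClosed_eq (by fun_prop) continuous_const)
    have hA₂ : IsClosed A₂ := ((isClosed_carrier h𝒜 (hfin.subset h𝒜𝒢)).preimage hbase).inter
      (isClosed_Icc.preimage (by fun_prop))
    have hc₀ : ContinuousOn g A₀ :=
      (F₀.continuous.comp_continuousOn (hΛ.comp hbase.continuousOn fun x hx => hx.1)).congr
        fun x hx => hg0 x hx.2
    have hc₁ : ContinuousOn g A₁ :=
      (F₁.continuous.comp_continuousOn (hΛ.comp hbase.continuousOn fun x hx => hx.1)).congr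
        fun x hx => hg1 x hx.2
    have hc₂ : ContinuousOn g A₂ :=
      (hH.continuousOn.comp (hbase.prodMk (continuous_apply none)).continuousOn
        fun x hx => ⟨hx.1, hx.2⟩).congr fun x hx => hgH x hx.1
    refine ((hc₀.union_of_isClosed hc₁ hA₀ hA₁).union_of_isClosed hc₂ (hA₀.union hA₁) hA₂).mono ?_
    intro x hx
    have h2 := mem_carrier_cylinder.1 (show x ∈ carrier (cylinder 𝒢) from hx.1)
    have h3 : cellType x none = 1 → base x ∈ carrier 𝒜 := hx.2
    have h4 := hx.1.2
    by_cases h0 : cellType x none = 0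
    · exact Or.inl (Or.inl ⟨h2.1, floor_add_ceil_eq_zero h0⟩)
    by_cases h1 : cellType x none = 2
    · exact Or.inl (Or.inr ⟨h2.1, floor_add_ceil_eq_two h1⟩)
    · exact Or.inr ⟨h3 (by omega), h2.2⟩
  · rintro σ ⟨hσ, hσ𝒜⟩
    refine ⟨fun h0 x hx => hg0 x ?_, fun h2 x hx => hg1 x ?_, fun h1 _ p hp => ?_⟩
    · have := hx none
      simp only [h0, Int.cast_zero, Int.zero_emod] at this
      have := abs_nonpos_iff.1 this
      linarith
    · have := hx none
      rw [h2] at this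
      norm_num at this
      linarith
    · have hmem : center (base σ) ∈ carrier 𝒜 :=
        closedCell_subset_carrier h𝒜 (hσ𝒜 h1) (center_mem_closedCell _)
      refine hH.track _ hmem p fun t => ?_
      exact (hp t).trans (hgH (withTime _ _) hmem)
  · intro x hx t ht
    exact hgH (withTime x t) hx

/-- Extension of a partial homotopy from a subcomplex to a complex. -/
theorem exists_isPartialHomotopy_extension [Finite ι]
    (hS : ∀ k : ℕ, 2 ≤ k → ∀ x : S, Subsingleton (π_ k S x)) (hP : IsPathSystem F₀ F₁ P)
    {U : Set Z} (hU : ConsistentOn P U) {𝒢 𝒜 : Set (ι → ℤ)} (h𝒢 : IsComplex 𝒢)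
    (hfin : 𝒢.Finite) (h𝒜 : IsComplex 𝒜) (h𝒜𝒢 : 𝒜 ⊆ 𝒢) (hΛ : ContinuousOn Λ (carrier 𝒢))
    (hΛU : ∀ x ∈ carrier 𝒢, Λ x ∈ U) {H : (ι → ℝ) × ℝ → S}
    (hH : IsPartialHomotopy P Λ (carrier 𝒜) H) :
    ∃ G : (ι → ℝ) × ℝ → S, IsPartialHomotopy P Λ (carrier 𝒢) G ∧
      ∀ x ∈ carrier 𝒜, ∀ t ∈ Set.Icc (0 : ℝ) 1, G (x, t) = H (x, t) := by
  classical
  have := Fintype.ofFinite ι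
  obtain ⟨g₀, hg₀, hg₀good, hg₀H⟩ := exists_map_cylinderBoundary h𝒢 hfin h𝒜 h𝒜𝒢 hΛ hH
  have hcell : ∀ c ∈ 𝒢, closedCell c ⊆ carrier 𝒢 := fun c hc => closedCell_subset_carrier h𝒢 hc
  obtain ⟨g, hg, hgg₀, hgood⟩ := exists_extension (isComplex_cylinderBoundary h𝒢 h𝒜)
    (fun σ g => IsGoodOn P Λ σ g) (fun σ g g' h hg => hg.congr h) hg₀ hg₀good
    (isComplex_cylinder h𝒢) (finite_cylinder hfin) (fun σ hσ => hσ.1) (by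
      intro σ hσ hσ𝒜 u hu hgoodu
      have h1 : σ none = 1 := by
        by_contra h
        exact hσ𝒜 ⟨hσ, fun h' => absurd h' h⟩
      have hΛσ : ContinuousOn Λ (closedCell (base σ)) := hΛ.mono (hcell _ hσ.1)
      -- For a cell over the open unit interval the condition only concerns vertical edges over
      -- vertices, so it is void as soon as the base has positive dimension.
      have htriv : ∀ u' : (Option ι → ℝ) → S, (∃ i, σ (some i) % 2 = 1) → IsGoodOn P Λ σ u' := by
        rintro u' ⟨i, hi⟩
        refine ⟨fun h => ?_, fun h => ?_, fun _ h => ?_⟩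
        · omega
        · omega
        · have := h i
          omega
      have hsquare : ∀ i, σ (some i) % 2 = 1 → (∀ j, j ≠ i → σ (some j) % 2 = 0) →
          ∃ u' : (Option ι → ℝ) → S, ContinuousOn u' (closedCell σ) ∧
            Set.EqOn u' u (boundary σ) ∧ IsGoodOn P Λ σ u' := by
        intro i hi he
        obtain ⟨u', h2, h3⟩ := exists_extension_vertical_square hU h1 hi he hΛσ
          (fun x hx => hΛU x (hcell _ hσ.1 hx)) hu hgoodu
        exact ⟨u', h2, h3, htriv u' ⟨i, hi⟩⟩
      -- The time coordinate of `σ` is odd. Hence `σ` is not a vertex; if it is an edge it is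
      -- vertical over a vertex, and if it is a square it stands over an edge of the base.
      rcases dim_cases σ with h | ⟨i, hi, he⟩ | ⟨i, j, hij, hi, hj, he⟩ | h
      · have := h none
        omega
      · obtain rfl : i = none := by
          by_contra hne
          have := he none (Ne.symm hne)
          omega
        obtain ⟨p, hp⟩ := hP.exists_path (Λ (center (base σ)))
        have hcen : ∀ ε, center (shift σ none ε) =
            withTime (center (base σ)) (((1 + ε : ℤ) : ℝ) / 2) := fun ε => by
          ext o
          cases o
          · simp [center, shift, withTime, h1]
          · simp [center, shift, withTime, base]
        have ha : u (center (shift σ none (-1))) = F₀ (Λ (center (base σ))) := by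
          rw [(hgoodu _ (isFace_shift hi (Or.inl rfl)) (shift_ne (Or.inl rfl))).bottom
            (by simp [shift, h1]) _ (center_mem_closedCell _), hcen, base_withTime]
        have hb : u (center (shift σ none 1)) = F₁ (Λ (center (base σ))) := by
          rw [(hgoodu _ (isFace_shift hi (Or.inr rfl)) (shift_ne (Or.inr rfl))).top
            (by simp [shift, h1]) _ (center_mem_closedCell _), hcen, base_withTime]
        obtain ⟨u', h2, h3, h4⟩ := exists_extension_edge hi he p ha hb
        refine ⟨u', h2, h3, fun h => ?_, fun h => ?_, fun _ _ q hq => ?_⟩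
        · omega
        · omega
        · have : q = p := by
            ext t
            have h0 : ((1 + -1 : ℤ) : ℝ) / 2 = 0 := by norm_num
            have h2 : ((1 + 1 : ℤ) : ℝ) / 2 = 1 := by norm_num
            rw [hq, ← h4, hcen, hcen, h0, h2, segPath_withTime_time]
          rwa [this]
      · rcases i with - | i
        · rcases j with - | j
          · exact absurd rfl hij
          · exact hsquare j hj fun k hk => he _ (by simp) (by simpa using hk)
        · have hjn : j = none := by
            by_contra hne
            have := he none (by simp) (Ne.symm hne)
            omega
          subst hjn
          exact hsquare i hi fun k hk => he _ (by simpa using hk) (by simp)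
      · obtain ⟨u', h2, h3⟩ := exists_extension_of_three_le_dim hS h hu
        refine ⟨u', h2, h3, htriv u' ?_⟩
        by_contra hne
        push Not at hne
        have hle : dim σ ≤ 1 := Fintype.card_le_one_iff.2 (by
          rintro ⟨a, ha⟩ ⟨b, hb⟩
          rcases a with - | a
          · rcases b with - | b
            · rfl
            · exact absurd hb (hne b)
          · exact absurd ha (hne a))
        omega)
  have hmemcar : ∀ x ∈ carrier 𝒢, ∀ t ∈ Set.Icc (0 : ℝ) 1,
      withTime x t ∈ carrier (cylinder 𝒢) := fun x hx t ht => mem_carrier_cylinder.2 ⟨hx, ht⟩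
  have hbot : ∀ x ∈ carrier 𝒢, g (withTime x 0) = F₀ (Λ x) := by
    intro x hx
    have h := hgood (cellType (withTime x 0)) (hmemcar x hx 0 ⟨le_rfl, zero_le_one⟩)
    exact h.bottom (by simp [cellType, withTime]) _ (mem_closedCell_cellType _)
  have htop : ∀ x ∈ carrier 𝒢, g (withTime x 1) = F₁ (Λ x) := by
    intro x hx
    have h := hgood (cellType (withTime x 1)) (hmemcar x hx 1 ⟨zero_le_one, le_rfl⟩)
    exact h.top (by simp [cellType, withTime]) _ (mem_closedCell_cellType _)
  refine ⟨fun q => g (withTime q.1 q.2), ⟨?_, hbot, htop, ?_⟩, ?_⟩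
  · exact hg.comp continuous_withTime.continuousOn fun q hq => hmemcar _ hq.1 _ hq.2
  · intro x hx p hp
    -- The class of the track was imposed at vertices only. For other points it follows by transport
    -- along the segment from a vertex of the cell: `g` itself fills the square over this segment,
    -- and comparison with the consistency square determines the class at `x` by cancellation.
    set c := cellType x with hc
    have hc𝒢 : c ∈ 𝒢 := hx
    obtain ⟨v, hvc, hv⟩ := exists_vertex c
    have hv𝒢 : v ∈ 𝒢 := h𝒢 c hc𝒢 v hvc
    have hvcar : center v ∈ carrier 𝒢 := hcell v hv𝒢 (center_mem_closedCell v)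
    have hvcell : center v ∈ closedCell c := center_mem_closedCell_iff.2 hvc
    have hxcell : x ∈ closedCell c := mem_closedCell_cellType x
    let σ : Option ι → ℤ := withTime c 1
    have hσ : σ ∈ cylinder 𝒢 := ⟨hc𝒢, by norm_num [σ, withTime], by norm_num [σ, withTime]⟩
    have hgσ : ContinuousOn g (closedCell σ) :=
      hg.mono (closedCell_subset_carrier (isComplex_cylinder h𝒢) hσ)
    have hmem : ∀ y ∈ closedCell c, ∀ t : unitInterval, withTime y (t : ℝ) ∈ closedCell σ :=
      fun y hy t => withTime_mem_closedCell rfl hy t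
    have hseg := fun t => segPath_mem (convex_closedCell c) hvcell hxcell t
    let γ : Path (Λ (center v)) (Λ x) :=
      ⟨⟨fun t => Λ (segPath (center v) x t),
        (hΛ.mono (hcell c hc𝒢)).comp_continuous (segPath _ _).continuous hseg⟩, by simp, by simp⟩
    obtain ⟨q, hq⟩ : ∃ q : Path (F₀ (Λ (center v))) (F₁ (Λ (center v))),
        ∀ t : unitInterval, q t = g (withTime (center v) (t : ℝ)) := by
      refine ⟨⟨⟨fun t => g (withTime (center v) (t : ℝ)), ?_⟩, ?_, ?_⟩, fun t => rfl⟩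
      · exact hgσ.comp_continuous (continuous_withTime.comp
          (by fun_prop : Continuous fun t : unitInterval => (center v, (t : ℝ)))) (hmem _ hvcell)
      · simpa using hbot _ hvcar
      · simpa using htop _ hvcar
    have hPq : P _ q := by
      have hτ : withTime v 1 ∈ cylinder 𝒢 :=
        ⟨hv𝒢, by norm_num [withTime], by norm_num [withTime]⟩
      exact (hgood _ hτ).track rfl hv q hq
    obtain ⟨p', hp'⟩ := hP.exists_path (Λ x)
    have hcons := hU _ _ γ (fun t => hΛU _ (hcell c hc𝒢 (hseg t))) q p' hPq hp'
    have hsq : ((γ.map F₀.continuous).trans p).Homotopic (q.trans (γ.map F₁.continuous)) := by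
      have i1 : IsImagePath (closedCell σ) g (segPath (withTime (center v) 0) (withTime x 0))
          (γ.map F₀.continuous) := fun t => by
        rw [segPath_withTime_base]
        exact ⟨by simpa using hmem _ (hseg t) 0, (hbot _ (hcell c hc𝒢 (hseg t))).symm⟩
      have i2 : IsImagePath (closedCell σ) g (segPath (withTime x 0) (withTime x 1)) p :=
        fun t => by
          rw [segPath_withTime_time]
          exact ⟨hmem _ hxcell t, hp t⟩
      have i3 : IsImagePath (closedCell σ) g
          (segPath (withTime (center v) 0) (withTime (center v) 1)) q := fun t => by
        rw [segPath_withTime_time]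
        exact ⟨hmem _ hvcell t, hq t⟩
      have i4 : IsImagePath (closedCell σ) g (segPath (withTime (center v) 1) (withTime x 1))
          (γ.map F₁.continuous) := fun t => by
        rw [segPath_withTime_base]
        exact ⟨by simpa using hmem _ (hseg t) 1, (htop _ (hcell c hc𝒢 (hseg t))).symm⟩
      exact (i1.trans i2).homotopic (convex_closedCell σ) hgσ (i3.trans i4)
    exact (hP.iff_homotopic hp').2 (Path.Homotopic.cancel_left (hcons.trans hsq.symm))
  · intro x hx t ht
    have hmem : withTime x t ∈ carrier (cylinderBoundary 𝒢 𝒜) :=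
      ⟨hmemcar x (h𝒜𝒢 hx) t ht, fun _ => hx⟩
    rw [← hg₀H x hx t ht]
    exact hgg₀ hmem

end LatticeCell

/-! ### Cube charts of a topological manifold -/

/-- An embedding of the closed cube `[-1, 1]ⁿ` such that the half cube is interior to the image. -/
structure IsCubeChart {Z : Type*} [TopologicalSpace Z] {n : ℕ} (κ : (Fin n → ℝ) → Z) : Prop where
  continuousOn : ContinuousOn κ (Metric.closedBall 0 1)
  injOn : Set.InjOn κ (Metric.closedBall 0 1)
  image_half_subset : κ '' Metric.closedBall 0 (1 / 2) ⊆ interior (κ '' Metric.closedBall 0 1)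

/-- The inverse of a chart is restricted to a small sup-norm ball around the image of `z₀`, rescaled
to the unit cube. It maps open subsets of the target to open sets, which gives the statements about
interiors and neighbourhoods. -/
theorem exists_isCubeChart {Z : Type*} [TopologicalSpace Z] {n : ℕ}
    [ChartedSpace (EuclideanSpace ℝ (Fin n)) Z] {z₀ : Z} {U : Set Z} (hU : U ∈ 𝓝 z₀) :
    ∃ κ : (Fin n → ℝ) → Z, IsCubeChart κ ∧ (∀ y ∈ Metric.closedBall 0 1, κ y ∈ U) ∧
      z₀ ∈ κ '' Metric.closedBall 0 (1 / 2) ∧ κ '' Metric.closedBall 0 (1 / 2) ∈ 𝓝 z₀ := by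
  let e : OpenPartialHomeomorph Z (Fin n → ℝ) :=
    (chartAt (EuclideanSpace ℝ (Fin n)) z₀).trans
      (EuclideanSpace.equiv (Fin n) ℝ).toHomeomorph.toOpenPartialHomeomorph
  have hz₀ : z₀ ∈ e.source := by simp [e]
  set a := e z₀ with ha
  have hopen : IsOpen (e.target ∩ e.symm ⁻¹' interior U) :=
    e.isOpen_inter_preimage_symm isOpen_interior
  have hmem : a ∈ e.target ∩ e.symm ⁻¹' interior U := by
    refine ⟨e.map_source hz₀, ?_⟩
    rw [Set.mem_preimage, e.left_inv hz₀]
    exact mem_interior_iff_mem_nhds.2 hU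
  obtain ⟨ρ, hρ, hball⟩ := Metric.nhds_basis_closedBall.mem_iff.1 (hopen.mem_nhds hmem)
  let A : (Fin n → ℝ) → (Fin n → ℝ) := fun y => a + ρ • y
  have hA : Continuous A := by fun_prop
  have hAimg : ∀ y ∈ Metric.closedBall (0 : Fin n → ℝ) 1, A y ∈ Metric.closedBall a ρ := by
    intro y hy
    rw [mem_closedBall_zero_iff] at hy
    rw [mem_closedBall_iff_norm, add_sub_cancel_left, norm_smul, Real.norm_eq_abs, abs_of_pos hρ]
    nlinarith
  have hAball : ∀ r : ℝ, A '' Metric.ball 0 r = Metric.ball a (ρ * r) := by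
    intro r
    ext x
    constructor
    · rintro ⟨y, hy, rfl⟩
      rw [mem_ball_zero_iff] at hy
      rw [mem_ball_iff_norm, add_sub_cancel_left, norm_smul, Real.norm_eq_abs, abs_of_pos hρ]
      exact mul_lt_mul_of_pos_left hy hρ
    · intro hx
      rw [mem_ball_iff_norm] at hx
      refine ⟨ρ⁻¹ • (x - a), ?_, ?_⟩
      · rw [mem_ball_zero_iff, norm_smul, Real.norm_eq_abs, abs_of_pos (inv_pos.2 hρ),
          inv_mul_lt_iff₀ hρ]
        exact hx
      · simp [A, smul_smul, hρ.ne']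
  have hopenimg : ∀ r : ℝ, r ≤ 1 → IsOpen ((e.symm ∘ A) '' Metric.ball 0 r) := by
    intro r hr
    rw [Set.image_comp, hAball]
    refine e.symm.isOpen_image_of_subset_source Metric.isOpen_ball ?_
    intro x hx
    exact (hball (Metric.ball_subset_closedBall
      (Metric.ball_subset_ball (by nlinarith : ρ * r ≤ ρ) hx))).1
  have hmem0 : ∀ r : ℝ, 0 < r → z₀ ∈ (e.symm ∘ A) '' Metric.ball 0 r := fun r hr =>
    ⟨0, Metric.mem_ball_self hr, by simp [A, a, e.left_inv hz₀]⟩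
  refine ⟨e.symm ∘ A, ⟨?_, ?_, ?_⟩, ?_, ?_, ?_⟩
  · exact e.continuousOn_symm.comp hA.continuousOn fun y hy => (hball (hAimg y hy)).1
  · intro y hy y' hy' h
    have h1 := e.symm.injOn (hball (hAimg y hy)).1 (hball (hAimg y' hy')).1 h
    exact smul_right_injective _ hρ.ne' (add_left_cancel h1)
  · refine (Set.image_mono (Metric.closedBall_subset_ball (by norm_num : (1 / 2 : ℝ) < 1))).trans ?_
    exact interior_maximal (Set.image_mono Metric.ball_subset_closedBall) (hopenimg 1 le_rfl)
  · exact fun y hy => interior_subset (hball (hAimg y hy)).2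
  · exact Set.image_mono Metric.ball_subset_closedBall (hmem0 (1 / 2) (by norm_num))
  · exact Filter.mem_of_superset ((hopenimg (1 / 2) (by norm_num)).mem_nhds
      (hmem0 (1 / 2) (by norm_num))) (Set.image_mono Metric.ball_subset_closedBall)

/-! ### Fine subdivisions of a cube -/

namespace LatticeCell

/-- The cells of the cube `[0, M]^ι`. -/
def grid (ι : Type*) (M : ℕ) : Set (ι → ℤ) := Set.Icc 0 fun _ => 2 * (M : ℤ)

theorem isComplex_grid (ι : Type*) (M : ℕ) : IsComplex (grid ι M) := by
  rintro c ⟨h0, h1⟩ d hd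
  rw [isFace_iff] at hd
  constructor <;> intro i <;> have h2 := h0 i <;> have h3 := h1 i <;> have h4 := hd i <;>
    simp only [Pi.zero_apply] at * <;> omega

theorem finite_grid (ι : Type*) [Finite ι] (M : ℕ) : (grid ι M).Finite := by
  classical
  have := Fintype.ofFinite ι
  exact Set.finite_Icc _ _

theorem mem_carrier_grid {ι : Type*} {M : ℕ} {x : ι → ℝ} :
    x ∈ carrier (grid ι M) ↔ ∀ i, 0 ≤ x i ∧ x i ≤ M := by
  have key : ∀ r : ℝ, (0 ≤ ⌊r⌋ + ⌈r⌉ ∧ ⌊r⌋ + ⌈r⌉ ≤ 2 * (M : ℤ)) ↔ 0 ≤ r ∧ r ≤ M := by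
    intro r
    have h6 := Int.floor_le_ceil r
    have h7 := Int.ceil_le_floor_add_one r
    rw [← Int.floor_nonneg (a := r), show (r ≤ M ↔ ⌈r⌉ ≤ (M : ℤ)) by rw [Int.ceil_le]; simp]
    omega
  exact ⟨fun h i => (key _).1 ⟨h.1 i, h.2 i⟩,
    fun h => ⟨fun i => ((key _).2 (h i)).1, fun i => ((key _).2 (h i)).2⟩⟩

/-- The affine map from the subdivided cube `[0, M]^ι` to `[-1, 1]^ι`. -/
noncomputable def rescale {ι : Type*} (M : ℕ) (x : ι → ℝ) : ι → ℝ := fun i => 2 * x i / M - 1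

theorem continuous_rescale {ι : Type*} (M : ℕ) : Continuous (rescale (ι := ι) M) := by
  unfold rescale; fun_prop

theorem rescale_mem {ι : Type*} [Fintype ι] {M : ℕ} (hM : 0 < M) {x : ι → ℝ}
    (hx : x ∈ carrier (grid ι M)) : rescale M x ∈ Metric.closedBall 0 1 := by
  rw [mem_closedBall_zero_iff, pi_norm_le_iff_of_nonneg zero_le_one]
  intro i
  obtain ⟨h0, h1⟩ := mem_carrier_grid.1 hx i
  have hM' : (0 : ℝ) < M := by exact_mod_cast hM
  have h2 : x i / M ≤ 1 := (div_le_one hM').2 h1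
  have h3 : 0 ≤ x i / M := by positivity
  rw [Real.norm_eq_abs, abs_le, rescale, mul_div_assoc]
  constructor <;> linarith

theorem dist_rescale_le {ι : Type*} [Fintype ι] {M : ℕ} {c : ι → ℤ}
    {x y : ι → ℝ} (hx : x ∈ closedCell c) (hy : y ∈ closedCell c) :
    dist (rescale M x) (rescale M y) ≤ 2 / M := by
  rw [dist_pi_le_iff (by positivity)]
  intro i
  have hcx := abs_le.1 (hx i)
  have hcy := abs_le.1 (hy i)
  have hc : ((c i % 2 : ℤ) : ℝ) ≤ 1 := by
    exact_mod_cast (by omega : c i % 2 ≤ 1)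
  have : rescale M x i - rescale M y i = 2 * (x i - y i) / M := by
    simp only [rescale]; ring
  rw [Real.dist_eq, this, abs_div, Nat.abs_cast]
  gcongr
  rw [abs_le]
  constructor <;> linarith

end LatticeCell

/-! ### From a path system on a compact manifold to a homotopy -/

section Extension

open LatticeCell

variable {Z S : Type*} [TopologicalSpace Z] [TopologicalSpace S] {F₀ F₁ : C(Z, S)}
  {P : ∀ z, Path (F₀ z) (F₁ z) → Prop}

theorem IsPartialHomotopy.mono {X : Type*} [TopologicalSpace X] {Λ : X → Z} {A B : Set X}
    {H : X × ℝ → S} (hH : IsPartialHomotopy P Λ A H) (h : B ⊆ A) : IsPartialHomotopy P Λ B H where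
  continuousOn := hH.continuousOn.mono (Set.prod_mono_left h)
  apply_zero x hx := hH.apply_zero x (h hx)
  apply_one x hx := hH.apply_one x (h hx)
  track x hx := hH.track x (h hx)

theorem IsPartialHomotopy.comp {X Y : Type*} [TopologicalSpace X] [TopologicalSpace Y] {Λ : X → Z}
    {A : Set X} {H : X × ℝ → S} (hH : IsPartialHomotopy P Λ A H) {f : Y → X} {B : Set Y}
    (hf : ContinuousOn f B) (hfB : Set.MapsTo f B A) :
    IsPartialHomotopy P (Λ ∘ f) B fun q => H (f q.1, q.2) where
  continuousOn := hH.continuousOn.comp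
    ((hf.comp continuousOn_fst fun _ hq => hq.1).prodMk continuousOn_snd)
    fun _ hq => ⟨hfB hq.1, hq.2⟩
  apply_zero _ hx := hH.apply_zero _ (hfB hx)
  apply_one _ hx := hH.apply_one _ (hfB hx)
  track _ hx := hH.track _ (hfB hx)

/-- Extension of a partial homotopy over a cube, keeping it on a closed set. -/
theorem exists_isPartialHomotopy_cube {n : ℕ}
    (hS : ∀ k : ℕ, 2 ≤ k → ∀ x : S, Subsingleton (π_ k S x)) (hP : IsPathSystem F₀ F₁ P)
    {κ : (Fin n → ℝ) → Z} (hκ : ContinuousOn κ (Metric.closedBall 0 1)) {U : Set Z}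
    (hU : ConsistentOn P U) (hκU : ∀ y ∈ Metric.closedBall 0 1, κ y ∈ U) {C W : Set Z}
    (hC : IsClosed C) (hW : IsOpen W) (hCW : C ⊆ W) {H : Z × ℝ → S}
    (hH : IsPartialHomotopy P id W H) :
    ∃ G : (Fin n → ℝ) × ℝ → S, IsPartialHomotopy P κ (Metric.closedBall 0 1) G ∧
      ∀ y ∈ Metric.closedBall 0 1, κ y ∈ C → ∀ t ∈ Set.Icc (0 : ℝ) 1, G (y, t) = H (κ y, t) := by
  obtain ⟨O, hO, hOeq⟩ := (continuousOn_iff'.1 hκ) W hW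
  have hD : IsCompact (Metric.closedBall (0 : Fin n → ℝ) 1 ∩ κ ⁻¹' C) :=
    (isCompact_closedBall 0 1).of_isClosed_subset
      (hκ.preimage_isClosed_of_isClosed Metric.isClosed_closedBall hC) Set.inter_subset_left
  have hDO : Metric.closedBall (0 : Fin n → ℝ) 1 ∩ κ ⁻¹' C ⊆ O := fun y hy =>
    (hOeq.subset ⟨hCW hy.2, hy.1⟩).1
  -- The preimage of `C` in the cube is compact, so a whole `δ`-neighbourhood of it, intersected
  -- with the cube, is mapped to `W`. Rescaled cells have diameter at most `2 / M < δ`; hence every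
  -- cell that meets the preimage of `C` belongs to `𝒜`, where the old homotopy is available.
  obtain ⟨δ, hδ, hδO⟩ := hD.exists_thickening_subset_open hO hDO
  obtain ⟨M, hM⟩ := exists_nat_gt (2 / δ)
  have hM' : (0 : ℝ) < M := (by positivity : (0 : ℝ) < 2 / δ).trans hM
  have hM0 : 0 < M := by exact_mod_cast hM'
  have hMδ : 2 / (M : ℝ) < δ := by
    rw [div_lt_iff₀ hδ] at hM
    rw [div_lt_iff₀ hM']
    linarith
  let 𝒜 : Set (Fin n → ℤ) := {c | c ∈ grid (Fin n) M ∧ ∀ x ∈ closedCell c, κ (rescale M x) ∈ W}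
  have h𝒜 : IsComplex 𝒜 := fun c hc d hd =>
    ⟨isComplex_grid _ M c hc.1 d hd, fun x hx => hc.2 x (closedCell_subset hd hx)⟩
  have hres : Set.MapsTo (rescale M) (carrier (grid (Fin n) M)) (Metric.closedBall 0 1) :=
    fun x hx => rescale_mem hM0 hx
  have hκres : ContinuousOn (κ ∘ rescale M) (carrier (grid (Fin n) M)) :=
    hκ.comp (continuous_rescale M).continuousOn hres
  have hH𝒜 : IsPartialHomotopy P (κ ∘ rescale M) (carrier 𝒜)
      fun q => H ((κ ∘ rescale M) q.1, q.2) :=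
    hH.comp (hκres.mono fun x hx => hx.1) fun x hx => hx.2 x (mem_closedCell_cellType x)
  obtain ⟨G, hG, hGH⟩ := exists_isPartialHomotopy_extension hS hP hU (isComplex_grid _ M)
    (finite_grid _ M) h𝒜 (fun c hc => hc.1) hκres (fun x hx => hκU _ (hres hx)) hH𝒜
  let inv : (Fin n → ℝ) → (Fin n → ℝ) := fun y i => M * (y i + 1) / 2
  have hinv : Continuous inv := by fun_prop
  have hresinv : ∀ y, rescale M (inv y) = y := by
    intro y
    ext i
    simp only [rescale, inv]
    field_simp
    ring
  have hinvmem : ∀ y ∈ Metric.closedBall (0 : Fin n → ℝ) 1, inv y ∈ carrier (grid (Fin n) M) := by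
    intro y hy
    rw [mem_closedBall_zero_iff] at hy
    rw [mem_carrier_grid]
    intro i
    have := abs_le.1 ((norm_le_pi_norm y i).trans hy)
    simp only [inv]
    constructor
    · have : 0 ≤ y i + 1 := by linarith
      positivity
    · nlinarith
  refine ⟨fun q => G (inv q.1, q.2), ?_, ?_⟩
  · have := hG.comp hinv.continuousOn hinvmem
    have hcomp : (κ ∘ rescale M) ∘ inv = κ := funext fun y => congrArg κ (hresinv y)
    rwa [hcomp] at this
  · intro y hy hyC t ht
    have hmem : inv y ∈ carrier 𝒜 := by
      refine ⟨hinvmem y hy, fun x hx => ?_⟩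
      have hxmem : rescale M x ∈ Metric.closedBall 0 1 :=
        hres (closedCell_subset_carrier (isComplex_grid _ M) (hinvmem y hy) hx)
      have hdist : dist (rescale M x) y < δ := by
        have h := dist_rescale_le (M := M) hx (mem_closedCell_cellType (inv y))
        rw [hresinv] at h
        exact h.trans_lt hMδ
      have hxO : rescale M x ∈ O := hδO (Metric.mem_thickening_iff.2 ⟨y, ⟨hy, hyC⟩, hdist⟩)
      exact (hOeq.symm.subset ⟨hxO, hxmem⟩).1
    have := hGH _ hmem t ht
    simp only [Function.comp_apply, hresinv] at this
    exact this

/-- Extension of a partial homotopy over the image of a cube in a Hausdorff space. -/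
theorem exists_isPartialHomotopy_union [T2Space Z] {n : ℕ}
    (hS : ∀ k : ℕ, 2 ≤ k → ∀ x : S, Subsingleton (π_ k S x)) (hP : IsPathSystem F₀ F₁ P)
    {κ : (Fin n → ℝ) → Z} (hκ : IsCubeChart κ) {U : Set Z}
    (hU : ConsistentOn P U) (hκU : ∀ y ∈ Metric.closedBall 0 1, κ y ∈ U) {C W : Set Z}
    (hC : IsClosed C) (hW : IsOpen W) (hCW : C ⊆ W) {H : Z × ℝ → S}
    (hH : IsPartialHomotopy P id W H) :
    ∃ H' : Z × ℝ → S, IsPartialHomotopy P id (C ∪ κ '' Metric.closedBall 0 1) H' := by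
  classical
  obtain ⟨G, hG, hGH⟩ := exists_isPartialHomotopy_cube hS hP hκ.continuousOn hU hκU hC hW hCW hH
  have : Nonempty S := ⟨F₀ (κ 0)⟩
  let B := Metric.closedBall (0 : Fin n → ℝ) 1
  let Q : B × Set.Icc (0 : ℝ) 1 → Z × ℝ := fun p => (κ p.1, p.2)
  have : CompactSpace B := isCompact_iff_compactSpace.1 (isCompact_closedBall 0 1)
  have hκB : Continuous fun y : B => κ y :=
    hκ.continuousOn.comp_continuous continuous_subtype_val fun y => y.2
  have hQ : Continuous Q := (hκB.comp continuous_fst).prodMk (by fun_prop)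
  -- Injectivity of `κ` lets the homotopy descend from the cube to its image.
  obtain ⟨u, hu, huG⟩ := exists_continuousOn_factor hQ (h := fun p => G (p.1, p.2))
    (hG.continuousOn.comp_continuous (by fun_prop) fun p => ⟨p.1.2, p.2.2⟩) (by
      rintro ⟨y, t⟩ ⟨y', t'⟩ h
      obtain ⟨h1, h2⟩ := Prod.mk.injEq .. ▸ h
      obtain rfl := Subtype.ext h2
      obtain rfl := Subtype.ext (hκ.injOn y.2 y'.2 h1)
      rfl)
  have huG' : ∀ y ∈ B, ∀ t ∈ Set.Icc (0 : ℝ) 1, u (κ y, t) = G (y, t) := fun y hy t ht =>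
    huG (⟨y, hy⟩, ⟨t, ht⟩)
  have hrange : (κ '' B) ×ˢ Set.Icc (0 : ℝ) 1 ⊆ Set.range Q := by
    rintro ⟨_, t⟩ ⟨⟨y, hy, rfl⟩, ht⟩
    exact ⟨(⟨y, hy⟩, ⟨t, ht⟩), rfl⟩
  have hclosed : IsClosed (κ '' B) :=
    ((isCompact_closedBall 0 1).image_of_continuousOn hκ.continuousOn).isClosed
  let H' : Z × ℝ → S := fun q => if q.1 ∈ κ '' B then u q else H q
  have hH'u : ∀ y ∈ B, ∀ t, H' (κ y, t) = u (κ y, t) := fun y hy t => if_pos ⟨y, hy, rfl⟩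
  have hH'H : ∀ z ∈ C, ∀ t ∈ Set.Icc (0 : ℝ) 1, H' (z, t) = H (z, t) := by
    intro z hz t ht
    by_cases h : z ∈ κ '' B
    · obtain ⟨y, hy, rfl⟩ := h
      rw [hH'u y hy, huG' y hy t ht, hGH y hy hz t ht]
    · exact if_neg h
  have h0 : (0 : ℝ) ∈ Set.Icc (0 : ℝ) 1 := ⟨le_rfl, zero_le_one⟩
  have h1 : (1 : ℝ) ∈ Set.Icc (0 : ℝ) 1 := ⟨zero_le_one, le_rfl⟩
  refine ⟨H', ⟨?_, ?_, ?_, ?_⟩⟩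
  · rw [Set.union_prod]
    refine ContinuousOn.union_of_isClosed ?_ ?_ (hC.prod isClosed_Icc) (hclosed.prod isClosed_Icc)
    · exact (hH.continuousOn.mono (Set.prod_mono_left hCW)).congr fun q hq => hH'H _ hq.1 _ hq.2
    · exact (hu.mono hrange).congr fun q hq => if_pos hq.1
  · rintro z (hz | ⟨y, hy, rfl⟩)
    · rw [hH'H z hz 0 h0, hH.apply_zero z (hCW hz)]
    · rw [hH'u y hy, huG' y hy 0 h0, hG.apply_zero y hy]
      rfl
  · rintro z (hz | ⟨y, hy, rfl⟩)
    · rw [hH'H z hz 1 h1, hH.apply_one z (hCW hz)]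
    · rw [hH'u y hy, huG' y hy 1 h1, hG.apply_one y hy]
      rfl
  · rintro z (hz | ⟨y, hy, rfl⟩) p hp
    · exact hH.track z (hCW hz) p fun t => by rw [hp, hH'H z hz t t.2]
    · exact hG.track y hy p fun t => by rw [hp, hH'u y hy, huG' y hy t t.2]

/-- On a compact manifold, two maps to a space with trivial higher homotopy groups are homotopic
if they are connected by a locally consistent system of homotopy classes of paths. -/
theorem IsPathSystem.homotopic [T2Space Z] [CompactSpace Z] [Nonempty S] {n : ℕ}
    [ChartedSpace (EuclideanSpace ℝ (Fin n)) Z]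
    (hS : ∀ k : ℕ, 2 ≤ k → ∀ x : S, Subsingleton (π_ k S x)) (hP : IsPathSystem F₀ F₁ P) :
    F₀.Homotopic F₁ := by
  classical
  choose U hU hUcons using hP.locally_consistent
  choose κ hκ hκU _ hκnhds using fun z => exists_isCubeChart (n := n) (hU z)
  -- The induction carries an open neighbourhood of the half cubes treated so far, since keeping a
  -- homotopy on a closed set requires it to be defined around that set.
  have hind : ∀ s : Finset Z, ∃ (W : Set Z) (H : Z × ℝ → S), IsOpen W ∧
      (⋃ z ∈ s, κ z '' Metric.closedBall 0 (1 / 2)) ⊆ W ∧ IsPartialHomotopy P id W H := by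
    intro s
    induction s using Finset.induction_on with
    | empty =>
      obtain ⟨s₀⟩ := ‹Nonempty S›
      exact ⟨∅, fun _ => s₀, isOpen_empty, by simp, ⟨by simp, by simp, by simp, by simp⟩⟩
    | insert z s _ ih =>
      obtain ⟨W, H, hW, hsW, hH⟩ := ih
      have hclosed : IsClosed (⋃ z ∈ s, κ z '' Metric.closedBall 0 (1 / 2)) :=
        s.finite_toSet.isClosed_biUnion fun z _ =>
          ((isCompact_closedBall 0 (1 / 2)).image_of_continuousOn ((hκ z).continuousOn.mono
            (Metric.closedBall_subset_closedBall (by norm_num)))).isClosed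
      -- Some of the old domain is given up: the homotopy is kept only on the closure of `V`. The
      -- new open domain is `V` together with the interior of the new cube, which contains the new
      -- half cube.
      obtain ⟨V, hV, hsV, hVW⟩ := normal_exists_closure_subset hclosed hW hsW
      obtain ⟨H', hH'⟩ := exists_isPartialHomotopy_union hS hP (hκ z) (hUcons z) (hκU z)
        isClosed_closure hW hVW hH
      refine ⟨V ∪ interior (κ z '' Metric.closedBall 0 1), H', hV.union isOpen_interior, ?_,
        hH'.mono (Set.union_subset_union subset_closure interior_subset)⟩
      rw [Finset.set_biUnion_insert]
      exact Set.union_subset ((hκ z).image_half_subset.trans Set.subset_union_right)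
        (hsV.trans Set.subset_union_left)
  obtain ⟨s, hs⟩ := CompactSpace.elim_nhds_subcover _ hκnhds
  obtain ⟨W, H, -, hsW, hH⟩ := hind s
  have hWuniv : ∀ z, z ∈ W := fun z => hsW (hs.symm.subset (Set.mem_univ z))
  refine ⟨⟨⟨fun q => H (q.2, q.1), ?_⟩, fun z => hH.apply_zero z (hWuniv z),
    fun z => hH.apply_one z (hWuniv z)⟩⟩
  exact hH.continuousOn.comp_continuous (by fun_prop) fun q => ⟨hWuniv _, q.1.2⟩

end Extension

/-! ### Lengths of curves and short connecting curves -/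

section CurveLength

variable {Z : Type*} [PseudoEMetricSpace Z]

theorem edist_le_curveLength {x y : Z} (γ : Path x y) (s t : unitInterval) :
    edist (γ s) (γ t) ≤ curveLength γ :=
  eVariationOn.edist_le (fun t : unitInterval => γ t) (Set.mem_univ s) (Set.mem_univ t)

theorem curveLength_refl (x : Z) : curveLength (Path.refl x) = 0 :=
  eVariationOn.constant_on (by rintro _ ⟨_, _, rfl⟩ _ ⟨_, _, rfl⟩; rfl)

theorem curveLength_symm_le {x y : Z} (γ : Path x y) : curveLength γ.symm ≤ curveLength γ :=
  eVariationOn.comp_le_of_antitoneOn (fun t : unitInterval => γ t) unitInterval.symm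
    (fun _ _ _ _ h => unitInterval.symm_le_symm.2 h) (Set.mapsTo_univ _ _)

theorem curveLength_trans_le {x y z : Z} (γ : Path x y) (η : Path y z) :
    curveLength (γ.trans η) ≤ curveLength γ + curveLength η := by
  let h : unitInterval := ⟨1 / 2, by norm_num, by norm_num⟩
  have huniv : (Set.univ : Set unitInterval) = Set.Iic h ∪ Set.Ici h := Set.Iic_union_Ici.symm
  unfold curveLength
  rw [huniv, eVariationOn.union _ isGreatest_Iic isLeast_Ici, ← huniv]
  refine add_le_add ?_ ?_
  · let φ : unitInterval → unitInterval := fun t => Set.projIcc 0 1 zero_le_one (2 * (t : ℝ))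
    rw [eVariationOn.congr (g := (fun t : unitInterval => γ t) ∘ φ)]
    · refine eVariationOn.comp_le_of_monotoneOn _ _ (fun s _ t _ hst => ?_) (Set.mapsTo_univ _ _)
      exact Set.monotone_projIcc _ (by simpa using hst)
    · intro t ht
      have ht' : (t : ℝ) ≤ 1 / 2 := ht
      simp only [Path.trans_apply, dif_pos ht', Function.comp_apply, φ]
      rw [Set.projIcc_of_mem]
  · let φ : unitInterval → unitInterval := fun t => Set.projIcc 0 1 zero_le_one (2 * (t : ℝ) - 1)
    rw [eVariationOn.congr (g := (fun t : unitInterval => η t) ∘ φ)]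
    · refine eVariationOn.comp_le_of_monotoneOn _ _ (fun s _ t _ hst => ?_) (Set.mapsTo_univ _ _)
      exact Set.monotone_projIcc _ (by simpa using hst)
    · intro t ht
      have ht' : 1 / 2 ≤ (t : ℝ) := ht
      rcases ht'.eq_or_lt with h1 | h1
      · have : (2 * (t : ℝ) - 1) = 0 := by linarith
        simp only [Path.trans_apply, dif_pos h1.symm.le, Function.comp_apply, φ, this]
        have h2 : (2 * (t : ℝ)) = 1 := by linarith
        simp [h2]
      · simp only [Path.trans_apply, dif_neg (not_le.2 h1), Function.comp_apply, φ]
        rw [Set.projIcc_of_mem]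

/-- Any two points are joined by curves of length arbitrarily close to their distance. -/
def HasShortPaths (Z : Type*) [PseudoEMetricSpace Z] : Prop :=
  ∀ (z z' : Z) (r : ℝ≥0∞), edist z z' < r → ∃ δ : Path z z', curveLength δ < r

end CurveLength

open Manifold in
-- The distance is the infimum of the Riemannian lengths of smooth paths. The metric length of such
-- a path does not exceed its Riemannian length, because each chord of an inscribed polygon is at
-- most the Riemannian length of its arc, and these lengths add up.
theorem hasShortPaths_of_isRiemannianManifold {E H M : Type*} [NormedAddCommGroup E]
    [NormedSpace ℝ E] [TopologicalSpace H] {I : ModelWithCorners ℝ E H} [PseudoEMetricSpace M]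
    [ChartedSpace H M] [Bundle.RiemannianBundle (fun x : M => TangentSpace I x)]
    [IsRiemannianManifold I M] :
    HasShortPaths M := by
  intro z z' r h
  rw [IsRiemannianManifold.out (I := I) z z'] at h
  obtain ⟨γ, h0, h1, hγ, hlen⟩ := exists_lt_of_riemannianEDist_lt h
  refine ⟨⟨⟨fun t => γ t, hγ.continuousOn.comp_continuous continuous_subtype_val fun t => t.2⟩,
    by simpa using h0, by simpa using h1⟩, lt_of_le_of_lt ?_ hlen⟩
  refine iSup_le ?_
  rintro ⟨k, u, hu, -⟩
  have key : ∀ k : ℕ, ∑ i ∈ Finset.range k, edist (γ (u (i + 1))) (γ (u i)) ≤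
      pathELength I γ (u 0) (u k) := by
    intro k
    induction k with
    | zero => simp
    | succ k ih =>
      have hk : (u k : ℝ) ≤ u (k + 1) := hu k.le_succ
      rw [Finset.sum_range_succ, ← pathELength_add (hu (Nat.zero_le k) : (u 0 : ℝ) ≤ u k) hk]
      refine add_le_add ih ?_
      rw [edist_comm, IsRiemannianManifold.out (I := I)]
      exact riemannianEDist_le_pathELength
        (hγ.mono (Set.Icc_subset_Icc (u k).2.1 (u (k + 1)).2.2)) rfl rfl hk
  exact (key k).trans (pathELength_mono (u 0).2.1 (u k).2.2)

/-- Paths in the image of a cube chart lift to the cube. -/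
theorem IsCubeChart.exists_isImagePath {Z : Type*} [TopologicalSpace Z] [T2Space Z] {n : ℕ}
    {κ : (Fin n → ℝ) → Z} (hκ : IsCubeChart κ) {z z' : Z} (γ : Path z z')
    (hγ : ∀ t, γ t ∈ κ '' Metric.closedBall 0 1) {y y' : Fin n → ℝ}
    (hy : y ∈ Metric.closedBall 0 1) (hy' : y' ∈ Metric.closedBall 0 1) (hyz : κ y = z)
    (hyz' : κ y' = z') : ∃ α : Path y y', IsImagePath (Metric.closedBall 0 1) κ α γ := by
  let B := Metric.closedBall (0 : Fin n → ℝ) 1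
  have : CompactSpace B := isCompact_iff_compactSpace.1 (isCompact_closedBall 0 1)
  have hemb : Topology.IsClosedEmbedding fun y : B => κ y :=
    (hκ.continuousOn.comp_continuous continuous_subtype_val fun y => y.2).isClosedEmbedding
      fun a b h => Subtype.ext (hκ.injOn a.2 b.2 h)
  choose α hα hακ using hγ
  have hcont : Continuous fun t => (⟨α t, hα t⟩ : B) := by
    rw [hemb.isInducing.continuous_iff]
    convert γ.continuous using 1
    exact funext hακ
  refine ⟨⟨⟨α, continuous_subtype_val.comp hcont⟩, ?_, ?_⟩, fun t => ⟨hα t, (hακ t).symm⟩⟩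
  · exact hκ.injOn (hα 0) hy (by rw [hακ, hyz, γ.source])
  · exact hκ.injOn (hα 1) hy' (by rw [hακ, hyz', γ.target])

/-- Both paths lift to the cube, where the straight-line homotopy is available. No regularity or
length bound is needed. -/
theorem IsCubeChart.homotopic {Z : Type*} [TopologicalSpace Z] [T2Space Z] {n : ℕ}
    {κ : (Fin n → ℝ) → Z} (hκ : IsCubeChart κ) {z z' : Z} {γ η : Path z z'}
    (hγ : ∀ t, γ t ∈ κ '' Metric.closedBall 0 1) (hη : ∀ t, η t ∈ κ '' Metric.closedBall 0 1) :
    γ.Homotopic η := by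
  obtain ⟨y, hy, hyz⟩ : z ∈ κ '' Metric.closedBall 0 1 := by simpa using hγ 0
  obtain ⟨y', hy', hyz'⟩ : z' ∈ κ '' Metric.closedBall 0 1 := by simpa using hγ 1
  obtain ⟨α, hα⟩ := hκ.exists_isImagePath γ hγ hy hy' hyz hyz'
  obtain ⟨β, hβ⟩ := hκ.exists_isImagePath η hη hy hy' hyz hyz'
  exact hα.homotopic (convex_closedBall 0 1) hκ.continuousOn hβ

/-! ### Short classes of paths in the target -/

/-- The path `p` is homotopic to the image under `f` of a curve of length less than `1 / 2`. -/
def IsShortClass {Z S : Type*} [PseudoEMetricSpace Z] [TopologicalSpace S] (f : C(Z, S)) {z z' : Z}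
    (p : Path (f z) (f z')) : Prop :=
  ∃ δ : Path z z', curveLength δ < 1 / 2 ∧ p.Homotopic (δ.map f.continuous)

namespace IsShortClass

variable {Z S : Type*} [PseudoEMetricSpace Z] [TopologicalSpace S] {f : C(Z, S)} {z z' z'' : Z}

theorem congr {p q : Path (f z) (f z')} (h : IsShortClass f p) (hpq : p.Homotopic q) :
    IsShortClass f q := by
  obtain ⟨δ, h1, h2⟩ := h
  exact ⟨δ, h1, hpq.symm.trans h2⟩

theorem refl (z : Z) : IsShortClass f (Path.refl (f z)) :=
  ⟨Path.refl z, by rw [curveLength_refl]; simp, Path.Homotopic.refl _⟩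

theorem symm {p : Path (f z) (f z')} (h : IsShortClass f p) : IsShortClass f p.symm := by
  obtain ⟨δ, h1, h2⟩ := h
  refine ⟨δ.symm, (curveLength_symm_le δ).trans_lt h1, ?_⟩
  rw [← Path.map_symm]
  exact h2.symm₂

theorem exists_path (hZ : HasShortPaths Z) (h : edist z z' < 1 / 2) :
    ∃ p : Path (f z) (f z'), IsShortClass f p := by
  obtain ⟨δ, hδ⟩ := hZ z z' _ h
  exact ⟨δ.map f.continuous, δ, hδ, Path.Homotopic.refl _⟩

/-- One short curve followed by the reverse of the other is a loop of length at most `1 / 2 + 1 /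
2`, so its image is null-homotopic. -/
theorem homotopic (hf : ∀ (z : Z) (γ : Path z z), curveLength γ ≤ 1 →
      (γ.map f.continuous).Homotopic (Path.refl (f z)))
    {p q : Path (f z) (f z')} (hp : IsShortClass f p) (hq : IsShortClass f q) :
    p.Homotopic q := by
  obtain ⟨δ, h1, h2⟩ := hp
  obtain ⟨η, h3, h4⟩ := hq
  refine h2.trans (Path.Homotopic.trans ?_ h4.symm)
  apply Path.Homotopic.of_trans_symm
  rw [Path.map_symm, ← Path.map_trans]
  refine hf z _ ((curveLength_trans_le _ _).trans ?_)
  calc curveLength δ + curveLength η.symm ≤ 1 / 2 + 1 / 2 :=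
        add_le_add h1.le ((curveLength_symm_le η).trans h3.le)
    _ = 1 := ENNReal.add_halves 1

/-- The given representatives may have length close to `1 / 2`, so their lengths cannot simply be
added. The distance bounds provide representatives shorter than `1 / 4`, which define the same
classes by uniqueness. -/
theorem trans (hZ : HasShortPaths Z) (hf : ∀ (z : Z) (γ : Path z z), curveLength γ ≤ 1 →
      (γ.map f.continuous).Homotopic (Path.refl (f z)))
    (h : edist z z' < 1 / 2 / 2) (h' : edist z' z'' < 1 / 2 / 2)
    {p : Path (f z) (f z')} {q : Path (f z') (f z'')} (hp : IsShortClass f p)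
    (hq : IsShortClass f q) : IsShortClass f (p.trans q) := by
  have h4 := ENNReal.add_halves (1 / 2)
  have hle : (1 / 2 / 2 : ℝ≥0∞) ≤ 1 / 2 := ENNReal.half_le_self
  obtain ⟨δ, hδ⟩ := hZ z z' _ h
  obtain ⟨η, hη⟩ := hZ z' z'' _ h'
  refine ⟨δ.trans η, (curveLength_trans_le δ η).trans_lt ?_, ?_⟩
  · rw [← h4]
    exact ENNReal.add_lt_add hδ hη
  · rw [Path.map_trans]
    exact (hp.homotopic hf ⟨δ, hδ.trans_le hle, Path.Homotopic.refl _⟩).hcomp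
      (hq.homotopic hf ⟨η, hη.trans_le hle, Path.Homotopic.refl _⟩)

end IsShortClass

/-- Paths near a given point represent the short class between their end points. -/
theorem exists_nhds_isShortClass {Z S : Type*} [EMetricSpace Z] {n : ℕ}
    [ChartedSpace (EuclideanSpace ℝ (Fin n)) Z] [TopologicalSpace S] (f : C(Z, S))
    (hZ : HasShortPaths Z) (z₀ : Z) :
    ∃ U ∈ 𝓝 z₀, ∀ (z z' : Z) (γ : Path z z'), (∀ t, γ t ∈ U) →
      IsShortClass f (γ.map f.continuous) ∧ edist z z' < 1 / 2 / 2 := by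
  obtain ⟨κ, hκ, -, -, hnhds⟩ := exists_isCubeChart (n := n) (Filter.univ_mem (f := 𝓝 z₀))
  have hV : κ '' Metric.closedBall 0 1 ∈ 𝓝 z₀ := Filter.mem_of_superset hnhds
    (Set.image_mono (Metric.closedBall_subset_closedBall (by norm_num)))
  obtain ⟨ε, hε, hεV⟩ := EMetric.mem_nhds_iff.1 hV
  -- The bound `ε / 3` keeps a curve of length less than `2 δ` that starts within `δ` of `z₀` inside
  -- the chart image. The bound `1 / 8` gives `2 δ ≤ 1 / 4`.
  let δ : ℝ≥0∞ := min (ε / 3) (1 / 2 / 2 / 2)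
  have hδ : 0 < δ := lt_min (ENNReal.div_pos hε.ne' (by norm_num)) (by norm_num)
  have hδε : δ + (δ + δ) ≤ ε := by
    calc δ + (δ + δ) ≤ ε / 3 + (ε / 3 + ε / 3) :=
          add_le_add (min_le_left _ _) (add_le_add (min_le_left _ _) (min_le_left _ _))
      _ = ε := by rw [← add_assoc, ENNReal.add_thirds]
  have h8 : δ + δ ≤ 1 / 2 / 2 := by
    calc δ + δ ≤ 1 / 2 / 2 / 2 + 1 / 2 / 2 / 2 := add_le_add (min_le_right _ _) (min_le_right _ _)
      _ = 1 / 2 / 2 := ENNReal.add_halves _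
  have hδU : Metric.eball z₀ δ ⊆ κ '' Metric.closedBall 0 1 := by
    refine (Metric.eball_subset_eball ?_).trans hεV
    exact le_self_add.trans hδε
  refine ⟨Metric.eball z₀ δ, Metric.eball_mem_nhds z₀ hδ, fun z z' γ hγ => ?_⟩
  have hz : edist z z₀ < δ := by simpa using hγ 0
  have hz' : edist z' z₀ < δ := by simpa using hγ 1
  have hzz' : edist z z' < δ + δ := (edist_triangle_right z z' z₀).trans_lt
    (ENNReal.add_lt_add hz hz')
  refine ⟨?_, hzz'.trans_le h8⟩
  -- The path `γ` need not have finite length. It is replaced by a short curve in the same chart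
  -- image, to which it is homotopic.
  obtain ⟨η, hη⟩ := hZ z z' _ hzz'
  have hηV : ∀ t, η t ∈ κ '' Metric.closedBall 0 1 := by
    intro t
    refine hεV (lt_of_lt_of_le ?_ hδε)
    have h1 : edist (η t) z ≤ curveLength η := by
      simpa using edist_le_curveLength η t 0
    calc edist (η t) z₀ ≤ edist (η t) z + edist z z₀ := edist_triangle _ _ _
      _ < (δ + δ) + δ := ENNReal.add_lt_add (h1.trans_lt hη) hz
      _ = δ + (δ + δ) := add_comm _ _
  refine ⟨η, hη.trans_le (h8.trans ENNReal.half_le_self), (hκ.homotopic (fun t => hδU (hγ t)) hηV).map f⟩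

namespace LatticeCell

theorem shift_comm {ι : Type*} [DecidableEq ι] (c : ι → ℤ) {i j : ι} (hij : i ≠ j) (a b : ℤ) :
    shift (shift c i a) j b = shift (shift c j b) i a := by
  ext k
  rcases eq_or_ne k i with rfl | hi
  · simp [shift, hij]
  · rcases eq_or_ne k j with rfl | hj
    · simp [shift, hij.symm]
    · simp [shift, hi, hj]

theorem segPath_symm_apply {ι : Type*} (x y : ι → ℝ) (t : unitInterval) :
    segPath x y (unitInterval.symm t) = segPath y x t := by
  ext i
  rw [segPath_apply', segPath_apply']
  simp only [unitInterval.coe_symm_eq]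
  ring

/-- Near a given point there are only cells that have the cell of the point as a face. -/
theorem exists_nhds_isFace {ι : Type*} [Finite ι] {𝒞 : Set (ι → ℤ)} (hfin : 𝒞.Finite)
    (x₀ : ι → ℝ) : ∃ V ∈ 𝓝 x₀, ∀ x ∈ V, x ∈ carrier 𝒞 → IsFace (cellType x₀) (cellType x) := by
  let A := ⋃ c ∈ {c | c ∈ 𝒞 ∧ ¬ IsFace (cellType x₀) c}, closedCell c
  have hA : IsClosed A :=
    (hfin.subset fun c hc => hc.1).isClosed_biUnion fun c _ => isClosed_closedCell c
  have hx₀ : x₀ ∉ A := by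
    simp only [A, Set.mem_iUnion, not_exists]
    exact fun c hc h => hc.2 (mem_closedCell_iff.1 h)
  refine ⟨Aᶜ, hA.isOpen_compl.mem_nhds hx₀, fun x hx hx𝒞 => ?_⟩
  by_contra h
  exact hx (Set.mem_biUnion (show cellType x ∈ {c | c ∈ 𝒞 ∧ ¬ IsFace (cellType x₀) c} from
    ⟨hx𝒞, h⟩) (mem_closedCell_cellType x))

end LatticeCell

/-! ### Extending a vertex map over a complex with edges in short classes -/

section VertexMap

open LatticeCell

variable {ι Z S : Type*} [PseudoEMetricSpace Z] [TopologicalSpace S]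

/-- The condition on a map `g` on a cell: it maps each vertex `v` to `f (ζ v)`, and each edge to a
path in the short class. -/
structure IsShortOn [DecidableEq ι] (f : C(Z, S)) (ζ : (ι → ℤ) → Z) (c : ι → ℤ)
    (g : (ι → ℝ) → S) : Prop where
  vertex : ∀ v, IsFace v c → (∀ i, v i % 2 = 0) → g (center v) = f (ζ v)
  edge : ∀ i, c i % 2 = 1 → (∀ j, j ≠ i → c j % 2 = 0) →
    ∀ p : Path (f (ζ (shift c i (-1)))) (f (ζ (shift c i 1))),
      (∀ t, p t = g (segPath (center (shift c i (-1))) (center (shift c i 1)) t)) →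
        IsShortClass f p

theorem IsShortOn.congr [DecidableEq ι] {f : C(Z, S)} {ζ : (ι → ℤ) → Z} {c : ι → ℤ}
    {g g' : (ι → ℝ) → S} (h : Set.EqOn g g' (closedCell c)) (hg : IsShortOn f ζ c g) :
    IsShortOn f ζ c g' where
  vertex v hv hev := (h (center_mem_closedCell_iff.2 hv)).symm.trans (hg.vertex v hv hev)
  edge i hi he p hp := hg.edge i hi he p fun t => by
    rw [hp, h (segPath_mem (convex_closedCell c)
      (center_mem_closedCell_iff.2 (isFace_shift hi (Or.inl rfl)))
      (center_mem_closedCell_iff.2 (isFace_shift hi (Or.inr rfl))) t)]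

variable {f : C(Z, S)} {ζ : (ι → ℤ) → Z} {𝒞 : Set (ι → ℤ)}

/-- A map on the vertices of a complex that moves adjacent vertices by a small distance extends to
the complex, sending the edges to short classes. -/
theorem exists_isShortOn [Fintype ι] [DecidableEq ι] [Nonempty S]
    (hS : ∀ k : ℕ, 2 ≤ k → ∀ x : S, Subsingleton (π_ k S x)) (hZ : HasShortPaths Z)
    (hf : ∀ (z : Z) (γ : Path z z), curveLength γ ≤ 1 →
      (γ.map f.continuous).Homotopic (Path.refl (f z)))
    (h𝒞 : IsComplex 𝒞) (hfin : 𝒞.Finite)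
    (hζ : ∀ c ∈ 𝒞, ∀ v w, IsFace v c → IsFace w c → edist (ζ v) (ζ w) < 1 / 2 / 2) :
    ∃ g : (ι → ℝ) → S, ContinuousOn g (carrier 𝒞) ∧ ∀ c ∈ 𝒞, IsShortOn f ζ c g := by
  obtain ⟨s₀⟩ := ‹Nonempty S›
  -- The process starts from the empty complex, so vertices are filled like other cells; the initial
  -- constant map plays no role.
  obtain ⟨g, hg, -, hgood⟩ := exists_extension (𝒜 := (∅ : Set (ι → ℤ)))
    (fun c hc => absurd hc (Set.notMem_empty c)) (IsShortOn f ζ)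
    (fun σ g g' h hg => hg.congr h) (g₀ := fun _ => s₀) continuousOn_const
    (fun σ hσ => absurd hσ (Set.notMem_empty σ)) h𝒞 hfin (Set.empty_subset 𝒞) (by
      intro c hc _ u hu hgood
      have hvert : ∀ v, IsFace v c → v ≠ c → (∀ i, v i % 2 = 0) → u (center v) = f (ζ v) :=
        fun v hv hne hev => (hgood v hv hne).vertex v (IsFace.refl v) hev
      rcases dim_cases c with h | ⟨i, hi, he⟩ | ⟨i, j, hij, hi, hj, he⟩ | h
      · refine ⟨fun _ => f (ζ c), continuousOn_const, ?_, ?_, ?_⟩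
        · intro x hx
          obtain ⟨-, k, hk, -⟩ := mem_boundary_iff.1 hx
          have := h k
          omega
        · intro v hv _
          have : v = c := by
            rw [isFace_iff] at hv
            ext k
            have := hv k
            have := h k
            omega
          rw [this]
        · intro k hk
          have := h k
          omega
      · have hev : ∀ ε : ℤ, ε = -1 ∨ ε = 1 → ∀ k, shift c i ε k % 2 = 0 := by
          intro ε hε k
          rcases eq_or_ne k i with rfl | hk
          · simp only [shift, Function.update_self]
            omega
          · simpa [shift, hk] using he k hk
        have hlo : IsFace (shift c i (-1)) c := isFace_shift hi (Or.inl rfl)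
        have hhi : IsFace (shift c i 1) c := isFace_shift hi (Or.inr rfl)
        obtain ⟨p, hp⟩ := IsShortClass.exists_path (f := f) hZ
          ((hζ c hc _ _ hlo hhi).trans_le ENNReal.half_le_self)
        obtain ⟨u', h1, h2, h3⟩ := exists_extension_edge hi he p
          (hvert _ hlo (shift_ne (Or.inl rfl)) (hev _ (Or.inl rfl)))
          (hvert _ hhi (shift_ne (Or.inr rfl)) (hev _ (Or.inr rfl)))
        refine ⟨u', h1, h2, ?_, ?_⟩
        · intro v hv hveven
          have hne : v ≠ c := by
            rintro rfl
            have := hveven i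
            omega
          rw [h2 (center_mem_boundary hv hne), hvert v hv hne hveven]
        · intro k hk _ q hq
          obtain rfl : k = i := by
            by_contra hki
            have := he k hki
            omega
          have : q = p := by
            ext t
            rw [hq, h3]
          rwa [this]
      · have hvv : ∀ u' : (ι → ℝ) → S, Set.EqOn u' u (boundary c) → IsShortOn f ζ c u' := by
          intro u' hu'
          refine ⟨fun v hv hveven => ?_, fun k hk hke => ?_⟩
          · have hne : v ≠ c := by
              rintro rfl
              have := hveven i
              omega
            rw [hu' (center_mem_boundary hv hne), hvert v hv hne hveven]
          · have h1 : i = k := by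
              by_contra h
              have := hke i h
              omega
            have h2 : j = k := by
              by_contra h
              have := hke j h
              omega
            exact absurd (h1.trans h2.symm) hij
        have hev : ∀ a b : ℤ, a = -1 ∨ a = 1 → b = -1 ∨ b = 1 →
            ∀ k, shift (shift c i a) j b k % 2 = 0 := by
          intro a b ha hb k
          rcases eq_or_ne k j with rfl | hkj
          · simp only [shift, Function.update_self, Function.update_of_ne hij.symm]
            omega
          · rcases eq_or_ne k i with rfl | hki
            · simp only [shift, Function.update_self, Function.update_of_ne hij]
              omega
            · simpa [shift, hkj, hki] using he k hki hkj
        have hface : ∀ a b : ℤ, a = -1 ∨ a = 1 → b = -1 ∨ b = 1 →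
            IsFace (shift (shift c i a) j b) c := by
          intro a b ha hb
          refine (isFace_shift ?_ hb).trans (isFace_shift hi ha)
          simpa [shift, hij.symm] using hj
        have hedge : ∀ (e : ι → ℤ) (k : ι), IsFace e c → e ≠ c → e k % 2 = 1 →
            (∀ l, l ≠ k → e l % 2 = 0) →
            ∃ p : Path (f (ζ (shift e k (-1)))) (f (ζ (shift e k 1))), IsShortClass f p ∧
              ∀ t, p t = u (segPath (center (shift e k (-1))) (center (shift e k 1)) t) := by
          intro e k hec hne hk hke
          have hlo : IsFace (shift e k (-1)) e := isFace_shift hk (Or.inl rfl)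
          have hhi : IsFace (shift e k 1) e := isFace_shift hk (Or.inr rfl)
          have hev : ∀ ε : ℤ, ε = -1 ∨ ε = 1 → ∀ l, shift e k ε l % 2 = 0 := by
            intro ε hε l
            rcases eq_or_ne l k with rfl | hl
            · simp only [shift, Function.update_self]
              omega
            · simpa [shift, hl] using hke l hl
          obtain ⟨p, hp⟩ := IsImagePath.exists_path
            (hu.mono (closedCell_subset_boundary hec hne))
            (segPath_mem (convex_closedCell e) (center_mem_closedCell_iff.2 hlo)
              (center_mem_closedCell_iff.2 hhi))
            ((hgood e hec hne).vertex _ hlo (hev _ (Or.inl rfl)))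
            ((hgood e hec hne).vertex _ hhi (hev _ (Or.inr rfl)))
          exact ⟨p, (hgood e hec hne).edge k hk hke p fun t => (hp t).2, fun t => (hp t).2⟩
        have hi_edge : ∀ b : ℤ, b = -1 ∨ b = 1 →
            ∃ p : Path (f (ζ (shift (shift c i (-1)) j b))) (f (ζ (shift (shift c i 1) j b))),
              IsShortClass f p ∧ ∀ t, p t = u (segPath (center (shift (shift c i (-1)) j b))
                (center (shift (shift c i 1) j b)) t) := by
          intro b hb
          rw [shift_comm c hij, shift_comm c hij]
          refine hedge _ i (isFace_shift hj hb) (shift_ne hb) (by simpa [shift, hij] using hi) ?_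
          intro l hl
          rcases eq_or_ne l j with rfl | hlj
          · simp only [shift, Function.update_self]
            omega
          · simpa [shift, hlj] using he l hl hlj
        have hj_edge : ∀ a : ℤ, a = -1 ∨ a = 1 →
            ∃ p : Path (f (ζ (shift (shift c i a) j (-1)))) (f (ζ (shift (shift c i a) j 1))),
              IsShortClass f p ∧ ∀ t, p t = u (segPath (center (shift (shift c i a) j (-1)))
                (center (shift (shift c i a) j 1)) t) := by
          intro a ha
          refine hedge _ j (isFace_shift hi ha) (shift_ne ha) (by simpa [shift, hij.symm] using hj) ?_
          intro l hl
          rcases eq_or_ne l i with rfl | hli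
          · simp only [shift, Function.update_self]
            omega
          · simpa [shift, hli] using he l hli hl
        obtain ⟨p₁, hp₁, hp₁u⟩ := hi_edge (-1) (Or.inl rfl)
        obtain ⟨p₂, hp₂, hp₂u⟩ := hj_edge 1 (Or.inr rfl)
        obtain ⟨q₁, hq₁, hq₁u⟩ := hj_edge (-1) (Or.inl rfl)
        obtain ⟨q₂, hq₂, hq₂u⟩ := hi_edge 1 (Or.inr rfl)
        have hd : ∀ a b a' b' : ℤ, a = -1 ∨ a = 1 → b = -1 ∨ b = 1 → a' = -1 ∨ a' = 1 →
            b' = -1 ∨ b' = 1 → edist (ζ (shift (shift c i a) j b))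
              (ζ (shift (shift c i a') j b')) < 1 / 2 / 2 := fun a b a' b' h1 h2 h3 h4 =>
          hζ c hc _ _ (hface a b h1 h2) (hface a' b' h3 h4)
        -- Each boundary path is a product of two short classes between points at distance less than
        -- `1 / 4`, hence itself short. Short classes with the same end points coincide.
        obtain ⟨u', h1, h2⟩ := exists_extension_of_dim_two hij hi hj he hp₁u hp₂u hq₁u hq₂u
          ((hp₁.trans hZ hf (hd _ _ _ _ (by simp) (by simp) (by simp) (by simp))
            (hd _ _ _ _ (by simp) (by simp) (by simp) (by simp)) hp₂).homotopic hf
          (hq₁.trans hZ hf (hd _ _ _ _ (by simp) (by simp) (by simp) (by simp))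
            (hd _ _ _ _ (by simp) (by simp) (by simp) (by simp)) hq₂))
        exact ⟨u', h1, h2, hvv u' h2⟩
      · obtain ⟨u', h1, h2⟩ := exists_extension_of_three_le_dim hS h hu
        refine ⟨u', h1, h2, fun v hv hveven => ?_, fun k hk hke => ?_⟩
        · have hne : v ≠ c := by
            rintro rfl
            have : IsEmpty {i // v i % 2 = 1} := ⟨fun i => by
              have := hveven i
              have := i.2
              omega⟩
            have : dim v = 0 := Fintype.card_eq_zero
            omega
          rw [h2 (center_mem_boundary hv hne), hvert v hv hne hveven]
        · have hle : dim c ≤ 1 := Fintype.card_le_one_iff.2 (by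
            have : ∀ a : {i // c i % 2 = 1}, a = ⟨k, hk⟩ := by
              rintro ⟨a, ha⟩
              ext
              by_contra hak
              have := hke a hak
              omega
            intro a b
            rw [this a, this b])
          omega)
  exact ⟨g, hg, hgood⟩

/-- A map that sends the edges to short classes also sends all segments between vertices of a cell
to short classes. -/
theorem isShortClass_of_isImagePath [Finite ι] [DecidableEq ι] (hZ : HasShortPaths Z)
    (hf : ∀ (z : Z) (γ : Path z z), curveLength γ ≤ 1 →
      (γ.map f.continuous).Homotopic (Path.refl (f z)))
    (h𝒞 : IsComplex 𝒞)
    (hζ : ∀ c ∈ 𝒞, ∀ v w, IsFace v c → IsFace w c → edist (ζ v) (ζ w) < 1 / 2 / 2)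
    {g : (ι → ℝ) → S} (hg : ContinuousOn g (carrier 𝒞)) (hgood : ∀ c ∈ 𝒞, IsShortOn f ζ c g)
    {c : ι → ℤ} (hc : c ∈ 𝒞) {v w : ι → ℤ} (hv : IsFace v c) (hw : IsFace w c)
    (hv2 : ∀ i, v i % 2 = 0) (hw2 : ∀ i, w i % 2 = 0) {p : Path (f (ζ v)) (f (ζ w))}
    (hp : IsImagePath (closedCell c) g (segPath (center v) (center w)) p) :
    IsShortClass f p := by
  have hgc : ContinuousOn g (closedCell c) := hg.mono (closedCell_subset_carrier h𝒞 hc)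
  -- Induction on the number of coordinates in which the vertices differ: one coordinate is switched
  -- along an edge of the cell, and the triangle formed with the remaining segment is filled by
  -- convexity.
  induction hn : {i | v i ≠ w i}.ncard generalizing v with
  | zero =>
    have hvw : v = w := by
      rw [Set.ncard_eq_zero] at hn
      ext i
      by_contra h
      exact Set.notMem_empty i (hn ▸ h)
    subst hvw
    refine (IsShortClass.refl (ζ v)).congr ?_
    refine IsImagePath.homotopic (convex_closedCell c) hgc (β := segPath (center v) (center v))
      (fun t => ⟨(hp t).1, ?_⟩) hp
    have h1 : segPath (center v) (center v) t = center v := by simp [segPath_apply]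
    rw [h1, (hgood c hc).vertex v hv hv2]
    rfl
  | succ n ih =>
    obtain ⟨i, hi⟩ : {i | v i ≠ w i}.Nonempty := Set.nonempty_of_ncard_ne_zero (by omega)
    have hi : v i ≠ w i := hi
    have hvi := hv.eq_or i
    have hwi := hw.eq_or i
    have hci : c i % 2 = 1 := by
      have := hv2 i
      have := hw2 i
      omega
    let v' := Function.update v i (w i)
    let e := Function.update v i (c i)
    have hv'i : v' i = w i := Function.update_self ..
    have hv'ne : ∀ k, k ≠ i → v' k = v k := fun k hk => Function.update_of_ne hk ..
    have hei : e i = c i := Function.update_self ..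
    have hene : ∀ k, k ≠ i → e k = v k := fun k hk => Function.update_of_ne hk ..
    have hv' : IsFace v' c := by
      intro k
      rcases eq_or_ne k i with rfl | hk
      · rw [hv'i]; exact hw k
      · rw [hv'ne k hk]; exact hv k
    have hv'2 : ∀ k, v' k % 2 = 0 := by
      intro k
      rcases eq_or_ne k i with rfl | hk
      · rw [hv'i]; exact hw2 k
      · rw [hv'ne k hk]; exact hv2 k
    have he : IsFace e c := by
      intro k
      rcases eq_or_ne k i with rfl | hk
      · rw [hei]; exact IsFace.refl c k
      · rw [hene k hk]; exact hv k
    have he2 : ∀ k, k ≠ i → e k % 2 = 0 := fun k hk => by rw [hene k hk]; exact hv2 k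
    have hshift : ∀ (a : ℤ) (x : ι → ℤ), x i = c i + a → (∀ k, k ≠ i → x k = v k) →
        x = shift e i a := by
      intro a x h1 h2
      ext k
      rcases eq_or_ne k i with rfl | hk
      · simp [shift, hei, h1]
      · simp [shift, hk, hene k hk, h2 k hk]
    have hmem : ∀ {x}, IsFace x c → center x ∈ closedCell c := fun h =>
      center_mem_closedCell_iff.2 h
    obtain ⟨q, hq⟩ := IsImagePath.exists_path hgc
      (segPath_mem (convex_closedCell c) (hmem hv) (hmem hv'))
      ((hgood c hc).vertex v hv hv2) ((hgood c hc).vertex v' hv' hv'2)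
    obtain ⟨r, hr⟩ := IsImagePath.exists_path hgc
      (segPath_mem (convex_closedCell c) (hmem hv') (hmem hw))
      ((hgood c hc).vertex v' hv' hv'2) ((hgood c hc).vertex w hw hw2)
    have hr' : IsShortClass f r := by
      refine ih hv' hv'2 hr ?_
      have hset : {k | v' k ≠ w k} = {k | v k ≠ w k} \ {i} := by
        ext k
        rcases eq_or_ne k i with rfl | hk
        · simp [hv'i]
        · simp [hv'ne k hk, hk]
      rw [hset, Set.ncard_sdiff_singleton_of_mem (show i ∈ {k | v k ≠ w k} from hi), hn]
      rfl
    have hq' : IsShortClass f q := by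
      have hgood_e := hgood e (h𝒞 c hc e he)
      have hei2 : e i % 2 = 1 := by rw [hei]; exact hci
      have hcases : (v i = c i + -1 ∧ w i = c i + 1) ∨ (v i = c i + 1 ∧ w i = c i + -1) := by
        have := hv2 i
        have := hw2 i
        omega
      have key : ∀ x y : ι → ℤ, x = shift e i (-1) → y = shift e i 1 →
          ∀ q : Path (f (ζ x)) (f (ζ y)), (∀ t, q t = g (segPath (center x) (center y) t)) →
            IsShortClass f q := by
        rintro x y rfl rfl q hq
        exact hgood_e.edge i hei2 he2 q hq
      rcases hcases with ⟨h1, h2⟩ | ⟨h1, h2⟩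
      · exact key v v' (hshift _ v h1 fun _ _ => rfl) (hshift _ v' (hv'i.trans h2) hv'ne) q
          fun t => (hq t).2
      -- Edges are oriented by increasing coordinate; in this case the edge is traversed backwards.
      · have := (key v' v (hshift _ v' (hv'i.trans h2) hv'ne) (hshift _ v h1 fun _ _ => rfl) q.symm
          fun t => by rw [← segPath_symm_apply]; exact (hq _).2).symm
        rwa [Path.symm_symm] at this
    exact (hq'.trans hZ hf (hζ c hc _ _ hv hv') (hζ c hc _ _ hv' hw) hr').congr
      (homotopic_of_triangle (convex_closedCell c) hgc hq hr hp)

end VertexMap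

open LatticeCell

/-! ### The nerve as a cubical complex -/

namespace BallCover

variable {Z : Type*} [PseudoEMetricSpace Z] {D : ℕ} (B : BallCover Z D)

/-- The cells of the rectangular nerve. -/
def nerveComplex : Set (Fin D → ℤ) :=
  {c | (∀ i, 0 ≤ c i ∧ c i ≤ 2) ∧ (∃ i, c i = 2) ∧ ∃ z, ∀ i, c i ≠ 0 → z ∈ B.ball i}

/-- The coordinates of the nerve in which all radii are one. -/
noncomputable def normalize (x : Fin D → ℝ) : Fin D → ℝ := fun i => x i / B.radius i

theorem continuous_normalize : Continuous B.normalize := by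
  unfold normalize; fun_prop

/-- Only coordinates with code 1 can change on a face. So a coordinate with code 2 survives, and the
set of balls required to have a common point can only shrink. -/
theorem isComplex_nerveComplex : IsComplex B.nerveComplex := by
  rintro c ⟨h, ⟨i, hi⟩, z, hz⟩ d hd
  rw [isFace_iff] at hd
  refine ⟨fun j => ?_, ⟨i, ?_⟩, z, fun j hj => hz j ?_⟩
  · have := h j
    have := hd j
    omega
  · have := hd i
    omega
  · have := h j
    have := hd j
    omega

theorem finite_nerveComplex : B.nerveComplex.Finite :=
  (Set.finite_Icc (0 : Fin D → ℤ) fun _ => 2).subset fun _ hc =>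
    ⟨fun i => (hc.1 i).1, fun i => (hc.1 i).2⟩

theorem cellType_eq_zero {x : ℝ} (h : x = 0) : ⌊x⌋ + ⌈x⌉ = 0 := by simp [h]

theorem cellType_eq_two {x : ℝ} (h : x = 1) : ⌊x⌋ + ⌈x⌉ = 2 := by simp [h]

theorem cellType_eq_one {x : ℝ} (h0 : 0 < x) (h1 : x < 1) : ⌊x⌋ + ⌈x⌉ = 1 := by
  have h2 : ⌊x⌋ = 0 := Int.floor_eq_zero_iff.2 ⟨h0.le, h1⟩
  have h3 : ⌈x⌉ = 1 := Int.ceil_eq_iff.2 ⟨by simpa using h0, by simpa using h1.le⟩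
  omega

theorem normalize_mem {x : Fin D → ℝ} (hx : x ∈ B.nerve) :
    B.normalize x ∈ carrier B.nerveComplex := by
  obtain ⟨I₀, I₁, -, ⟨i₁, hi₁⟩, ⟨z, hz⟩, h0, h1, h01⟩ := hx
  simp only [Set.mem_iInter] at hz
  have t0 : ∀ i ∈ I₀, cellType (B.normalize x) i = 0 := fun i hi =>
    cellType_eq_zero (by rw [normalize, h0 i hi, zero_div])
  have t1 : ∀ i ∈ I₁, cellType (B.normalize x) i = 2 := fun i hi =>
    cellType_eq_two (by rw [normalize, h1 i hi, div_self (B.radius_pos i).ne'])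
  have t01 : ∀ i, i ∉ I₀ → i ∉ I₁ → cellType (B.normalize x) i = 1 := fun i hi hi' =>
    cellType_eq_one (div_pos (h01 i hi hi').1 (B.radius_pos i))
      ((div_lt_one (B.radius_pos i)).2 (h01 i hi hi').2)
  refine ⟨fun i => ?_, ⟨i₁, t1 i₁ hi₁⟩, z, fun i hi => hz i fun h => hi (t0 i h)⟩
  by_cases h : i ∈ I₀
  · rw [t0 i h]; norm_num
  by_cases h' : i ∈ I₁
  · rw [t1 i h']; norm_num
  · rw [t01 i h h']; norm_num

variable {B}

theorem edist_lt_of_mem_ball {i : Fin D} (hB : B.radius i ≤ 1 / 100) {z z' : Z}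
    (hz : z ∈ B.ball i) (hz' : z' ∈ B.ball i) : edist z z' < 1 / 2 / 2 := by
  have h1 : edist z (B.center i) ≤ ENNReal.ofReal (1 / 100) :=
    (Metric.mem_closedEBall.1 hz).trans (ENNReal.ofReal_le_ofReal hB)
  have h2 : edist z' (B.center i) ≤ ENNReal.ofReal (1 / 100) :=
    (Metric.mem_closedEBall.1 hz').trans (ENNReal.ofReal_le_ofReal hB)
  refine (edist_triangle_right z z' (B.center i)).trans_lt ((add_le_add h1 h2).trans_lt ?_)
  have h3 : (1 / 2 / 2 : ℝ≥0∞) = ENNReal.ofReal (1 / 2 / 2) := by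
    rw [ENNReal.ofReal_div_of_pos two_pos, ENNReal.ofReal_div_of_pos two_pos]
    simp
  rw [h3, ← ENNReal.ofReal_add (by norm_num) (by norm_num)]
  exact (ENNReal.ofReal_lt_ofReal_iff (by norm_num)).2 (by norm_num)

/-- The normalized coordinates of the image of a point in the nerve. -/
noncomputable def NerveCoordinates.pos (φ : B.NerveCoordinates) (z : Z) : Fin D → ℝ :=
  B.normalize (φ.toNerve z)

theorem NerveCoordinates.continuous_pos (φ : B.NerveCoordinates) : Continuous φ.pos :=
  B.continuous_normalize.comp (continuous_subtype_val.comp φ.toNerve.continuous)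

theorem NerveCoordinates.pos_mem (φ : B.NerveCoordinates) (z : Z) :
    φ.pos z ∈ carrier B.nerveComplex := B.normalize_mem (φ.toNerve z).2

theorem NerveCoordinates.mem_ball (φ : B.NerveCoordinates) {z : Z} {v : Fin D → ℤ}
    (hv : IsFace v (cellType (φ.pos z))) {i : Fin D} (hi : v i ≠ 0) : z ∈ B.ball i := by
  by_contra h
  have h0 : cellType (φ.pos z) i = 0 := cellType_eq_zero (by
    change φ.toFun i z / B.radius i = 0
    rw [φ.eq_zero i z h, zero_div])
  have := hv.eq_or i
  omega

/-- This shared coordinate is the source of the distance estimates: the points chosen for all faces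
of a cell lie in one ball `B i`. It is where the condition that `I₁` is nonempty enters. -/
theorem exists_face_eq_two {c : Fin D → ℤ} (hc : c ∈ B.nerveComplex) :
    ∃ i, ∀ v, IsFace v c → v i = 2 := by
  obtain ⟨-, ⟨i, hi⟩, -⟩ := hc
  refine ⟨i, fun v hv => ?_⟩
  have := hv.eq_or i
  omega

/-! ### Tracks from the nerve map to `f` -/

section PathSystem

variable {S : Type*} [TopologicalSpace S]

/-- The paths that run from the image of `z` in the nerve straight to a vertex, and from there in
the short class to `f z`. -/
def NerveCoordinates.IsTrack (φ : B.NerveCoordinates) (f : C(Z, S)) (ζ : (Fin D → ℤ) → Z)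
    (g : (Fin D → ℝ) → S) (z : Z) (v : Fin D → ℤ) {a : S} (p : Path a (f z)) : Prop :=
  IsFace v (cellType (φ.pos z)) ∧ (∀ i, v i % 2 = 0) ∧
    ∃ (p₁ : Path a (f (ζ v))) (p₂ : Path (f (ζ v)) (f z)),
      IsImagePath (closedCell (cellType (φ.pos z))) g (segPath (φ.pos z) (LatticeCell.center v)) p₁ ∧
        IsShortClass f p₂ ∧ p.Homotopic (p₁.trans p₂)

variable {φ : B.NerveCoordinates} {f : C(Z, S)} {ζ : (Fin D → ℤ) → Z} {g : (Fin D → ℝ) → S}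

theorem edist_vertex_lt (hB : ∀ i, B.radius i ≤ 1 / 100)
    (hζ : ∀ c ∈ B.nerveComplex, ∀ i, c i ≠ 0 → ζ c ∈ B.ball i) {c : Fin D → ℤ}
    (hc : c ∈ B.nerveComplex) {v w : Fin D → ℤ} (hv : IsFace v c) (hw : IsFace w c) :
    edist (ζ v) (ζ w) < 1 / 2 / 2 := by
  obtain ⟨i, hi⟩ := exists_face_eq_two hc
  have h := B.isComplex_nerveComplex c hc
  exact edist_lt_of_mem_ball (hB i) (hζ v (h v hv) i (by rw [hi v hv]; norm_num))
    (hζ w (h w hw) i (by rw [hi w hw]; norm_num))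

/-- The point `z` belongs to the same ball as `ζ v`, because the `i`-th coordinate function vanishes
outside `B i`. -/
theorem edist_vertex_point_lt (hB : ∀ i, B.radius i ≤ 1 / 100)
    (hζ : ∀ c ∈ B.nerveComplex, ∀ i, c i ≠ 0 → ζ c ∈ B.ball i) {z : Z} {v : Fin D → ℤ}
    (hv : IsFace v (cellType (φ.pos z))) : edist (ζ v) z < 1 / 2 / 2 := by
  obtain ⟨i, hi⟩ := exists_face_eq_two (φ.pos_mem z)
  have h2 : v i ≠ 0 := by rw [hi v hv]; norm_num
  exact edist_lt_of_mem_ball (hB i)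
    (hζ v (B.isComplex_nerveComplex _ (φ.pos_mem z) v hv) i h2) (φ.mem_ball hv h2)

theorem exists_isTrack (hZ : HasShortPaths Z) (hB : ∀ i, B.radius i ≤ 1 / 100)
    (hζ : ∀ c ∈ B.nerveComplex, ∀ i, c i ≠ 0 → ζ c ∈ B.ball i)
    (hg : ContinuousOn g (carrier B.nerveComplex))
    (hgood : ∀ c ∈ B.nerveComplex, IsShortOn f ζ c g) {z : Z} {v : Fin D → ℤ}
    (hv : IsFace v (cellType (φ.pos z))) (hv2 : ∀ i, v i % 2 = 0) {a : S} (ha : g (φ.pos z) = a) :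
    ∃ p : Path a (f z), φ.IsTrack f ζ g z v p := by
  obtain ⟨p₁, hp₁⟩ := IsImagePath.exists_path
    (hg.mono (closedCell_subset_carrier B.isComplex_nerveComplex (φ.pos_mem z)))
    (segPath_mem (convex_closedCell _) (mem_closedCell_cellType (φ.pos z))
      (center_mem_closedCell_iff.2 hv)) ha ((hgood _ (φ.pos_mem z)).vertex v hv hv2)
  obtain ⟨p₂, hp₂⟩ := IsShortClass.exists_path (f := f) hZ
    ((edist_vertex_point_lt hB hζ hv).trans_le ENNReal.half_le_self)
  exact ⟨p₁.trans p₂, hv, hv2, p₁, p₂, hp₁, hp₂, Path.Homotopic.refl _⟩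

/-- Let `r` be the image of the segment from `v` to `w`. The triangle with corners `φ.pos z`, `v`,
`w` lies in one convex cell, so `p₁ · r ≃ q₁`. As `r` is short, uniqueness of short classes gives `r
· q₂ ≃ p₂`. -/
theorem NerveCoordinates.IsTrack.homotopic (hZ : HasShortPaths Z)
    (hf : ∀ (z : Z) (γ : Path z z), curveLength γ ≤ 1 →
      (γ.map f.continuous).Homotopic (Path.refl (f z)))
    (hB : ∀ i, B.radius i ≤ 1 / 100)
    (hζ : ∀ c ∈ B.nerveComplex, ∀ i, c i ≠ 0 → ζ c ∈ B.ball i)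
    (hg : ContinuousOn g (carrier B.nerveComplex))
    (hgood : ∀ c ∈ B.nerveComplex, IsShortOn f ζ c g) {z : Z} {v w : Fin D → ℤ} {a : S}
    {p q : Path a (f z)} (hp : φ.IsTrack f ζ g z v p) (hq : φ.IsTrack f ζ g z w q) :
    p.Homotopic q := by
  obtain ⟨hv, hv2, p₁, p₂, hp₁, hp₂, hp⟩ := hp
  obtain ⟨hw, hw2, q₁, q₂, hq₁, hq₂, hq⟩ := hq
  have hc := φ.pos_mem z
  have hgc := hg.mono (closedCell_subset_carrier B.isComplex_nerveComplex hc)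
  have hζ' := fun c hc v w hv hw => edist_vertex_lt (c := c) (v := v) (w := w) hB hζ hc hv hw
  obtain ⟨r, hr⟩ := IsImagePath.exists_path hgc
    (segPath_mem (convex_closedCell _) (center_mem_closedCell_iff.2 hv)
      (center_mem_closedCell_iff.2 hw)) ((hgood _ hc).vertex v hv hv2)
    ((hgood _ hc).vertex w hw hw2)
  have hrs := isShortClass_of_isImagePath hZ hf B.isComplex_nerveComplex hζ' hg hgood hc hv hw
    hv2 hw2 hr
  have h1 : (p₁.trans r).Homotopic q₁ := homotopic_of_triangle (convex_closedCell _) hgc hp₁ hr hq₁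
  have h2 : (r.trans q₂).Homotopic p₂ :=
    (hrs.trans hZ hf (hζ' _ hc _ _ hv hw) (edist_vertex_point_lt hB hζ hw) hq₂).homotopic hf hp₂
  refine hp.trans (Path.Homotopic.trans ?_ hq.symm)
  exact (((Path.Homotopic.refl p₁).hcomp h2.symm).trans (Path.Homotopic.assoc _ _ _).symm).trans
    (h1.hcomp (Path.Homotopic.refl q₂))

/-- The straight paths to a common vertex vary continuously. -/
theorem homotopic_of_isImagePath_vertex (hg : ContinuousOn g (carrier B.nerveComplex))
    {F : C(Z, S)} (hF : ∀ z, F z = g (φ.pos z)) {z z' : Z} (γ : Path z z') {v : Fin D → ℤ}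
    (hγ : ∀ t, IsFace v (cellType (φ.pos (γ t)))) {s : S} {p : Path (F z) s}
    {q : Path (F z') s} (hp : IsImagePath (closedCell (cellType (φ.pos z))) g
      (segPath (φ.pos z) (LatticeCell.center v)) p) (hq : IsImagePath (closedCell (cellType (φ.pos z'))) g
      (segPath (φ.pos z') (LatticeCell.center v)) q) :
    ((γ.map F.continuous).trans q).Homotopic p := by
  let K : Set (ℝ × ℝ) := Set.Icc 0 1 ×ˢ Set.Icc 0 1
  have hK : Convex ℝ K := (convex_Icc 0 1).prod (convex_Icc 0 1)
  -- The square of all segments from points over `γ` to the common vertex `v`. It stays in the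
  -- complex because `v` is a vertex of every cell met along `γ`, and its side at `v` is constant.
  let A : ℝ × ℝ → Fin D → ℝ := fun x => AffineMap.lineMap (φ.pos (γ.extend x.1)) (LatticeCell.center v) x.2
  have hA : Continuous A := by
    simp only [A, AffineMap.lineMap_apply_module]
    have h := φ.continuous_pos.comp (γ.continuous_extend.comp continuous_fst : Continuous
      fun x : ℝ × ℝ => γ.extend x.1)
    exact ((continuous_const.sub continuous_snd).smul h).add (continuous_snd.smul continuous_const)
  have hAmem : Set.MapsTo A K (carrier B.nerveComplex) := by
    rintro ⟨a, b⟩ ⟨ha, hb⟩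
    have hext : γ.extend a = γ ⟨a, ha⟩ := γ.extend_apply ha
    have hface := hγ ⟨a, ha⟩
    refine closedCell_subset_carrier B.isComplex_nerveComplex (φ.pos_mem (γ ⟨a, ha⟩)) ?_
    simp only [A, hext]
    exact (convex_closedCell _).lineMap_mem (mem_closedCell_cellType _)
      (center_mem_closedCell_iff.2 hface) hb
  have hG : ContinuousOn (g ∘ A) K := hg.comp hA.continuousOn hAmem
  have hfst : ∀ (x y : ℝ × ℝ) (t : unitInterval), segPath x y t =
      ((1 - (t : ℝ)) * x.1 + t * y.1, (1 - (t : ℝ)) * x.2 + t * y.2) := by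
    intro x y t
    simp [segPath_apply, AffineMap.lineMap_apply_module]
    rfl
  have i1 : IsImagePath K (g ∘ A) (segPath (0, 0) (1, 0)) (γ.map F.continuous) := by
    intro t
    rw [hfst]
    refine ⟨⟨by simp, by simp⟩, ?_⟩
    simp [A, hF]
  have i2 : IsImagePath K (g ∘ A) (segPath (1, 0) (1, 1)) q := by
    intro t
    rw [hfst]
    refine ⟨⟨by simp, by simp⟩, ?_⟩
    rw [(hq t).2, segPath_apply]
    simp [A]
  have i3 : IsImagePath K (g ∘ A) (segPath (0, 0) (0, 1)) p := by
    intro t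
    rw [hfst]
    refine ⟨⟨by simp, by simp⟩, ?_⟩
    rw [(hp t).2, segPath_apply]
    simp [A]
  have i4 : IsImagePath K (g ∘ A) (segPath (0, 1) (1, 1)) (Path.refl s) := by
    intro t
    rw [hfst]
    refine ⟨⟨by simp, by simp⟩, ?_⟩
    have h1 := (hp 1).2
    rw [Path.target, Path.target] at h1
    simp [A, h1]
  exact ((i1.trans i2).homotopic hK hG (i3.trans i4)).trans ⟨Path.Homotopy.transRefl p⟩

end PathSystem

end BallCover

/-! ### Local consistency of the tracks and the conclusion -/

open BallCover in
/-- The tracks form a locally consistent system of paths. -/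
theorem isPathSystem_isTrack {Z S : Type*} [EMetricSpace Z] {n D : ℕ}
    [ChartedSpace (EuclideanSpace ℝ (Fin n)) Z] [TopologicalSpace S] {B : BallCover Z D}
    {φ : B.NerveCoordinates} {f F : C(Z, S)} {ζ : (Fin D → ℤ) → Z} {g : (Fin D → ℝ) → S}
    (hF : ∀ z, F z = g (φ.pos z)) (hZ : HasShortPaths Z)
    (hf : ∀ (z : Z) (γ : Path z z), curveLength γ ≤ 1 →
      (γ.map f.continuous).Homotopic (Path.refl (f z)))
    (hB : ∀ i, B.radius i ≤ 1 / 100)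
    (hζ : ∀ c ∈ B.nerveComplex, ∀ i, c i ≠ 0 → ζ c ∈ B.ball i)
    (hg : ContinuousOn g (carrier B.nerveComplex))
    (hgood : ∀ c ∈ B.nerveComplex, IsShortOn f ζ c g) :
    IsPathSystem F f fun z p => ∃ v, φ.IsTrack f ζ g z v p where
  exists_path z := by
    obtain ⟨v, hv, hv2⟩ := exists_vertex (cellType (φ.pos z))
    obtain ⟨p, hp⟩ := exists_isTrack hZ hB hζ hg hgood hv hv2 (hF z).symm
    exact ⟨p, v, hp⟩
  iff_homotopic := by
    rintro z p p' ⟨v, hv⟩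
    refine ⟨fun ⟨w, hw⟩ => hv.homotopic hZ hf hB hζ hg hgood hw, fun h => ⟨v, ?_⟩⟩
    obtain ⟨h1, h2, p₁, p₂, h3, h4, h5⟩ := hv
    exact ⟨h1, h2, p₁, p₂, h3, h4, h.symm.trans h5⟩
  locally_consistent z₀ := by
    obtain ⟨U, hU, hUshort⟩ := exists_nhds_isShortClass (n := n) f hZ z₀
    obtain ⟨V, hV, hVface⟩ := exists_nhds_isFace B.finite_nerveComplex (φ.pos z₀)
    obtain ⟨v, hv, hv2⟩ := exists_vertex (cellType (φ.pos z₀))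
    refine ⟨U ∩ φ.pos ⁻¹' V, Filter.inter_mem hU (φ.continuous_pos.continuousAt hV), ?_⟩
    rintro z z' γ hγ p p' ⟨w, hw⟩ ⟨w', hw'⟩
    -- All cells met near `φ.pos z₀` have the cell of `φ.pos z₀` as a face, hence also its vertex
    -- `v`. By independence of the vertex, the tracks at both ends of `γ` may be taken through `v`.
    have hface : ∀ t, IsFace v (cellType (φ.pos (γ t))) := fun t =>
      hv.trans (hVface _ (hγ t).2 (φ.pos_mem _))
    have hfz : IsFace v (cellType (φ.pos z)) := by simpa using hface 0
    have hfz' : IsFace v (cellType (φ.pos z')) := by simpa using hface 1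
    obtain ⟨q, hq⟩ := exists_isTrack (φ := φ) (z := z) hZ hB hζ hg hgood hfz hv2 (hF z).symm
    obtain ⟨q', hq'⟩ := exists_isTrack (φ := φ) (z := z') hZ hB hζ hg hgood hfz' hv2 (hF z').symm
    have hpq := hw.homotopic hZ hf hB hζ hg hgood hq
    have hpq' := hw'.homotopic hZ hf hB hζ hg hgood hq'
    obtain ⟨-, -, q₁, q₂, hq₁, hq₂, hqq⟩ := hq
    obtain ⟨-, -, q₁', q₂', hq₁', hq₂', hqq'⟩ := hq'
    obtain ⟨hγs, hzz'⟩ := hUshort z z' γ fun t => (hγ t).1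
    -- The consistency square splits at `f (ζ v)` into two triangles: one is filled in the nerve,
    -- the other by uniqueness of short classes.
    have h1 : ((γ.map F.continuous).trans q₁').Homotopic q₁ :=
      homotopic_of_isImagePath_vertex hg hF γ hface hq₁ hq₁'
    have h2 : (q₂.trans (γ.map f.continuous)).Homotopic q₂' :=
      (hq₂.trans hZ hf (edist_vertex_point_lt hB hζ hfz) hzz' hγs).homotopic hf hq₂'
    have h3 : ((γ.map F.continuous).trans p').Homotopic (q₁.trans q₂') :=
      (((Path.Homotopic.refl _).hcomp (hpq'.trans hqq')).trans
        (Path.Homotopic.assoc _ _ _).symm).trans (h1.hcomp (Path.Homotopic.refl _))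
    have h4 : (p.trans (γ.map f.continuous)).Homotopic (q₁.trans q₂') :=
      (((hpq.trans hqq).hcomp (Path.Homotopic.refl _)).trans
        (Path.Homotopic.assoc _ _ _)).trans ((Path.Homotopic.refl _).hcomp h2)
    exact h3.trans h4.symm

theorem lemma8 {n m D : ℕ}
    {Z : Type*} [EMetricSpace Z] [CompactSpace Z]
    [ChartedSpace (EuclideanSpace ℝ (Fin n)) Z] [IsManifold (𝓡 n) ∞ Z]
    [Bundle.RiemannianBundle (fun z : Z => TangentSpace (𝓡 n) z)]
    [IsContMDiffRiemannianBundle (𝓡 n) ∞ (EuclideanSpace ℝ (Fin n))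
      (fun z : Z => TangentSpace (𝓡 n) z)]
    [IsRiemannianManifold (𝓡 n) Z]
    {S : Type*} [TopologicalSpace S] [T2Space S] [CompactSpace S]
    [ChartedSpace (EuclideanSpace ℝ (Fin m)) S]
    (hS : IsAspherical S)
    (B : BallCover Z D) (hB : ∀ i, B.radius i ≤ 1 / 100)
    (φ : B.NerveCoordinates)
    (f : C(Z, S))
    (hf : ∀ (z : Z) (γ : Path z z), curveLength γ ≤ 1 →
      (γ.map f.continuous).Homotopic (Path.refl (f z))) :
    ∃ ψ : C(B.nerve, S), (ψ.comp φ.toNerve).Homotopic f := by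
  classical
  have : Nonempty S := hS.pathConnected.nonempty
  -- For empty `Z` there are no points to choose for the vertices, and a constant map suffices.
  rcases isEmpty_or_nonempty Z with hempty | ⟨⟨z₀⟩⟩
  · obtain ⟨s₀⟩ := ‹Nonempty S›
    refine ⟨ContinuousMap.const _ s₀, ?_⟩
    have : (ContinuousMap.const B.nerve s₀).comp φ.toNerve = f := by
      ext z
      exact hempty.elim z
    rw [this]
  have hZ : HasShortPaths Z := hasShortPaths_of_isRiemannianManifold (I := 𝓡 n)
  -- A common point of the balls of the cell is chosen; the value `z₀` off the complex is only a
  -- default.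
  let ζ : (Fin D → ℤ) → Z := fun c => if hc : c ∈ B.nerveComplex then hc.2.2.choose else z₀
  have hζ : ∀ c ∈ B.nerveComplex, ∀ i, c i ≠ 0 → ζ c ∈ B.ball i := by
    intro c hc i hi
    simp only [ζ, dif_pos hc]
    exact hc.2.2.choose_spec i hi
  obtain ⟨g, hg, hgood⟩ := exists_isShortOn (f := f) (ζ := ζ) hS.subsingleton_homotopyGroup hZ hf
    B.isComplex_nerveComplex B.finite_nerveComplex
    fun c hc v w hv hw => BallCover.edist_vertex_lt hB hζ hc hv hw
  let ψ : C(B.nerve, S) := ⟨fun x => g (B.normalize x),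
    hg.comp_continuous (B.continuous_normalize.comp continuous_subtype_val)
      fun x => B.normalize_mem x.2⟩
  exact ⟨ψ, (isPathSystem_isTrack (n := n) (F := ψ.comp φ.toNerve) (φ := φ) (fun z => rfl) hZ hf hB
    hζ hg hgood).homotopic (n := n) hS.subsingleton_homotopyGroup⟩
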